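/- **Setting** (in $\mathbb R^4$). Let $\mathcal L_4$ be the set of lines $(p,0)+\mathbb R v$ with $p\in[-\frac14,\frac14]^3$, $v\in S^3$, $v_4\ge\frac12$, with $d(l,l')=|p-p'|+\angle(v,v')$. The $\delta$-tube $T$ with coaxial line $l\in\mathcal L_4$ is $N_{8\delta}(l)\cap[-1,1]^4$, and $v(T)=v$. A $\delta$-cube is a set $[0,\delta)^4+p$ with $p\in(\delta\mathbb Z)^4$. A shaded collection $(\mathbb T,Y)_\delta$ is a finite set $\mathbb T$ of $\delta$-tubes with, for each $T\in\mathbb T$, a set $Y(T)\subset T$ that is a union of $\delta$-cubes. Write $E_{\mathbb T}=\bigcup_{T\in\mathbb T}Y(T)$, $\mathcal Q(Y)$ for the set of $\delta$-cubes contained in some $Y(T)$, and $\mathbb T_Y(Q)=\{T\in\mathbb T: Q\subset Y(T)\}$. Two $\delta$-tubes are essentially distinct if $d(l,l')>\delta$, and essentially parallel if $\angle(v,v')\le\delta$. *Covers.* A $\rho$-tube $\tilde T$ (with $\rho\ge\delta$) covers a $\delta$-tube $T$ if $d(l,\tilde l)\le\rho/2$; $\mathbb T[\tilde T]$ is the set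 of $T\in\mathbb T$ covered by $\tilde T$. $(\tilde{\mathbb T},\tilde Y)_\rho$ covers $(\mathbb T,Y)_\delta$ if every $T\in\mathbb T$ is covered by some $\tilde T\in\tilde{\mathbb T}$, and $Y(T)\subset\tilde Y(\tilde T)$ whenever $\tilde T\in\tilde{\mathbb T}$ and $T\in\mathbb T[\tilde T]$. *Refinements.* $(\mathbb T',Y')_\delta$ is a $t$-refinement of $(\mathbb T,Y)_\delta$ if $\mathbb T'\subset\mathbb T$, $Y'(T)\subset Y(T)$ for $T\in\mathbb T'$, and $\sum_{T\in\mathbb T'}|Y'(T)|\ge t\sum_{T\in\mathbb T}|Y(T)|$. It is a refinement with constant $C$ if it is a $C^{-1}|\log\delta|^{-C}$-refinement. *Extremality.* Call $(\mathbb T,Y)_\delta$ $(s,t)$-admissible if its tubes are pairwise essentially distinct; for each $\delta\le r\le1$, $\mathbb T$ can be covered by a finite set of $r$-tubes of which at most $\delta^{-t}$ are essentially parallel to any given $r$-tube; and $\sum_{T\in\mathbb T}|Y(T)|\ge\delta^s$. Let $M(s,t,\delta)$ be the infimum of $|E_{\mathbb T}|$ over $(s,t)$-admissible $(\mathbb T,Y)_\delta$,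 let $N(s,t)=\limsup_{\delta\to0^+}\frac{\log M(s,t,\delta)}{\log\delta}$ and $\sigma_4=\inf_{(s,t)\in(0,1)^2}N(s,t)$. $(\mathbb T,Y)_\delta$ is $\eta$-extremal if it is $(\eta,\eta)$-admissible and $|E_{\mathbb T}|\le\delta^{\sigma_4-\eta}$. *Unit rescaling.* Let the $\rho$-tube $\tilde T$ with coaxial line $\tilde l$ cover all tubes in $\mathbb T$. Let $\phi$ be a rigid motion sending $\tilde l\cap\{x_4=0\}$ to $0$ and $\tilde l$ to the $x_4$-axis, followed by $x\mapsto(\frac{cx_1}{\rho},\frac{cx_2}{\rho},\frac{cx_3}{\rho},cx_4)$ with $c=\frac14$. The unit rescaling of $(\mathbb T,Y)_\delta$ relative to $\tilde T$ is the shaded collection at scale $\delta/\rho$ whose coaxial lines are the images under $\phi$ of those of $\mathbb T$, and where the shading of the image of $T$ is the union of the $\delta/\rho$-cubes that meet $\phi(Y(T))$. Saying that it is $\varepsilon$-extremal includes that it is a shaded collection (its lines lie in $\mathcal L_4$, its shadings lie in its tubes), and means that this holds for every choice of the rigid motion. *Planiness.* $(\tilde{\mathbb T},\tilde Y)_\rho$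 is plany with constant $C$ if for each $\rho$-cube $\tilde Q$ there is a 2-plane $\Pi(\tilde Q)$ with $\angle(v(\tilde T),\Pi(\tilde Q))\le C\rho$ for all $\tilde T\in\tilde{\mathbb T}_{\tilde Y}(\tilde Q)$. **Lemma.** There is an absolute constant $C>0$ such that for every $\varepsilon>0$ there exist $\eta>0$ and $\delta_0>0$ such that the following holds for all $\delta\in(0,\delta_0]$. Let $(\mathbb T,Y)_\delta$ be an $\eta$-extremal collection and let $\rho\in[\delta^{1-\varepsilon},\delta^{\varepsilon}]$. Then at least one of the following is true. (a) There is a refinement $(\mathbb T',Y')_\delta$ of $(\mathbb T,Y)_\delta$ with constant $C$ such that for each $Q\in\mathcal Q(Y')$ $$\#\{(T_1,T_2,T_3)\in\mathbb T'_{Y'}(Q)^3:\ |v(T_1)\wedge v(T_2)\wedge v(T_3)|\ge C^{-1}\rho^2\}\ \ge\ C^{-1}\,(\#\mathbb T'_{Y'}(Q))^3.$$ (b) There are a $\delta^{23\eta+2\varepsilon^3}$-refinement $(\mathbb T',Y')_\delta$ of $(\mathbb T,Y)_\delta$ and a shaded collection $(\tilde{\mathbb T},\tilde Y)_\rho$ covering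 $(\mathbb T',Y')_\delta$ such that: 1. each $T\in\mathbb T'$ is covered by exactly one tube of $\tilde{\mathbb T}$; 2. $(\tilde{\mathbb T},\tilde Y)_\rho$ is $\varepsilon$-extremal; 3. for each $\tilde T\in\tilde{\mathbb T}$, the unit rescaling of $(\mathbb T'[\tilde T],Y')_\delta$ relative to $\tilde T$ is $\varepsilon$-extremal; 4. $\#\tilde{\mathbb T}_{\tilde Y}(\tilde Q)\le C\rho^{-\sigma_4-\varepsilon}$ for each $\tilde Q\in\mathcal Q(\tilde Y)$; 5. $\#\mathbb T'[\tilde T]_{Y'}(Q)\le C(\delta/\rho)^{-\sigma_4-\varepsilon}$ for each $Q\in\mathcal Q(Y')$ and $\tilde T\in\tilde{\mathbb T}$; and there is a number $\mu_{\mathrm{fine}}>0$ such that $C^{-1}\mu_{\mathrm{fine}}\le\#\mathbb T'[\tilde T]_{Y'}(Q)\le C\mu_{\mathrm{fine}}$ for each $\tilde T\in\tilde{\mathbb T}$ and each $\delta$-cube $Q\subset E_{\mathbb T'[\tilde T]}$; 6. $(\tilde{\mathbb T},\tilde Y)_\rho$ is plany with constant $C$. -/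

import Mathlib

open MeasureTheory Filter Topology

noncomputable section

namespace StickyKakeya

/-- Four-dimensional Euclidean space; the coordinate `x_4` has index `3`. -/
abbrev E4 : Type := EuclideanSpace ℝ (Fin 4)

/-- The parameter set of `𝓛₄`, the lines `(p, 0) + ℝ v` with `p ∈ [-1/4, 1/4]³` and `v` a unit
vector with `v₄ ≥ 1/2`. The point `base` is `(p, 0)` and `dir` is `v`; both are determined by the
line. A `δ`-tube is given by its coaxial line, so collections of tubes are sets of such lines. -/
@[ext]
structure TubeLine where
  base : E4
  dir : E4
  base_last : base 3 = 0
  abs_base_le : ∀ i, |base i| ≤ 1 / 4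
  norm_dir : ‖dir‖ = 1
  half_le_dir : 1 / 2 ≤ dir 3

namespace TubeLine

/-- The line itself, as a set of points. -/
def line (l : TubeLine) : Set E4 := Set.range fun t : ℝ => l.base + t • l.dir

/-- The angle between the directions of two lines. -/
def angle (l l' : TubeLine) : ℝ := InnerProductGeometry.angle l.dir l'.dir

/-- `d(l, l') = |p - p'| + ∠(v, v')`. -/
def lineDist (l l' : TubeLine) : ℝ := ‖l.base - l'.base‖ + l.angle l'

/-- The `δ`-tube with coaxial line `l`: the part in `[-1, 1]⁴` of the `2nδ`-neighbourhood of `l`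
(`n = 4`). -/
def tube (δ : ℝ) (l : TubeLine) : Set E4 :=
  Metric.thickening (2 * 4 * δ) l.line ∩ {x | ∀ i, x i ∈ Set.Icc (-1 : ℝ) 1}

/-- The `ρ`-tube around `u` covers the (thinner) tube around `l`. -/
def CoversTube (ρ : ℝ) (u l : TubeLine) : Prop := l.lineDist u ≤ ρ / 2

end TubeLine

/-- The `δ`-cube `[0, δ)⁴ + δ k`, `k ∈ ℤ⁴`. -/
def cube (δ : ℝ) (k : Fin 4 → ℤ) : Set E4 :=
  {x | ∀ i, x i ∈ Set.Ico (δ * k i) (δ * k i + δ)}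

/-- A finite collection `(𝕋, Y)_δ` of `δ`-tubes with a shading. The shading `Y(T)` is the union of
the `δ`-cubes with index in `shade T`. As the `δ`-cubes with different indices are disjoint, a
`δ`-cube is contained in `Y(T)` if and only if its index lies in `shade T`.
(Values of `shade` outside `tubes` are irrelevant.) -/
structure ShadedTubes (δ : ℝ) where
  tubes : Finset TubeLine
  shade : TubeLine → Finset (Fin 4 → ℤ)
  cube_subset_tube : ∀ T ∈ tubes, ∀ k ∈ shade T, cube δ k ⊆ T.tube δ

namespace ShadedTubes

variable {δ ρ : ℝ}

/-- The shading `Y(T)` as a set of points. -/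
def shadeSet (𝒯 : ShadedTubes δ) (T : TubeLine) : Set E4 := ⋃ k ∈ 𝒯.shade T, cube δ k

/-- The union `E_𝕋` of all the shadings `Y(T)`, `T ∈ 𝕋`. -/
def unionSet (𝒯 : ShadedTubes δ) : Set E4 := ⋃ T ∈ 𝒯.tubes, 𝒯.shadeSet T

/-- The mass `∑_{T ∈ 𝕋} |Y(T)|`. -/
def mass (𝒯 : ShadedTubes δ) : ℝ := ∑ T ∈ 𝒯.tubes, volume.real (𝒯.shadeSet T)

/-- `𝓠(Y)`: (the indices of) the `δ`-cubes that lie in at least one shading. -/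
def cubes (𝒯 : ShadedTubes δ) : Set (Fin 4 → ℤ) := {k | ∃ T ∈ 𝒯.tubes, k ∈ 𝒯.shade T}

open Classical in
/-- `𝕋_Y(Q)`: the tubes whose shading contains the `δ`-cube `Q` with index `k`. -/
def through (𝒯 : ShadedTubes δ) (k : Fin 4 → ℤ) : Finset TubeLine :=
  𝒯.tubes.filter fun T => k ∈ 𝒯.shade T

open Classical in
/-- `(𝕋[U], Y)_δ`: the tubes covered by the `ρ`-tube around `U`, with their shadings. -/
def coveredBy (𝒯 : ShadedTubes δ) (ρ : ℝ) (U : TubeLine) : ShadedTubes δ where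
  tubes := 𝒯.tubes.filter fun T => U.CoversTube ρ T
  shade := 𝒯.shade
  cube_subset_tube T hT := 𝒯.cube_subset_tube T (Finset.mem_filter.mp hT).1

/-- `𝒯'` is a `t`-refinement of `𝒯`. -/
def IsRefinementBy (𝒯' : ShadedTubes δ) (t : ℝ) (𝒯 : ShadedTubes δ) : Prop :=
  𝒯'.tubes ⊆ 𝒯.tubes ∧ (∀ T ∈ 𝒯'.tubes, 𝒯'.shade T ⊆ 𝒯.shade T) ∧ t * 𝒯.mass ≤ 𝒯'.mass

/-- `𝒯'` is a refinement of `𝒯`, the mass dropping at most by the factor `C⁻¹ |log δ|^{-C}`. -/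
def IsRefinement (𝒯' : ShadedTubes δ) (C : ℝ) (𝒯 : ShadedTubes δ) : Prop :=
  𝒯'.IsRefinementBy (C⁻¹ * |Real.log δ| ^ (-C)) 𝒯

/-- `(𝕋̃, Ỹ)_ρ` covers `(𝕋, Y)_δ`. -/
def Covers (𝒰 : ShadedTubes ρ) (𝒯 : ShadedTubes δ) : Prop :=
  (∀ T ∈ 𝒯.tubes, ∃ U ∈ 𝒰.tubes, U.CoversTube ρ T) ∧
    ∀ U ∈ 𝒰.tubes, ∀ T ∈ (𝒯.coveredBy ρ U).tubes, 𝒯.shadeSet T ⊆ 𝒰.shadeSet U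

/-- The tubes are pairwise essentially distinct. -/
def EssentiallyDistinct (𝒯 : ShadedTubes δ) : Prop :=
  ∀ T ∈ 𝒯.tubes, ∀ T' ∈ 𝒯.tubes, T ≠ T' → δ < T.lineDist T'

open Classical in
/-- For each `δ ≤ r ≤ 1` the tubes can be covered by a set of `r`-tubes, at most `δ^{-t}` of which
are essentially parallel to any given `r`-tube. -/
def StickyAtAllScales (𝒯 : ShadedTubes δ) (t : ℝ) : Prop :=
  ∀ r : ℝ, δ ≤ r → r ≤ 1 → ∃ 𝒱 : Finset TubeLine,
    (∀ T ∈ 𝒯.tubes, ∃ V ∈ 𝒱, V.CoversTube r T) ∧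
    ∀ V : TubeLine, ((𝒱.filter fun V' => V'.angle V ≤ r).card : ℝ) ≤ δ ^ (-t)

/-- The class of shaded collections over which the infimum `M(s, t, δ)` is taken. -/
def IsAdmissible (𝒯 : ShadedTubes δ) (s t : ℝ) : Prop :=
  𝒯.EssentiallyDistinct ∧ 𝒯.StickyAtAllScales t ∧ δ ^ s ≤ 𝒯.mass

end ShadedTubes

/-- `M(s, t, δ)`, the infimum of `|⋃_T Y(T)|` over the admissible collections. (For fixed `s`, `t`
admissible collections exist once `δ` is small, and only small `δ` matter below.) -/
def minVolume (s t δ : ℝ) : ℝ :=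
  sInf {m | ∃ 𝒯 : ShadedTubes δ, 𝒯.IsAdmissible s t ∧ m = volume.real 𝒯.unionSet}

/-- `N(s, t) = limsup_{δ → 0+} log M(s, t, δ) / log δ`. -/
def volumeExponent (s t : ℝ) : ℝ :=
  limsup (fun δ : ℝ => Real.log (minVolume s t δ) / Real.log δ) (𝓝[>] 0)

/-- `σ₄`, the infimum of `N(s, t)` over `(s, t) ∈ (0, 1)²`. -/
def sigma4 : ℝ := sInf (Set.image2 volumeExponent (Set.Ioo 0 1) (Set.Ioo 0 1))

/-- The anisotropic dilation `x ↦ (c x₁ / ρ, c x₂ / ρ, c x₃ / ρ, c x₄)`. The dimensional constant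
is `c = 1/4`: small enough for rescaled lines to lie in `𝓛₄` and rescaled shadings in their tubes. -/
def dilation (ρ : ℝ) (x : E4) : E4 :=
  WithLp.toLp 2 fun i => if i = 3 then 1 / 4 * x i else 1 / 4 / ρ * x i

namespace ShadedTubes

variable {δ ρ : ℝ}

/-- `(𝕋, Y)_δ` is `η`-extremal. -/
def IsExtremal (𝒯 : ShadedTubes δ) (η : ℝ) : Prop :=
  𝒯.IsAdmissible η η ∧ volume.real 𝒯.unionSet ≤ δ ^ (sigma4 - η)

/-- `𝒯'` is the image of `𝒯` under the rescaling map `φ`: its coaxial lines are the images of those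
of `𝒯`, and its shadings are the unions of the `δ'`-cubes that intersect the image of the shading. -/
def IsImageUnder {δ' : ℝ} (𝒯' : ShadedTubes δ') (φ : E4 → E4) (𝒯 : ShadedTubes δ) : Prop :=
  (∀ T ∈ 𝒯.tubes, ∃ T' ∈ 𝒯'.tubes, T'.line = φ '' T.line ∧
    ∀ k, k ∈ 𝒯'.shade T' ↔ (cube δ' k ∩ φ '' 𝒯.shadeSet T).Nonempty) ∧
  ∀ T' ∈ 𝒯'.tubes, ∃ T ∈ 𝒯.tubes, T'.line = φ '' T.line

/-- The unit rescaling of `𝒯` relative to the `ρ`-tube around `U` is `ε`-extremal. The rigid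
motion `g` in the rescaling map sends `U ∩ {x₄ = 0}` to the origin and `U` to the `x₄`-axis; it is
unique only up to symmetries of that axis, and the property is required for every choice of it.
That the rescaling is again a shaded collection (lines in `𝓛₄`, shadings inside the tubes) is part
of the property. -/
def RescalingIsExtremal (𝒯 : ShadedTubes δ) (ρ : ℝ) (U : TubeLine) (ε : ℝ) : Prop :=
  ∀ g : E4 ≃ᵃⁱ[ℝ] E4, g U.base = 0 → g '' U.line = {x | ∀ i, i ≠ 3 → x i = 0} →
    ∃ 𝒯' : ShadedTubes (δ / ρ),
      𝒯'.IsImageUnder (fun x => dilation ρ (g x)) 𝒯 ∧ 𝒯'.IsExtremal ε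

/-- `(𝕋, Y)_ρ` is plany with implicit constant `C`: for each `ρ`-cube there is a plane with which
all tubes through the cube make an angle at most `Cρ`. (The angle of a vector with a plane is its
angle with its orthogonal projection, and `π / 2` when the projection vanishes.) -/
def IsPlany (𝒯 : ShadedTubes ρ) (C : ℝ) : Prop :=
  ∀ k : Fin 4 → ℤ, ∃ P : Submodule ℝ E4, Module.finrank ℝ P = 2 ∧
    ∀ T ∈ 𝒯.through k, InnerProductGeometry.angle T.dir (P.starProjection T.dir) ≤ C * ρ

end ShadedTubes

/-- `|u ∧ v ∧ w|`, the square root of the Gram determinant. -/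
def wedgeNorm (u v w : E4) : ℝ := Real.sqrt (Matrix.gram ℝ ![u, v, w]).det

open Classical in
/-- The triples in `𝕋_Y(Q)³` with `|v(T₁) ∧ v(T₂) ∧ v(T₃)| ≥ θ`. -/
def ShadedTubes.wideTriples {δ : ℝ} (𝒯 : ShadedTubes δ) (k : Fin 4 → ℤ) (θ : ℝ) :
    Finset (TubeLine × TubeLine × TubeLine) :=
  (𝒯.through k ×ˢ 𝒯.through k ×ˢ 𝒯.through k).filter fun T =>
    θ ≤ wedgeNorm T.1.dir T.2.1.dir T.2.2.dir

end StickyKakeya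

end

/-!
A shaded collection is a finite set `I` of incidences `(T, k)` between tubes and `δ`-cubes: the mass
is `δ⁴ #I`, the volume of the union is `δ⁴` times the number of cubes met by `I`, and a refinement
is a subset of `I`. All losses below are powers of `A = δ^{-η}`, which exceeds every constant and
every logarithm in sight.

**Wide or narrow** (`wide_or_narrow`). A cube is wide if a fixed proportion of the triples of tubes
through it has wedge at least `ρ² / 100`. If the wide cubes carry half of `I`, keeping them gives
the trilinear case. At a cube `k` that is not wide some pair of directions makes almost all triples
degenerate, so that half of the tubes through `k` lie within `ρ` of a plane `P k`; keep these.

**Pruning** (`exists_isPruned`). Stickiness at scale `ρ`, followed by the choice of a separated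
subfamily of the covering tubes, assigns to each remaining tube `T` one `ρ`-tube `u T`, and no other
`ρ`-tube of the family covers `T`. Pigeonholing makes all nonzero multiplicities of cubes inside a
single covering tube comparable to one number `μ`. The incidences inside one `ρ`-tube can be rescaled
to scale `δ / ρ` (`exists_rescaling`), and the cubes can be replaced by `ρ`-cubes
(`exists_coarse`). Both operations preserve stickiness up to constants and turn large subsets of
incidences into admissible collections (`IsPruned.exists_coarse_admissible`,
`IsPruned.exists_fine_admissible`), so the definition of `σ₄` gives lower bounds for the volume of
every such collection (`exists_volume_lower_bound`).

**Two scales** (`TwoScaleBounds.exists_twoScale`). The union of the extremal collection has volume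
at most `A δ^{σ₄} = A ρ^{σ₄} (δ / ρ)^{σ₄}`, whereas the collections at scales `ρ` and `δ / ρ` have
volume at least `ρ^{σ₄ + ζ}` and `(δ / ρ)^{σ₄ + ζ}`. Hence both lower bounds are nearly attained.
Quantitatively, the fine bound forces `μ ≲ (δ / ρ)^{-σ₄ - ζ}`; the coarse bound forces most `ρ`-cubes
to meet few covering tubes; and comparison with the total mass then bounds `μ` from below and all
volumes from above. Every set removed in this argument is a union of classes of incidences with the
same `u T` and the same cube, so the multiplicities inside covering tubes stay comparable to `μ`.

**Planes.** In each coarse cell `m` one `δ`-cube `k m` is chosen, and only those covering tubes are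
kept that contain a narrow incidence at `k m`; by Cauchy-Schwarz some choice keeps enough of the
mass. All `ρ`-tubes kept at `m` are then within `2 ρ` of the single plane `P (k m)`, which is the
planiness of the coarse collection (`IsPruned.exists_plany`). It remains to choose `ζ = e³`
with `e = min ε (1 / 4)` and `η` small in terms of `e` and of the exponent for which the lower bounds hold (`wide_or_plany`).
-/

noncomputable section

namespace StickyKakeya

open scoped Classical

/-! ### Finite combinatorics -/

/-- Points whose coordinates are bounded by `M` fall into at most `(2 M + 1) ^ Fintype.card ι` unit
cells. If no more than `K` of them are within distance `< 1` of any given one, there are at most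
`K * (2 M + 1) ^ Fintype.card ι` of them. -/
theorem card_le_mul_of_grid {α ι : Type*} [Fintype ι] (s : Finset α) (f : α → ι → ℝ) (M K : ℕ)
    (hM : ∀ a ∈ s, ∀ i, |f a i| ≤ M)
    (hK : ∀ a ∈ s, ∀ t ⊆ s, (∀ b ∈ t, ∀ i, |f a i - f b i| < 1) → t.card ≤ K) :
    s.card ≤ K * (2 * M + 1) ^ Fintype.card ι := by
  have hmaps : ∀ a ∈ s, (fun i => ⌊f a i⌋) ∈
      Fintype.piFinset (fun _ : ι => Finset.Icc (-(M : ℤ)) M) := by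
    intro a ha
    rw [Fintype.mem_piFinset]
    intro i
    have := abs_le.mp (hM a ha i)
    rw [Finset.mem_Icc]
    constructor
    · rw [Int.le_floor]; push_cast; exact this.1
    · have : ((⌊f a i⌋ : ℤ) : ℝ) ≤ (M : ℝ) := (Int.floor_le _).trans this.2
      exact_mod_cast this
  have hcard : (Fintype.piFinset (fun _ : ι => Finset.Icc (-(M : ℤ)) M)).card
      = (2 * M + 1) ^ Fintype.card ι := by
    rw [Fintype.card_piFinset, Finset.prod_const, Int.card_Icc, Finset.card_univ]
    congr 1
    omega
  rw [← hcard]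
  refine Finset.card_le_mul_card_image_of_maps_to hmaps K ?_
  intro c _
  by_cases hne : ∃ a ∈ s, (fun i => ⌊f a i⌋) = c
  · obtain ⟨a, ha, rfl⟩ := hne
    refine hK a ha _ (Finset.filter_subset _ _) fun b hb i => ?_
    rw [Finset.mem_filter] at hb
    exact Int.abs_sub_lt_one_of_floor_eq_floor (congrFun hb.2 i).symm
  · rw [Finset.filter_eq_empty_iff.mpr]
    · simp
    · intro a ha h
      exact hne ⟨a, ha, h⟩

theorem card_le_of_grid {α ι : Type*} [Fintype ι] (s : Finset α) (f : α → ι → ℝ) (M : ℕ)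
    (hM : ∀ a ∈ s, ∀ i, |f a i| ≤ M)
    (hinj : ∀ a ∈ s, ∀ b ∈ s, (∀ i, |f a i - f b i| < 1) → a = b) :
    s.card ≤ (2 * M + 1) ^ Fintype.card ι := by
  refine (card_le_mul_of_grid s f M 1 hM ?_).trans_eq (one_mul _)
  intro a ha t ht hat
  rw [Finset.card_le_one]
  intro b hb c hc
  exact (hinj a ha b (ht hb) (hat b hb)).symm.trans (hinj a ha c (ht hc) (hat c hc))

/-- The version of `card_le_of_grid` in which only differences are known to be bounded. -/
theorem card_le_of_grid_of_sub {α ι : Type*} [Fintype ι] (s : Finset α) (f : α → ι → ℝ) (M : ℕ)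
    (hM : ∀ a ∈ s, ∀ b ∈ s, ∀ i, |f a i - f b i| ≤ M)
    (hinj : ∀ a ∈ s, ∀ b ∈ s, (∀ i, |f a i - f b i| < 1) → a = b) :
    s.card ≤ (2 * M + 1) ^ Fintype.card ι := by
  rcases s.eq_empty_or_nonempty with rfl | ⟨a₀, ha₀⟩
  · simp
  · refine card_le_of_grid s (fun a i => f a i - f a₀ i) M (fun a ha i => hM a ha a₀ ha₀ i) ?_
    intro a ha b hb h
    exact hinj a ha b hb fun i => by simpa using h i

theorem card_le_of_int_sub_le (s : Finset ℤ) {M : ℝ} (hM : 0 ≤ M)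
    (h : ∀ a ∈ s, ∀ b ∈ s, ((a : ℝ) - b) ≤ M) : (s.card : ℝ) ≤ M + 1 := by
  rcases s.eq_empty_or_nonempty with rfl | hne
  · simp; linarith
  · have hsub : s ⊆ Finset.Icc (s.min' hne) (s.max' hne) := fun a ha =>
      Finset.mem_Icc.mpr ⟨s.min'_le a ha, s.le_max' a ha⟩
    have h1 := Finset.card_le_card hsub
    rw [Int.card_Icc] at h1
    have h2 := h _ (s.max'_mem hne) _ (s.min'_mem hne)
    have h3 : s.min' hne ≤ s.max' hne := s.min'_le _ (s.max'_mem hne)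
    have h4 : (s.card : ℤ) ≤ s.max' hne + 1 - s.min' hne := by omega
    have h5 : ((s.card : ℤ) : ℝ) ≤ ((s.max' hne + 1 - s.min' hne : ℤ) : ℝ) := by exact_mod_cast h4
    push_cast at h5
    linarith

/-- Greedy choice of an independent set `t` for a symmetric relation `r`: it is maximal, and if
every point is related to at most `K` points, it carries a `1 / K` fraction of the weight. -/
theorem exists_independent {α : Type*} (r : α → α → Prop) (hrefl : ∀ a, r a a)
    (hsymm : ∀ a b, r a b → r b a) (w : α → ℕ) (K : ℕ) (s : Finset α)
    (hK : ∀ a ∈ s, (s.filter fun b => r a b).card ≤ K) :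
    ∃ t ⊆ s, (∀ a ∈ t, ∀ b ∈ t, a ≠ b → ¬ r a b) ∧ (∀ a ∈ s, ∃ b ∈ t, r a b) ∧
      ∑ a ∈ s, w a ≤ K * ∑ a ∈ t, w a := by
  induction hn : s.card using Nat.strong_induction_on generalizing s with
  | _ n ih =>
  rcases s.eq_empty_or_nonempty with rfl | hne
  · exact ⟨∅, by simp⟩
  obtain ⟨a, ha, hmax⟩ := s.exists_max_image w hne
  set s' := s.filter fun b => ¬ r a b with hs'
  have hlt : s'.card < n := by
    rw [← hn]
    exact Finset.card_lt_card (Finset.filter_ssubset.mpr ⟨a, ha, by simpa using hrefl a⟩)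
  obtain ⟨t, hts, hind, hmaxl, hw⟩ := ih _ hlt s' (fun b hb => (Finset.card_le_card
    (Finset.filter_subset_filter _ (Finset.filter_subset _ _))).trans
      (hK b (Finset.mem_of_mem_filter b hb))) rfl
  have hat : ∀ b ∈ t, ¬ r a b := fun b hb => (Finset.mem_filter.mp (hts hb)).2
  have hat' : a ∉ t := fun h => hat a h (hrefl a)
  refine ⟨insert a t, ?_, ?_, ?_, ?_⟩
  · intro b hb
    rcases Finset.mem_insert.mp hb with rfl | hb
    · exact ha
    · exact Finset.mem_of_mem_filter b (hts hb)
  · intro b hb c hc hbc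
    rcases Finset.mem_insert.mp hb with hb' | hb' <;> rcases Finset.mem_insert.mp hc with hc' | hc'
    · exact absurd (hb'.trans hc'.symm) hbc
    · exact hb' ▸ hat c hc'
    · exact fun h => hat b hb' (hsymm _ _ (hc' ▸ h))
    · exact hind b hb' c hc' hbc
  · intro b hb
    by_cases hab : r a b
    · exact ⟨a, Finset.mem_insert_self _ _, hsymm _ _ hab⟩
    · obtain ⟨c, hc, h⟩ := hmaxl b (Finset.mem_filter.mpr ⟨hb, hab⟩)
      exact ⟨c, Finset.mem_insert_of_mem hc, h⟩
  · rw [← Finset.sum_filter_add_sum_filter_not s (fun b => r a b), Finset.sum_insert hat', mul_add]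
    refine add_le_add ?_ hw
    calc ∑ b ∈ s.filter fun b => r a b, w b
        ≤ (s.filter fun b => r a b).card • w a := Finset.sum_le_card_nsmul _ _ _ fun b hb =>
          hmax b (Finset.mem_of_mem_filter b hb)
      _ ≤ K * w a := by rw [smul_eq_mul]; exact Nat.mul_le_mul_right _ (hK a ha)

theorem exists_maximal_independent {α : Type*} (r : α → α → Prop) (hrefl : ∀ a, r a a)
    (hsymm : ∀ a b, r a b → r b a) (s : Finset α) :
    ∃ t ⊆ s, (∀ a ∈ t, ∀ b ∈ t, a ≠ b → ¬ r a b) ∧ ∀ a ∈ s, ∃ b ∈ t, r a b := by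
  obtain ⟨t, h1, h2, h3, -⟩ := exists_independent r hrefl hsymm (fun _ => 0) s.card s
    (fun _ _ => Finset.card_filter_le _ _)
  exact ⟨t, h1, h2, h3⟩

theorem exists_card_le_mul_card_fiber {α β : Type*} [DecidableEq β] (s : Finset α) (f : α → β)
    (t : Finset β) (ht : t.Nonempty) (hf : ∀ a ∈ s, f a ∈ t) :
    ∃ b ∈ t, s.card ≤ t.card * (s.filter fun a => f a = b).card := by
  obtain ⟨b, hb, hmax⟩ := t.exists_max_image (fun b => (s.filter fun a => f a = b).card) ht
  refine ⟨b, hb, ?_⟩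
  rw [mul_comm]
  exact Finset.card_le_mul_card_image_of_maps_to hf _ hmax

/-- Removing the fibres of `f` with fewer than `c` elements loses at most `c` elements per fibre. -/
theorem card_small_fibers_le {α β : Type*} [DecidableEq β] (s : Finset α) (f : α → β) {c N : ℝ}
    (hc : 0 ≤ c) (hN : ((s.image f).card : ℝ) ≤ N) :
    ((s.filter fun a => ((s.filter fun b => f b = f a).card : ℝ) < c).card : ℝ) ≤ c * N := by
  set s' := s.filter fun a => ((s.filter fun b => f b = f a).card : ℝ) < c with hs'
  have h1 : (s'.card : ℝ) = ∑ b ∈ s.image f, ((s'.filter fun a => f a = b).card : ℝ) := by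
    have := Finset.card_eq_sum_card_fiberwise (s := s') (t := s.image f) (f := f)
      (fun a ha => Finset.mem_image_of_mem f (Finset.mem_of_mem_filter a ha))
    exact_mod_cast this
  rw [h1]
  calc ∑ b ∈ s.image f, ((s'.filter fun a => f a = b).card : ℝ) ≤ ∑ _b ∈ s.image f, c := by
        refine Finset.sum_le_sum fun b _ => ?_
        rcases (s'.filter fun a => f a = b).eq_empty_or_nonempty with h | ⟨a, ha⟩
        · rw [h]; simpa using hc
        · rw [Finset.mem_filter] at ha
          obtain ⟨ha, rfl⟩ := ha
          refine le_trans ?_ (Finset.mem_filter.mp ha).2.le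
          exact_mod_cast Finset.card_le_card
            (Finset.filter_subset_filter _ (Finset.filter_subset _ _))
    _ = (s.image f).card * c := by rw [Finset.sum_const, nsmul_eq_mul]
    _ ≤ c * N := by nlinarith

theorem card_le_mul_card_image_real {α β : Type*} [DecidableEq β] (s : Finset α) (f : α → β) {c : ℝ}
    (h : ∀ a ∈ s, ((s.filter fun b => f b = f a).card : ℝ) ≤ c) :
    (s.card : ℝ) ≤ c * (s.image f).card := by
  have h1 : (s.card : ℝ) = ∑ b ∈ s.image f, ((s.filter fun a => f a = b).card : ℝ) := by
    have := Finset.card_eq_sum_card_fiberwise (s := s) (t := s.image f) (f := f)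
      (fun a ha => Finset.mem_image_of_mem f ha)
    exact_mod_cast this
  rw [h1, mul_comm, ← nsmul_eq_mul]
  refine Finset.sum_le_card_nsmul _ _ _ fun b hb => ?_
  obtain ⟨a, ha, rfl⟩ := Finset.mem_image.mp hb
  exact h a ha

/-! ### The metric on lines -/

section

theorem abs_coord_le_norm (x : E4) (i : Fin 4) : |x i| ≤ ‖x‖ := by
  simpa using PiLp.norm_apply_le x i

theorem norm_sq_eq_coords (x : E4) : ‖x‖ ^ 2 = x 0 ^ 2 + x 1 ^ 2 + x 2 ^ 2 + x 3 ^ 2 := by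
  rw [EuclideanSpace.norm_sq_eq, Fin.sum_univ_four]
  simp

theorem norm_le_of_abs_coord_le {x : E4} {a : ℝ} (h : ∀ i, |x i| ≤ a) : ‖x‖ ≤ 2 * a := by
  have ha : 0 ≤ a := (abs_nonneg _).trans (h 0)
  refine abs_le_of_sq_le_sq' ?_ (by linarith) |>.2
  rw [norm_sq_eq_coords]
  have h' : ∀ i, x i ^ 2 ≤ a ^ 2 := fun i => sq_le_sq' (abs_le.mp (h i)).1 (abs_le.mp (h i)).2
  linarith [h' 0, h' 1, h' 2, h' 3]

section Angle

variable {V : Type*} [NormedAddCommGroup V] [InnerProductSpace ℝ V]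

theorem norm_sub_eq_two_mul_sin {x y : V} (hx : ‖x‖ = 1) (hy : ‖y‖ = 1) :
    ‖x - y‖ = 2 * Real.sin (InnerProductGeometry.angle x y / 2) := by
  set t := InnerProductGeometry.angle x y with ht
  have h0 : 0 ≤ Real.sin (t / 2) := Real.sin_nonneg_of_nonneg_of_le_pi
    (by linarith [InnerProductGeometry.angle_nonneg x y])
    (by linarith [InnerProductGeometry.angle_le_pi x y, Real.pi_pos])
  have h1 : ‖x - y‖ ^ 2 = (2 * Real.sin (t / 2)) ^ 2 := by
    rw [norm_sub_sq_real, hx, hy]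
    have h2 := InnerProductGeometry.cos_angle x y
    rw [hx, hy, ← ht] at h2
    have h3 : Real.cos t = 1 - 2 * Real.sin (t / 2) ^ 2 := by
      have h4 := Real.cos_two_mul (t / 2)
      have h5 := Real.sin_sq_add_cos_sq (t / 2)
      rw [show 2 * (t / 2) = t by ring] at h4
      linarith
    have h6 : inner ℝ x y = Real.cos t := by rw [h2]; simp
    rw [h6, h3]
    ring
  exact (sq_eq_sq₀ (norm_nonneg _) (by positivity)).mp h1

theorem norm_sub_le_angle {x y : V} (hx : ‖x‖ = 1) (hy : ‖y‖ = 1) :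
    ‖x - y‖ ≤ InnerProductGeometry.angle x y := by
  rw [norm_sub_eq_two_mul_sin hx hy]
  have := Real.sin_le (x := InnerProductGeometry.angle x y / 2)
    (by linarith [InnerProductGeometry.angle_nonneg x y])
  linarith

theorem angle_le_two_mul_norm_sub {x y : V} (hx : ‖x‖ = 1) (hy : ‖y‖ = 1) :
    InnerProductGeometry.angle x y ≤ 2 * ‖x - y‖ := by
  rw [norm_sub_eq_two_mul_sin hx hy]
  set t := InnerProductGeometry.angle x y with ht
  have h0 := InnerProductGeometry.angle_nonneg x y
  have h := Real.mul_le_sin (x := t / 2) (by linarith)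
    (by linarith [InnerProductGeometry.angle_le_pi x y])
  have h1 : 1 / 2 ≤ 2 / Real.pi := by
    rw [div_le_div_iff₀ (by norm_num) Real.pi_pos]
    linarith [Real.pi_le_four]
  have h2 : 1 / 2 * (t / 2) ≤ 2 / Real.pi * (t / 2) := mul_le_mul_of_nonneg_right h1 (by linarith)
  linarith

end Angle

namespace TubeLine

theorem abs_dir_le (l : TubeLine) (i : Fin 4) : |l.dir i| ≤ 1 :=
  (abs_coord_le_norm _ _).trans l.norm_dir.le

theorem dir_three_pos (l : TubeLine) : 0 < l.dir 3 := by linarith [l.half_le_dir]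

theorem norm_dir_sub_le_angle (l l' : TubeLine) : ‖l.dir - l'.dir‖ ≤ l.angle l' :=
  norm_sub_le_angle l.norm_dir l'.norm_dir

theorem angle_le_two_mul_norm (l l' : TubeLine) : l.angle l' ≤ 2 * ‖l.dir - l'.dir‖ :=
  angle_le_two_mul_norm_sub l.norm_dir l'.norm_dir

theorem angle_nonneg (l l' : TubeLine) : 0 ≤ l.angle l' := InnerProductGeometry.angle_nonneg _ _

theorem angle_comm (l l' : TubeLine) : l.angle l' = l'.angle l :=
  InnerProductGeometry.angle_comm _ _

theorem angle_triangle (l l' l'' : TubeLine) : l.angle l'' ≤ l.angle l' + l'.angle l'' :=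
  InnerProductGeometry.angle_le_angle_add_angle _ _ _

theorem angle_self (l : TubeLine) : l.angle l = 0 := by
  refine InnerProductGeometry.angle_self ?_
  intro h
  have := l.norm_dir
  rw [h, norm_zero] at this
  exact zero_ne_one this

theorem lineDist_comm (l l' : TubeLine) : l.lineDist l' = l'.lineDist l := by
  rw [lineDist, lineDist, norm_sub_rev, angle_comm]

theorem lineDist_triangle (l l' l'' : TubeLine) :
    l.lineDist l'' ≤ l.lineDist l' + l'.lineDist l'' := by
  have h1 := norm_sub_le_norm_sub_add_norm_sub l.base l'.base l''.base
  have h2 := angle_triangle l l' l''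
  unfold lineDist
  linarith

theorem lineDist_self (l : TubeLine) : l.lineDist l = 0 := by
  rw [lineDist, angle_self, sub_self, norm_zero, add_zero]

theorem angle_le_lineDist (l l' : TubeLine) : l.angle l' ≤ l.lineDist l' := by
  unfold lineDist; linarith [norm_nonneg (l.base - l'.base)]

theorem norm_base_sub_le_lineDist (l l' : TubeLine) : ‖l.base - l'.base‖ ≤ l.lineDist l' := by
  unfold lineDist; linarith [angle_nonneg l l']

theorem norm_dir_sub_le_lineDist (l l' : TubeLine) : ‖l.dir - l'.dir‖ ≤ l.lineDist l' :=
  (norm_dir_sub_le_angle _ _).trans (angle_le_lineDist _ _)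

/-- Lines at mutual distance more than `s` in a ball of radius `a`: a packing bound. -/
theorem card_le_of_separated (S : Finset TubeLine) (W : TubeLine) {s a : ℝ} (hs : 0 < s) (M : ℕ)
    (hM : 6 * a / s ≤ M) (hW : ∀ T ∈ S, T.lineDist W ≤ a)
    (hsep : ∀ T ∈ S, ∀ T' ∈ S, T ≠ T' → s < T.lineDist T') :
    S.card ≤ (2 * M + 1) ^ 8 := by
  have hcard := card_le_of_grid S (ι := Fin 4 ⊕ Fin 4)
    (fun T => Sum.elim (fun i => (T.base i - W.base i) / (s / 6))
      (fun i => (T.dir i - W.dir i) / (s / 6))) M ?_ ?_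
  · simpa using hcard
  · have key : ∀ x : ℝ, |x| ≤ a → |x / (s / 6)| ≤ M := by
      intro x hx
      rw [abs_div, abs_of_pos (show 0 < s / 6 by positivity)]
      refine le_trans ?_ hM
      rw [div_le_div_iff₀ (by positivity) hs]
      nlinarith
    rintro T hT (i | i)
    · refine key _ ?_
      have := abs_coord_le_norm (T.base - W.base) i
      rw [PiLp.sub_apply] at this
      linarith [norm_base_sub_le_lineDist T W, hW T hT]
    · refine key _ ?_
      have := abs_coord_le_norm (T.dir - W.dir) i
      rw [PiLp.sub_apply] at this
      linarith [norm_dir_sub_le_lineDist T W, hW T hT]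
  · intro T hT T' hT' h
    by_contra hne
    have hlt := hsep T hT T' hT' hne
    have key : ∀ x y : ℝ, |x / (s / 6) - y / (s / 6)| < 1 → |x - y| ≤ s / 6 := by
      intro x y hxy
      rw [← sub_div, abs_div, abs_of_pos (show 0 < s / 6 by positivity),
        div_lt_one (by positivity)] at hxy
      exact hxy.le
    have h1 : ‖T.base - T'.base‖ ≤ 2 * (s / 6) := norm_le_of_abs_coord_le fun i => by
      have := key _ _ (h (Sum.inl i))
      rw [PiLp.sub_apply]
      simpa using this
    have h2 : ‖T.dir - T'.dir‖ ≤ 2 * (s / 6) := norm_le_of_abs_coord_le fun i => by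
      have := key _ _ (h (Sum.inr i))
      rw [PiLp.sub_apply]
      simpa using this
    have h3 := angle_le_two_mul_norm T T'
    unfold lineDist at hlt
    linarith

/-- The last coordinate of a direction is a Lipschitz function of the other three. -/
theorem angle_le_of_abs_dir_sub_le {l l' : TubeLine} {h : ℝ}
    (hh : ∀ i : Fin 3, |l.dir i.castSucc - l'.dir i.castSucc| ≤ h) : l.angle l' ≤ 24 * h := by
  have h0 : |l.dir 0 - l'.dir 0| ≤ h := hh 0
  have h1 : |l.dir 1 - l'.dir 1| ≤ h := hh 1
  have h2 : |l.dir 2 - l'.dir 2| ≤ h := hh 2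
  have hpos : 0 ≤ h := (abs_nonneg _).trans h0
  have key : ∀ i, |l.dir i - l'.dir i| ≤ h → |l.dir i ^ 2 - l'.dir i ^ 2| ≤ 2 * h := by
    intro i hi
    rw [sq_sub_sq, abs_mul]
    have : |l.dir i + l'.dir i| ≤ 2 :=
      (abs_add_le _ _).trans (by linarith [l.abs_dir_le i, l'.abs_dir_le i])
    nlinarith [abs_nonneg (l.dir i + l'.dir i), abs_nonneg (l.dir i - l'.dir i)]
  have e1 := norm_sq_eq_coords l.dir
  have e2 := norm_sq_eq_coords l'.dir
  rw [l.norm_dir] at e1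
  rw [l'.norm_dir] at e2
  have h3 : |l.dir 3 - l'.dir 3| ≤ 6 * h := by
    have h4 : |l.dir 3 ^ 2 - l'.dir 3 ^ 2| ≤ 6 * h := by
      have := abs_le.mp (key 0 h0)
      have := abs_le.mp (key 1 h1)
      have := abs_le.mp (key 2 h2)
      rw [abs_le]
      constructor <;> linarith
    rw [sq_sub_sq, abs_mul] at h4
    have h5 : 1 ≤ |l.dir 3 + l'.dir 3| := by
      refine le_trans ?_ (le_abs_self _)
      linarith [l.half_le_dir, l'.half_le_dir]
    nlinarith [abs_nonneg (l.dir 3 - l'.dir 3)]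
  have h6 : ‖l.dir - l'.dir‖ ≤ 2 * (6 * h) := by
    refine norm_le_of_abs_coord_le fun i => ?_
    rw [PiLp.sub_apply]
    fin_cases i
    · exact h0.trans (by linarith)
    · exact h1.trans (by linarith)
    · exact h2.trans (by linarith)
    · exact h3
  linarith [angle_le_two_mul_norm l l']

/-- A bound for the number of directions (with multiplicity) in `r`-caps gives a bound in larger
caps. The exponent `3` is the dimension of the sphere of directions. -/
theorem card_angle_le (𝒱 : Finset TubeLine) {r a : ℝ} (hr : 0 < r) (K M : ℕ)
    (hK : ∀ W : TubeLine, (𝒱.filter fun V => V.angle W ≤ r).card ≤ K) (hM : 24 * a / r ≤ M)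
    (W : TubeLine) : (𝒱.filter fun V => V.angle W ≤ a).card ≤ K * (2 * M + 1) ^ 3 := by
  have hcard := card_le_mul_of_grid (𝒱.filter fun V => V.angle W ≤ a) (ι := Fin 3)
    (fun V i => (V.dir i.castSucc - W.dir i.castSucc) / (r / 24)) M K ?_ ?_
  · simpa using hcard
  · intro V hV i
    rw [Finset.mem_filter] at hV
    have h1 := abs_coord_le_norm (V.dir - W.dir) i.castSucc
    rw [PiLp.sub_apply] at h1
    have h2 := norm_dir_sub_le_angle V W
    rw [abs_div, abs_of_pos (show 0 < r / 24 by positivity)]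
    refine le_trans ?_ hM
    rw [div_le_div_iff₀ (by positivity) hr]
    have := hV.2
    nlinarith
  · intro V _ t ht htV
    refine (Finset.card_le_card fun V' hV' => ?_).trans (hK V)
    refine Finset.mem_filter.mpr ⟨Finset.mem_of_mem_filter _ (ht hV'), ?_⟩
    have := angle_le_of_abs_dir_sub_le (l := V') (l' := V) (h := r / 24) fun i => by
      have := htV V' hV' i
      rw [← sub_div, abs_div, abs_of_pos (show 0 < r / 24 by positivity),
        div_lt_one (by positivity), sub_sub_sub_cancel_right, abs_sub_comm] at this
      exact this.le
    linarith

end TubeLine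

end

/-! ### Cubes, volumes and incidences -/

section

/-- The corner `δ k` of the `δ`-cube with index `k`. -/
def corner (δ : ℝ) (k : Fin 4 → ℤ) : E4 := WithLp.toLp 2 fun i => δ * k i

@[simp]
theorem corner_apply (δ : ℝ) (k : Fin 4 → ℤ) (i : Fin 4) : corner δ k i = δ * k i := rfl

theorem corner_mem_cube {δ : ℝ} (hδ : 0 < δ) (k : Fin 4 → ℤ) : corner δ k ∈ cube δ k :=
  fun i => by simp [hδ]

theorem mem_cube_iff {δ : ℝ} (hδ : 0 < δ) (k : Fin 4 → ℤ) (x : E4) :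
    x ∈ cube δ k ↔ ∀ i, ⌊x i / δ⌋ = k i := by
  refine forall_congr' fun i => ?_
  rw [Int.floor_eq_iff, le_div_iff₀ hδ, div_lt_iff₀ hδ, Set.mem_Ico]
  constructor <;> rintro ⟨h1, h2⟩ <;> constructor <;> nlinarith

theorem abs_sub_corner_le {δ : ℝ} {k : Fin 4 → ℤ} {x : E4} (hx : x ∈ cube δ k) (i : Fin 4) :
    |x i - δ * k i| ≤ δ := by
  have h1 := (hx i).1
  have h2 := (hx i).2
  rw [abs_le]; constructor <;> linarith

theorem norm_sub_corner_le {δ : ℝ} {k : Fin 4 → ℤ} {x : E4} (hx : x ∈ cube δ k) :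
    ‖x - corner δ k‖ ≤ 2 * δ :=
  norm_le_of_abs_coord_le fun i => by
    rw [PiLp.sub_apply, corner_apply]; exact abs_sub_corner_le hx i

theorem cube_eq_preimage (δ : ℝ) (k : Fin 4 → ℤ) :
    cube δ k = (WithLp.ofLp : E4 → Fin 4 → ℝ) ⁻¹'
      Set.pi Set.univ fun i => Set.Ico (δ * k i) (δ * k i + δ) := by
  ext x
  simp only [cube, Set.mem_preimage, Set.mem_pi, Set.mem_univ, forall_const]
  rfl

theorem measurableSet_cube (δ : ℝ) (k : Fin 4 → ℤ) : MeasurableSet (cube δ k) := by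
  rw [cube_eq_preimage]
  exact (PiLp.volume_preserving_ofLp (Fin 4)).measurable
    (MeasurableSet.univ_pi fun i => measurableSet_Ico)

theorem volume_cube (δ : ℝ) (k : Fin 4 → ℤ) : volume (cube δ k) = ENNReal.ofReal δ ^ 4 := by
  rw [cube_eq_preimage, (PiLp.volume_preserving_ofLp (Fin 4)).measure_preimage
    (MeasurableSet.univ_pi fun i => measurableSet_Ico).nullMeasurableSet, Real.volume_pi_Ico]
  simp

theorem disjoint_cube {δ : ℝ} (hδ : 0 < δ) {k k' : Fin 4 → ℤ} (h : k ≠ k') :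
    Disjoint (cube δ k) (cube δ k') := by
  rw [Set.disjoint_left]
  intro x hx hx'
  rw [mem_cube_iff hδ] at hx hx'
  exact h (funext fun i => (hx i).symm.trans (hx' i))

theorem volume_real_biUnion_cube {δ : ℝ} (hδ : 0 < δ) (F : Finset (Fin 4 → ℤ)) :
    volume.real (⋃ k ∈ F, cube δ k) = F.card * δ ^ 4 := by
  rw [measureReal_def, measure_biUnion_finset (fun k _ k' _ h => disjoint_cube hδ h)
    (fun k _ => measurableSet_cube δ k)]
  simp only [volume_cube, Finset.sum_const, nsmul_eq_mul, ENNReal.toReal_mul, ENNReal.toReal_natCast,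
    ENNReal.toReal_pow, ENNReal.toReal_ofReal hδ.le]

namespace ShadedTubes

variable {δ : ℝ}

/-- The incidences `(T, k)`: the `δ`-cube with index `k` lies in `Y(T)`. -/
def incidences (𝒯 : ShadedTubes δ) : Finset (TubeLine × (Fin 4 → ℤ)) :=
  (𝒯.tubes ×ˢ 𝒯.tubes.biUnion 𝒯.shade).filter fun p => p.2 ∈ 𝒯.shade p.1

theorem mem_incidences {𝒯 : ShadedTubes δ} {p : TubeLine × (Fin 4 → ℤ)} :
    p ∈ 𝒯.incidences ↔ p.1 ∈ 𝒯.tubes ∧ p.2 ∈ 𝒯.shade p.1 := by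
  simp only [incidences, Finset.mem_filter, Finset.mem_product, Finset.mem_biUnion]
  constructor
  · rintro ⟨⟨h1, -⟩, h2⟩; exact ⟨h1, h2⟩
  · rintro ⟨h1, h2⟩; exact ⟨⟨h1, p.1, h1, h2⟩, h2⟩

theorem card_incidences_fiber {𝒯 : ShadedTubes δ} {T : TubeLine} (hT : T ∈ 𝒯.tubes) :
    (𝒯.incidences.filter fun p => p.1 = T).card = (𝒯.shade T).card := by
  symm
  refine Finset.card_bij (fun k _ => (T, k)) ?_ ?_ ?_
  · intro k hk
    exact Finset.mem_filter.mpr ⟨mem_incidences.mpr ⟨hT, hk⟩, rfl⟩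
  · intro a _ b _ h
    exact (Prod.mk.inj h).2
  · rintro ⟨T', k⟩ hp
    obtain ⟨h1, rfl⟩ := Finset.mem_filter.mp hp
    exact ⟨k, (mem_incidences.mp h1).2, rfl⟩

theorem card_incidences (𝒯 : ShadedTubes δ) :
    𝒯.incidences.card = ∑ T ∈ 𝒯.tubes, (𝒯.shade T).card := by
  rw [Finset.card_eq_sum_card_fiberwise (f := Prod.fst) (t := 𝒯.tubes)
    (fun p hp => (mem_incidences.mp hp).1)]
  exact Finset.sum_congr rfl fun T hT => card_incidences_fiber hT

theorem mass_eq (hδ : 0 < δ) (𝒯 : ShadedTubes δ) : 𝒯.mass = 𝒯.incidences.card * δ ^ 4 := by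
  rw [mass, card_incidences]
  push_cast
  rw [Finset.sum_mul]
  exact Finset.sum_congr rfl fun T _ => volume_real_biUnion_cube hδ _

theorem volume_unionSet (hδ : 0 < δ) (𝒯 : ShadedTubes δ) :
    volume.real 𝒯.unionSet = (𝒯.incidences.image Prod.snd).card * δ ^ 4 := by
  rw [← volume_real_biUnion_cube hδ]
  congr 1
  ext x
  simp only [unionSet, shadeSet, Set.mem_iUnion, Finset.mem_image, exists_prop]
  constructor
  · rintro ⟨T, hT, k, hk, hx⟩
    exact ⟨k, ⟨(T, k), mem_incidences.mpr ⟨hT, hk⟩, rfl⟩, hx⟩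
  · rintro ⟨k, ⟨⟨T, k'⟩, hp, rfl⟩, hx⟩
    exact ⟨T, (mem_incidences.mp hp).1, k', (mem_incidences.mp hp).2, hx⟩

/-- The shaded collection with a given set of incidences. -/
def restrict (𝒯 : ShadedTubes δ) (J : Finset (TubeLine × (Fin 4 → ℤ))) (hJ : J ⊆ 𝒯.incidences) :
    ShadedTubes δ where
  tubes := J.image Prod.fst
  shade T := (J.filter fun p => p.1 = T).image Prod.snd
  cube_subset_tube T _ k hk := by
    obtain ⟨p, hp, rfl⟩ := Finset.mem_image.mp hk
    obtain ⟨hp', rfl⟩ := Finset.mem_filter.mp hp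
    have := mem_incidences.mp (hJ hp')
    exact 𝒯.cube_subset_tube _ this.1 _ this.2

variable {𝒯 : ShadedTubes δ} {J : Finset (TubeLine × (Fin 4 → ℤ))} {hJ : J ⊆ 𝒯.incidences}

theorem mem_restrict_shade {T : TubeLine} {k : Fin 4 → ℤ} :
    k ∈ (𝒯.restrict J hJ).shade T ↔ (T, k) ∈ J := by
  simp only [restrict, Finset.mem_image, Finset.mem_filter]
  constructor
  · rintro ⟨⟨T', k'⟩, ⟨h, rfl⟩, rfl⟩; exact h
  · intro h; exact ⟨(T, k), ⟨h, rfl⟩, rfl⟩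

theorem mem_restrict_tubes {T : TubeLine} :
    T ∈ (𝒯.restrict J hJ).tubes ↔ ∃ k, (T, k) ∈ J := by
  simp [restrict]

@[simp]
theorem incidences_restrict : (𝒯.restrict J hJ).incidences = J := by
  ext ⟨T, k⟩
  rw [mem_incidences, mem_restrict_shade, mem_restrict_tubes]
  exact ⟨fun h => h.2, fun h => ⟨⟨k, h⟩, h⟩⟩

theorem restrict_tubes_subset : (𝒯.restrict J hJ).tubes ⊆ 𝒯.tubes := by
  intro T hT
  obtain ⟨k, hk⟩ := mem_restrict_tubes.mp hT
  exact (mem_incidences.mp (hJ hk)).1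

theorem restrict_isRefinementBy (hδ : 0 < δ) {t : ℝ} (h : t * 𝒯.incidences.card ≤ J.card) :
    (𝒯.restrict J hJ).IsRefinementBy t 𝒯 := by
  refine ⟨restrict_tubes_subset, fun T _ k hk => ?_, ?_⟩
  · exact (mem_incidences.mp (hJ (mem_restrict_shade.mp hk))).2
  · rw [mass_eq hδ, mass_eq hδ, incidences_restrict, ← mul_assoc]
    exact mul_le_mul_of_nonneg_right h (by positivity)

theorem mem_through {T : TubeLine} {k : Fin 4 → ℤ} :
    T ∈ 𝒯.through k ↔ (T, k) ∈ 𝒯.incidences := by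
  rw [through, Finset.mem_filter, mem_incidences]

theorem card_through (k : Fin 4 → ℤ) :
    (𝒯.through k).card = (𝒯.incidences.filter fun p => p.2 = k).card := by
  refine Finset.card_bij (fun T _ => (T, k)) ?_ ?_ ?_
  · intro T hT
    exact Finset.mem_filter.mpr ⟨mem_through.mp hT, rfl⟩
  · intro a _ b _ h
    exact (Prod.mk.inj h).1
  · rintro ⟨T, k'⟩ hp
    obtain ⟨h1, rfl⟩ := Finset.mem_filter.mp hp
    exact ⟨T, mem_through.mpr h1, rfl⟩

theorem mem_cubes {k : Fin 4 → ℤ} : k ∈ 𝒯.cubes ↔ ∃ T, (T, k) ∈ 𝒯.incidences := by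
  simp only [cubes, Set.mem_ofPred_eq, mem_incidences]

theorem incidences_coveredBy (ρ : ℝ) (U : TubeLine) :
    (𝒯.coveredBy ρ U).incidences = 𝒯.incidences.filter fun p => U.CoversTube ρ p.1 := by
  ext p
  simp only [mem_incidences, Finset.mem_filter, coveredBy]
  tauto

end ShadedTubes

end

/-! ### Counting cubes along a tube -/

section

namespace TubeLine

/-- The point of the line at height `h` (its last coordinate is `h`). -/
def pt (l : TubeLine) (h : ℝ) : E4 := l.base + (h / l.dir 3) • l.dir

/-- The slopes `dir i / dir 3` of the line, as a graph over the last coordinate. -/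
def slope (l : TubeLine) (i : Fin 4) : ℝ := l.dir i / l.dir 3

theorem pt_apply (l : TubeLine) (h : ℝ) (i : Fin 4) : l.pt h i = l.base i + h * l.slope i := by
  simp only [pt, slope, PiLp.add_apply, PiLp.smul_apply, smul_eq_mul]
  ring

theorem slope_three (l : TubeLine) : l.slope 3 = 1 := div_self l.dir_three_pos.ne'

theorem norm_base_le (l : TubeLine) : ‖l.base‖ ≤ 1 / 2 := by
  have := norm_le_of_abs_coord_le l.abs_base_le
  linarith

theorem abs_slope_sub_le (l l' : TubeLine) (i : Fin 4) :
    |l.slope i - l'.slope i| ≤ 8 * ‖l.dir - l'.dir‖ := by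
  have h1 := abs_coord_le_norm (l.dir - l'.dir) i
  have h2 := abs_coord_le_norm (l.dir - l'.dir) 3
  rw [PiLp.sub_apply] at h1 h2
  have h3 := l.dir_three_pos
  have h4 := l'.dir_three_pos
  have h5 := l.half_le_dir
  have h6 := l'.half_le_dir
  have e : l.slope i - l'.slope i =
      ((l.dir i - l'.dir i) * l'.dir 3 - l'.dir i * (l.dir 3 - l'.dir 3)) /
        (l.dir 3 * l'.dir 3) := by
    unfold slope
    field_simp
    ring
  rw [e, abs_div, abs_of_pos (mul_pos h3 h4), div_le_iff₀ (mul_pos h3 h4)]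
  have h7 : |(l.dir i - l'.dir i) * l'.dir 3 - l'.dir i * (l.dir 3 - l'.dir 3)| ≤
      2 * ‖l.dir - l'.dir‖ := by
    refine (abs_sub _ _).trans ?_
    rw [abs_mul, abs_mul]
    have h8 := l'.abs_dir_le i
    have h9 := l'.abs_dir_le 3
    have h10 : |l.dir i - l'.dir i| * |l'.dir 3| ≤ ‖l.dir - l'.dir‖ * 1 := by gcongr
    have h11 : |l'.dir i| * |l.dir 3 - l'.dir 3| ≤ 1 * ‖l.dir - l'.dir‖ := by gcongr
    linarith
  have h12 : 1 / 4 ≤ l.dir 3 * l'.dir 3 := by nlinarith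
  nlinarith [norm_nonneg (l.dir - l'.dir)]

/-- A point of the tube is close to the point of the line at the same height. -/
theorem norm_sub_pt_le {l : TubeLine} {δ : ℝ} {x : E4} (hx : x ∈ l.tube δ) :
    ‖x - l.pt (x 3)‖ ≤ 24 * δ := by
  obtain ⟨y, ⟨t, rfl⟩, hy⟩ := Metric.mem_thickening_iff.mp hx.1
  rw [dist_eq_norm] at hy
  have h1 := abs_coord_le_norm (x - (l.base + t • l.dir)) 3
  simp only [PiLp.sub_apply, PiLp.add_apply, PiLp.smul_apply, smul_eq_mul, l.base_last,
    zero_add] at h1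
  have h2 := l.dir_three_pos
  have h3 := l.half_le_dir
  have h4 : |t - x 3 / l.dir 3| ≤ 16 * δ := by
    have : t - x 3 / l.dir 3 = -(x 3 - t * l.dir 3) / l.dir 3 := by field_simp; ring
    rw [this, abs_div, abs_neg, abs_of_pos h2, div_le_iff₀ h2]
    nlinarith [norm_nonneg (x - (l.base + t • l.dir))]
  have e : x - l.pt (x 3) = (x - (l.base + t • l.dir)) + (t - x 3 / l.dir 3) • l.dir := by
    unfold pt
    rw [sub_smul]
    abel
  rw [e]
  refine (norm_add_le _ _).trans ?_
  rw [norm_smul, l.norm_dir, mul_one, Real.norm_eq_abs]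
  linarith

end TubeLine

/-- The index `k` of a `δ`-cube lying in the `δ`-tube around `l`. -/
def CubeIn (δ : ℝ) (l : TubeLine) (k : Fin 4 → ℤ) : Prop := cube δ k ⊆ l.tube δ

section CubeIn

variable {δ ρ : ℝ} {l U : TubeLine} {k k' : Fin 4 → ℤ}

theorem CubeIn.abs_le (hδ : 0 < δ) (h : CubeIn δ l k) (i : Fin 4) : |δ * k i| ≤ 1 :=
  _root_.abs_le.mpr ((h (corner_mem_cube hδ k)).2 i)

theorem CubeIn.abs_sub_le (hδ : 0 < δ) (h : CubeIn δ l k) (i : Fin 4) :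
    |δ * k i - (l.base i + δ * k 3 * l.slope i)| ≤ 24 * δ := by
  have h1 := (abs_coord_le_norm _ i).trans (l.norm_sub_pt_le (h (corner_mem_cube hδ k)))
  rw [PiLp.sub_apply, l.pt_apply] at h1
  exact h1

/-- Difference of two cubes of the same tube. -/
theorem CubeIn.abs_sub_sub_le (hδ : 0 < δ) (h : CubeIn δ l k) (h' : CubeIn δ l k') (i : Fin 4) :
    |(δ * k i - δ * k' i) - (δ * k 3 - δ * k' 3) * l.slope i| ≤ 48 * δ := by
  have h1 := _root_.abs_le.mp (h.abs_sub_le hδ i)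
  have h2 := _root_.abs_le.mp (h'.abs_sub_le hδ i)
  rw [_root_.abs_le]
  constructor <;> nlinarith

/-- Integer vectors that are determined up to `M` by their last coordinate. -/
theorem card_le_of_last (F : Finset (Fin 4 → ℤ)) {A : ℝ} (hA : 0 ≤ A) (M : ℕ)
    (h3 : ∀ m ∈ F, ∀ m' ∈ F, ((m 3 : ℝ) - m' 3) ≤ A)
    (hM : ∀ m ∈ F, ∀ m' ∈ F, m 3 = m' 3 → ∀ i, |(m i : ℝ) - m' i| ≤ M) :
    (F.card : ℝ) ≤ (2 * M + 1) ^ 4 * (A + 1) := by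
  have h1 := Finset.card_le_mul_card_image (f := fun m : Fin 4 → ℤ => m 3) F ((2 * M + 1) ^ 4) (by
    intro b _
    have := card_le_of_grid_of_sub (F.filter fun m => m 3 = b) (ι := Fin 4) (fun m i => (m i : ℝ)) M
      (by
        intro m hm m' hm' i
        rw [Finset.mem_filter] at hm hm'
        exact hM m hm.1 m' hm'.1 (hm.2.trans hm'.2.symm) i)
      (by
        intro m _ m' _ h
        funext i
        have := h i
        rw [← Int.cast_sub, ← Int.cast_abs] at this
        have h2 : |m i - m' i| < 1 := by exact_mod_cast this
        rw [Int.abs_lt_one_iff] at h2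
        linarith)
    simpa using this)
  have h2 := card_le_of_int_sub_le (F.image fun m => m 3) hA (by
    intro a ha b hb
    obtain ⟨m, hm, rfl⟩ := Finset.mem_image.mp ha
    obtain ⟨m', hm', rfl⟩ := Finset.mem_image.mp hb
    exact h3 m hm m' hm')
  calc (F.card : ℝ) ≤ ((2 * M + 1) ^ 4 : ℝ) * ((F.image fun m => m 3).card : ℝ) := by
        exact_mod_cast h1
    _ ≤ _ := mul_le_mul_of_nonneg_left h2 (by positivity)

/-- The cubes of a tube in a range of heights of length `a`. -/
theorem card_cubeIn_le (hδ : 0 < δ) (F : Finset (Fin 4 → ℤ)) (hF : ∀ k ∈ F, CubeIn δ l k) {a : ℝ}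
    (ha : 0 ≤ a) (h3 : ∀ k ∈ F, ∀ k' ∈ F, δ * (k 3 : ℝ) - δ * k' 3 ≤ a) :
    (F.card : ℝ) ≤ 97 ^ 4 * (a / δ + 1) := by
  have := card_le_of_last F (A := a / δ) (by positivity) 48 (by
    intro m hm m' hm'
    rw [le_div_iff₀ hδ]
    linarith [h3 m hm m' hm']) (by
    intro m hm m' hm' h i
    have h1 := (hF m hm).abs_sub_sub_le hδ (hF m' hm') i
    rw [h, sub_self, zero_mul, sub_zero, ← mul_sub, abs_mul, abs_of_pos hδ, mul_comm] at h1
    exact_mod_cast le_of_mul_le_mul_right h1 hδ)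
  norm_num at this ⊢
  exact this

/-- The slab of width `2 ρ` along the boundary of the cube `[-1, 1]⁴` meets a tube only in cubes of
heights in a few intervals of length `≲ ρ`, because a line of `𝓛₄` starting near the `x₄`-axis is
transversal to the faces it reaches. -/
theorem card_cubeIn_boundary_le (hδ : 0 < δ) (hδρ : δ ≤ ρ) (hρ : ρ ≤ 1 / 1000)
    (F : Finset (Fin 4 → ℤ)) (hF : ∀ k ∈ F, CubeIn δ l k)
    (hbd : ∀ k ∈ F, ∃ i, 1 - 2 * ρ < |δ * k i|) : (F.card : ℝ) ≤ 10 ^ 12 * (ρ / δ) := by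
  have hρ0 : 0 < ρ := hδ.trans_le hδρ
  have key : ∀ (i : Fin 4) (s : ℝ), (s = 1 ∨ s = -1) →
      (((F.filter fun k => 1 - 2 * ρ < s * (δ * k i)).card : ℝ) ≤ 97 ^ 4 * (100 * ρ / δ + 1)) := by
    intro i s hs
    refine card_cubeIn_le (l := l) hδ _ (fun k hk => hF k (Finset.mem_of_mem_filter k hk))
      (by positivity) ?_
    intro k hk k' hk'
    rw [Finset.mem_filter] at hk hk'
    have h1 := (hF k hk.1).abs_sub_sub_le hδ (hF k' hk'.1) i
    have h2 := (hF k hk.1).abs_sub_le hδ i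
    have h3 := abs_le.mp ((hF k hk.1).abs_le hδ i)
    have h4 := abs_le.mp ((hF k' hk'.1).abs_le hδ i)
    have h5 := abs_le.mp (l.abs_base_le i)
    have h6 := (hF k hk.1).abs_le hδ 3
    have h7 : |δ * (k i : ℝ) - δ * k' i| ≤ 2 * ρ := by
      rcases hs with rfl | rfl <;> rw [abs_le] <;> constructor <;> linarith [hk.2, hk'.2]
    -- the slope in direction `i` is bounded below
    have h8 : 1 / 2 ≤ |l.slope i| := by
      have h9 : 1 / 2 ≤ |δ * (k 3 : ℝ) * l.slope i| := by
        have := abs_le.mp h2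
        rcases hs with rfl | rfl
        · exact le_trans (by linarith [hk.2]) (le_abs_self _)
        · exact le_trans (by linarith [hk.2]) (neg_le_abs _)
      rw [abs_mul] at h9
      nlinarith [abs_nonneg (l.slope i)]
    have h10 : |(δ * (k 3 : ℝ) - δ * k' 3) * l.slope i| ≤ 50 * ρ := by
      have := abs_le.mp h1
      have := abs_le.mp h7
      rw [abs_le]
      constructor <;> linarith
    rw [abs_mul] at h10
    have h11 : |δ * (k 3 : ℝ) - δ * k' 3| ≤ 100 * ρ := by
      nlinarith [abs_nonneg (δ * (k 3 : ℝ) - δ * k' 3)]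
    exact (le_abs_self _).trans h11
  have hsub : F ⊆ (Finset.univ : Finset (Fin 4)).biUnion fun i =>
      (F.filter fun k => 1 - 2 * ρ < 1 * (δ * k i)) ∪
        (F.filter fun k => 1 - 2 * ρ < (-1) * (δ * k i)) := by
    intro k hk
    obtain ⟨i, hi⟩ := hbd k hk
    simp only [Finset.mem_biUnion, Finset.mem_univ, true_and, Finset.mem_union, Finset.mem_filter]
    refine ⟨i, ?_⟩
    rcases lt_abs.mp hi with h | h
    · exact Or.inl ⟨hk, by linarith⟩
    · exact Or.inr ⟨hk, by linarith⟩
  have h1 : (F.card : ℝ) ≤ ∑ i : Fin 4,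
      (((F.filter fun k => 1 - 2 * ρ < 1 * (δ * k i)).card : ℝ) +
        ((F.filter fun k => 1 - 2 * ρ < (-1) * (δ * k i)).card : ℝ)) := by
    refine le_trans (Nat.cast_le.mpr ((Finset.card_le_card hsub).trans Finset.card_biUnion_le)) ?_
    push_cast
    exact Finset.sum_le_sum fun i _ => by exact_mod_cast Finset.card_union_le _ _
  have h2 : (F.card : ℝ) ≤ ∑ _i : Fin 4, 2 * (97 ^ 4 * (100 * ρ / δ + 1)) :=
    h1.trans (Finset.sum_le_sum fun i _ => by
      linarith [key i 1 (Or.inl rfl), key i (-1) (Or.inr rfl)])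
  rw [Finset.sum_const, Finset.card_univ, Fintype.card_fin, nsmul_eq_mul] at h2
  have h3 : 1 ≤ ρ / δ := (one_le_div hδ).mpr hδρ
  rw [mul_div_assoc] at h2
  push_cast at h2
  norm_num at h2 ⊢
  linarith

/-- The index of the `ρ`-cube that contains the corner of a `δ`-cube. -/
def coarseCell (δ ρ : ℝ) (k : Fin 4 → ℤ) : Fin 4 → ℤ := fun i => ⌊δ * k i / ρ⌋

theorem abs_sub_le_of_coarseCell_eq (hρ : 0 < ρ) (i : Fin 4)
    (h : coarseCell δ ρ k i = coarseCell δ ρ k' i) : |δ * (k i : ℝ) - δ * k' i| ≤ ρ := by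
  have := Int.abs_sub_lt_one_of_floor_eq_floor h
  rw [← sub_div, abs_div, abs_of_pos hρ, div_lt_one hρ] at this
  exact this.le

theorem card_coarseCell_fiber_le (hδ : 0 < δ) (hδρ : δ ≤ ρ) (F : Finset (Fin 4 → ℤ))
    (hF : ∀ k ∈ F, CubeIn δ l k) {m : Fin 4 → ℤ} (hm : ∀ k ∈ F, coarseCell δ ρ k = m) :
    (F.card : ℝ) ≤ 10 ^ 9 * (ρ / δ) := by
  have hρ : 0 < ρ := hδ.trans_le hδρ
  have h1 := card_cubeIn_le hδ F hF hρ.le (fun k hk k' hk' => (le_abs_self _).trans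
    (abs_sub_le_of_coarseCell_eq hρ 3 (congrFun ((hm k hk).trans (hm k' hk').symm) 3)))
  have h3 : 1 ≤ ρ / δ := (one_le_div hδ).mpr hδρ
  norm_num at h1 ⊢
  linarith

theorem floor_sub_floor_le (x y : ℝ) : ((⌊x⌋ : ℝ) - ⌊y⌋) ≤ x - y + 1 := by
  linarith [Int.floor_le x, Int.lt_floor_add_one y]

theorem abs_floor_sub_floor_le (x y : ℝ) : |(⌊x⌋ : ℝ) - ⌊y⌋| ≤ |x - y| + 1 := by
  rw [abs_le]
  constructor
  · linarith [floor_sub_floor_le y x, le_abs_self (y - x), abs_sub_comm x y]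
  · linarith [floor_sub_floor_le x y, le_abs_self (x - y)]

theorem abs_slope_sub_le_of_covers (h : U.CoversTube ρ l) (i : Fin 4) :
    |l.slope i - U.slope i| ≤ 4 * ρ := by
  have h1 := l.abs_slope_sub_le U i
  have h2 := l.norm_dir_sub_le_lineDist U
  unfold TubeLine.CoversTube at h
  linarith

theorem CubeIn.abs_sub_coarse_le (hδ : 0 < δ) (hδρ : δ ≤ ρ) (hk : CubeIn δ l k)
    (h : U.CoversTube ρ l) (i : Fin 4) :
    |δ * k i - (U.base i + δ * k 3 * U.slope i)| ≤ 29 * ρ := by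
  have h1 := abs_slope_sub_le_of_covers h i
  have h2 := (abs_coord_le_norm _ i).trans (l.norm_base_sub_le_lineDist U)
  rw [PiLp.sub_apply] at h2
  have h3 := hk.abs_sub_le hδ i
  have h4 := hk.abs_le hδ 3
  have h5 : |δ * (k 3 : ℝ) * (l.slope i - U.slope i)| ≤ 1 * (4 * ρ) := by
    rw [abs_mul]
    exact mul_le_mul h4 h1 (abs_nonneg _) zero_le_one
  have h6 := _root_.abs_le.mp h5
  have h7 := _root_.abs_le.mp h3
  have h8 := _root_.abs_le.mp h2
  unfold TubeLine.CoversTube at h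
  rw [_root_.abs_le]
  constructor <;> nlinarith

/-- A `ρ`-tube meets `≲ 1 / ρ` coarse cells. -/
theorem card_coarseCell_le (hδ : 0 < δ) (hδρ : δ ≤ ρ) (hρ1 : ρ ≤ 1) (F : Finset (Fin 4 → ℤ))
    (hF : ∀ m ∈ F, ∃ l k, CubeIn δ l k ∧ U.CoversTube ρ l ∧ coarseCell δ ρ k = m) :
    (F.card : ℝ) ≤ 10 ^ 10 / ρ := by
  have hρ : 0 < ρ := hδ.trans_le hδρ
  have h1 := card_le_of_last F (A := 2 / ρ + 1) (by positivity) 61 (by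
    intro m hm m' hm'
    obtain ⟨l, k, hk, -, rfl⟩ := hF m hm
    obtain ⟨l', k', hk', -, rfl⟩ := hF m' hm'
    refine (floor_sub_floor_le _ _).trans ?_
    rw [← sub_div]
    have h1 := abs_le.mp (hk.abs_le hδ 3)
    have h2 := abs_le.mp (hk'.abs_le hδ 3)
    gcongr
    linarith) (by
    intro m hm m' hm' h i
    obtain ⟨l, k, hk, hU, rfl⟩ := hF m hm
    obtain ⟨l', k', hk', hU', rfl⟩ := hF m' hm'
    refine (abs_floor_sub_floor_le _ _).trans ?_
    have h1 := abs_sub_le_of_coarseCell_eq hρ 3 h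
    have h2 := abs_le.mp (hk.abs_sub_coarse_le hδ hδρ hU i)
    have h3 := abs_le.mp (hk'.abs_sub_coarse_le hδ hδρ hU' i)
    have hs : |U.slope i| ≤ 2 := by
      unfold TubeLine.slope
      rw [abs_div, abs_of_pos U.dir_three_pos, div_le_iff₀ U.dir_three_pos]
      linarith [U.abs_dir_le i, U.half_le_dir]
    have h4 : |(δ * (k 3 : ℝ) - δ * k' 3) * U.slope i| ≤ ρ * 2 := by
      rw [abs_mul]
      exact mul_le_mul h1 hs (abs_nonneg _) hρ.le
    have h5 := abs_le.mp h4
    have h6 : |δ * (k i : ℝ) - δ * k' i| ≤ 60 * ρ := by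
      rw [abs_le]
      constructor <;> linarith
    rw [← sub_div, abs_div, abs_of_pos hρ]
    have h7 : |δ * (k i : ℝ) - δ * k' i| / ρ ≤ 60 := (div_le_iff₀ hρ).mpr h6
    push_cast
    linarith)
  have h2 : 1 ≤ 1 / ρ := (one_le_div hρ).mpr hρ1
  have h3 : 2 / ρ = 2 * (1 / ρ) := by ring
  have h4 : (10 : ℝ) ^ 10 / ρ = 10 ^ 10 * (1 / ρ) := by ring
  rw [h3] at h1
  rw [h4]
  norm_num at h1 h2 ⊢
  linarith

/-- The cell of a `δ`-cube relative to the `ρ`-tube around `U`: in coordinates sheared along `U`, it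
has length `δ / ρ` along `U` and width `δ` across. The rescaling maps it to a set of diameter
`≲ δ / ρ`. -/
def fineCell (δ ρ : ℝ) (U : TubeLine) (k : Fin 4 → ℤ) : Fin 4 → ℤ := fun i =>
  if i = 3 then ⌊δ * k 3 / (δ / ρ)⌋ else ⌊(δ * k i - δ * k 3 * U.slope i) / δ⌋

theorem abs_sub_le_of_fineCell_three_eq (hδ : 0 < δ) (hρ : 0 < ρ)
    (h : fineCell δ ρ U k 3 = fineCell δ ρ U k' 3) : |δ * (k 3 : ℝ) - δ * k' 3| ≤ δ / ρ := by
  simp only [fineCell, if_true] at h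
  have := Int.abs_sub_lt_one_of_floor_eq_floor h
  rw [← sub_div, abs_div, abs_of_pos (div_pos hδ hρ), div_lt_one (div_pos hδ hρ)] at this
  exact this.le

theorem abs_sub_le_of_fineCell_eq (hδ : 0 < δ) {i : Fin 4} (hi : i ≠ 3)
    (h : fineCell δ ρ U k i = fineCell δ ρ U k' i) :
    |(δ * (k i : ℝ) - δ * k' i) - (δ * k 3 - δ * k' 3) * U.slope i| ≤ δ := by
  simp only [fineCell, if_neg hi] at h
  have := Int.abs_sub_lt_one_of_floor_eq_floor h
  rw [← sub_div, abs_div, abs_of_pos hδ, div_lt_one hδ] at this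
  refine le_trans (le_of_eq ?_) this.le
  congr 1
  ring

/-- A `δ`-tube covered by the `ρ`-tube around `U` meets `≲ ρ / δ` of the cells relative to `U`. -/
theorem card_fineCell_le (hδ : 0 < δ) (hδρ : δ ≤ ρ) (h : U.CoversTube ρ l)
    (F : Finset (Fin 4 → ℤ)) (hF : ∀ m ∈ F, ∃ k, CubeIn δ l k ∧ fineCell δ ρ U k = m) :
    (F.card : ℝ) ≤ 10 ^ 10 * (ρ / δ) := by
  have hρ : 0 < ρ := hδ.trans_le hδρ
  have h1 := card_le_of_last F (A := 2 * (ρ / δ) + 1) (by positivity) 53 (by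
    intro m hm m' hm'
    obtain ⟨k, hk, rfl⟩ := hF m hm
    obtain ⟨k', hk', rfl⟩ := hF m' hm'
    simp only [fineCell, if_true]
    refine (floor_sub_floor_le _ _).trans ?_
    rw [← sub_div]
    have h1 := abs_le.mp (hk.abs_le hδ 3)
    have h2 := abs_le.mp (hk'.abs_le hδ 3)
    have h3 : (δ * (k 3 : ℝ) - δ * k' 3) / (δ / ρ) ≤ 2 / (δ / ρ) := by
      gcongr
      linarith
    have h4 : 2 / (δ / ρ) = 2 * (ρ / δ) := by field_simp
    linarith) (by
    intro m hm m' hm' he i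
    obtain ⟨k, hk, rfl⟩ := hF m hm
    obtain ⟨k', hk', rfl⟩ := hF m' hm'
    by_cases hi : i = 3
    · subst hi
      rw [he, sub_self, abs_zero]
      positivity
    simp only [fineCell, if_neg hi]
    refine (abs_floor_sub_floor_le _ _).trans ?_
    have h1 := abs_sub_le_of_fineCell_three_eq hδ hρ he
    have h2 := abs_le.mp (hk.abs_sub_sub_le hδ hk' i)
    have h3 := abs_slope_sub_le_of_covers h i
    have h4 : |(δ * (k 3 : ℝ) - δ * k' 3) * (l.slope i - U.slope i)| ≤ δ / ρ * (4 * ρ) := by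
      rw [abs_mul]
      exact mul_le_mul h1 h3 (abs_nonneg _) (by positivity)
    have h5 : δ / ρ * (4 * ρ) = 4 * δ := by field_simp
    rw [h5] at h4
    have h6 := abs_le.mp h4
    rw [← sub_div, abs_div, abs_of_pos hδ]
    have h7 : |δ * (k i : ℝ) - δ * k 3 * U.slope i - (δ * k' i - δ * k' 3 * U.slope i)| ≤ 52 * δ := by
      rw [abs_le]
      constructor <;> nlinarith
    have h8 := (div_le_iff₀ hδ).mpr h7
    push_cast
    linarith)
  have h3 : 1 ≤ ρ / δ := (one_le_div hδ).mpr hδρ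
  norm_num at h1 ⊢
  linarith

end CubeIn

end

/-! ### Stickiness -/

/-- At most `K` tubes of the collection `𝒱` are essentially parallel to any given `r`-tube. -/
def ParallelBound (𝒱 : Finset TubeLine) (r : ℝ) (K : ℕ) : Prop :=
  ∀ W : TubeLine, (𝒱.filter fun V => V.angle W ≤ r).card ≤ K

theorem ParallelBound.card_le {𝒱 : Finset TubeLine} {r : ℝ} {K : ℕ} (hr : 0 < r) (hr1 : r ≤ 1)
    (h : ParallelBound 𝒱 r K) : (𝒱.card : ℝ) ≤ K * (10 ^ 7 / r ^ 3) := by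
  rcases 𝒱.eq_empty_or_nonempty with rfl | ⟨W, _⟩
  · simp; positivity
  have h1 := TubeLine.card_angle_le 𝒱 (a := 4) hr K ⌈24 * 4 / r⌉₊ h (Nat.le_ceil _) W
  rw [Finset.filter_true_of_mem fun V _ => show V.angle W ≤ (4 : ℝ) from
    (InnerProductGeometry.angle_le_pi _ _).trans Real.pi_le_four] at h1
  have h2 : (⌈24 * 4 / r⌉₊ : ℝ) < 24 * 4 / r + 1 := Nat.ceil_lt_add_one (by positivity)
  have h3 : 1 ≤ 1 / r := (one_le_div hr).mpr hr1
  have h4 : (24 * 4 / r : ℝ) = 96 * (1 / r) := by ring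
  have h5 : (2 * (⌈24 * 4 / r⌉₊ : ℝ) + 1) ≤ 195 * (1 / r) := by linarith
  calc (𝒱.card : ℝ) ≤ K * (2 * (⌈24 * 4 / r⌉₊ : ℝ) + 1) ^ 3 := by exact_mod_cast h1
    _ ≤ K * (195 * (1 / r)) ^ 3 := by gcongr
    _ = K * (195 ^ 3 / r ^ 3) := by ring
    _ ≤ K * (10 ^ 7 / r ^ 3) := by gcongr; norm_num

/-- Essentially distinct `δ`-tubes with directions in an `a`-cap. -/
theorem card_distinct_angle_le {S 𝒱 : Finset TubeLine} {δ a : ℝ} {K : ℕ} (hδ : 0 < δ) (hδa : δ ≤ a)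
    (hS : ∀ T ∈ S, ∀ T' ∈ S, T ≠ T' → δ < T.lineDist T')
    (hcov : ∀ T ∈ S, ∃ V ∈ 𝒱, V.CoversTube δ T) (h : ParallelBound 𝒱 δ K) (W : TubeLine)
    (hW : ∀ T ∈ S, T.angle W ≤ a) : (S.card : ℝ) ≤ K * (10 ^ 6 * (a / δ) ^ 3) := by
  choose! f hf𝒱 hf using hcov
  set M := ⌈24 * (2 * a) / δ⌉₊ with hM
  have h1 := TubeLine.card_angle_le 𝒱 (a := 2 * a) hδ K M h (Nat.le_ceil _) W
  have h2 : S.card ≤ (𝒱.filter fun V => V.angle W ≤ 2 * a).card := by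
    refine Finset.card_le_card_of_injOn f (fun T hT => ?_) (fun T hT T' hT' he => ?_)
    · refine Finset.mem_filter.mpr ⟨hf𝒱 T hT, ?_⟩
      have e1 := TubeLine.angle_triangle (f T) T W
      have e2 := (TubeLine.angle_le_lineDist T (f T)).trans (hf T hT)
      rw [TubeLine.angle_comm] at e2
      linarith [hW T hT]
    · by_contra hne
      have e1 := hS T hT T' hT' hne
      have e2 := TubeLine.lineDist_triangle T (f T) T'
      have e3 := hf T hT
      have e4 := hf T' hT'
      rw [← he] at e4
      unfold TubeLine.CoversTube at e3 e4
      rw [TubeLine.lineDist_comm (f T) T'] at e2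
      linarith
  have ha : 0 < a := hδ.trans_le hδa
  have h3 : (M : ℝ) < 24 * (2 * a) / δ + 1 := Nat.ceil_lt_add_one (by positivity)
  have h4 : 1 ≤ a / δ := (one_le_div hδ).mpr hδa
  have h5 : 24 * (2 * a) / δ = 48 * (a / δ) := by ring
  have h6 : (2 * (M : ℝ) + 1) ≤ 99 * (a / δ) := by linarith
  calc (S.card : ℝ) ≤ K * (2 * (M : ℝ) + 1) ^ 3 := by exact_mod_cast h2.trans h1
    _ ≤ K * (99 * (a / δ)) ^ 3 := by gcongr
    _ = K * (99 ^ 3 * (a / δ) ^ 3) := by ring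
    _ ≤ K * (10 ^ 6 * (a / δ) ^ 3) := by gcongr; norm_num

/-- `s`-separated lines near a sticky collection: the bound for nearly parallel lines survives. -/
theorem card_separated_angle_le {S 𝒱 : Finset TubeLine} {r s a b : ℝ} {K : ℕ} (hr : 0 < r)
    (hs : 0 < s) (hS : ∀ T ∈ S, ∀ T' ∈ S, T ≠ T' → s < T.lineDist T')
    (hcov : ∀ T ∈ S, ∃ V ∈ 𝒱, T.lineDist V ≤ b) (h : ParallelBound 𝒱 r K) (W : TubeLine)
    (hW : ∀ T ∈ S, T.angle W ≤ a) (M₁ M₂ : ℕ) (hM₁ : 6 * b / s ≤ M₁) (hM₂ : 24 * (a + b) / r ≤ M₂) :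
    S.card ≤ (2 * M₁ + 1) ^ 8 * (K * (2 * M₂ + 1) ^ 3) := by
  choose! f hf𝒱 hf using hcov
  have h1 := TubeLine.card_angle_le 𝒱 (a := a + b) hr K M₂ h hM₂ W
  refine (Finset.card_le_mul_card_image_of_maps_to (f := f)
    (t := 𝒱.filter fun V => V.angle W ≤ a + b) (fun T hT => ?_) ((2 * M₁ + 1) ^ 8)
    fun V _ => ?_).trans (Nat.mul_le_mul_left _ h1)
  · refine Finset.mem_filter.mpr ⟨hf𝒱 T hT, ?_⟩
    have e1 := TubeLine.angle_triangle (f T) T W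
    have e2 := (TubeLine.angle_le_lineDist T (f T)).trans (hf T hT)
    rw [TubeLine.angle_comm] at e2
    linarith [hW T hT]
  · refine TubeLine.card_le_of_separated _ V hs M₁ hM₁ (fun T hT => ?_) (fun T hT T' hT' => ?_)
    · obtain ⟨hT', rfl⟩ := Finset.mem_filter.mp hT
      exact hf T hT'
    · exact hS T (Finset.mem_of_mem_filter T hT) T' (Finset.mem_of_mem_filter T' hT')

/-- A maximal `r / 2`-separated subset covers; so a bound for separated subsets gives a cover. -/
theorem exists_cover_of_separated_bound (S : Finset TubeLine) {r : ℝ} (hr : 0 < r) (N : ℕ)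
    (h : ∀ S' ⊆ S, (∀ T ∈ S', ∀ T' ∈ S', T ≠ T' → r / 2 < T.lineDist T') → ∀ W : TubeLine,
      (S'.filter fun V => V.angle W ≤ r).card ≤ N) :
    ∃ 𝒱 : Finset TubeLine, (∀ T ∈ S, ∃ V ∈ 𝒱, V.CoversTube r T) ∧ ParallelBound 𝒱 r N := by
  obtain ⟨t, hts, hind, hmax⟩ := exists_maximal_independent
    (fun T T' : TubeLine => T.lineDist T' ≤ r / 2)
    (fun T => by rw [TubeLine.lineDist_self]; positivity)
    (fun T T' h => by rwa [TubeLine.lineDist_comm]) S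
  exact ⟨t, hmax, h t hts fun T hT T' hT' hne => not_le.mp (hind T hT T' hT' hne)⟩

/-! ### The rescaling of a line -/

section

theorem dilation_apply (ρ : ℝ) (x : E4) (i : Fin 4) :
    dilation ρ x i = if i = 3 then 1 / 4 * x i else 1 / 4 / ρ * x i := rfl

theorem dilation_add (ρ : ℝ) (x y : E4) : dilation ρ (x + y) = dilation ρ x + dilation ρ y := by
  ext i
  simp only [PiLp.add_apply, dilation_apply]
  split_ifs <;> ring

theorem dilation_smul (ρ c : ℝ) (x : E4) : dilation ρ (c • x) = c • dilation ρ x := by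
  ext i
  simp only [PiLp.smul_apply, dilation_apply, smul_eq_mul]
  split_ifs <;> ring

theorem dilation_sub (ρ : ℝ) (x y : E4) : dilation ρ (x - y) = dilation ρ x - dilation ρ y := by
  ext i
  simp only [PiLp.sub_apply, dilation_apply]
  split_ifs <;> ring

theorem norm_dilation_le {ρ : ℝ} (hρ : 0 < ρ) (hρ1 : ρ ≤ 1) (x : E4) :
    ‖dilation ρ x‖ ≤ 1 / 4 / ρ * ‖x‖ := by
  have h1 : 1 ≤ 1 / ρ := (one_le_div hρ).mpr hρ1
  have h2 : (1 : ℝ) / 4 ≤ 1 / 4 / ρ := by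
    rw [div_div, mul_comm, ← div_div]
    linarith
  have h0 : (0 : ℝ) ≤ 1 / 4 / ρ := by positivity
  refine abs_le_of_sq_le_sq' ?_ (by positivity) |>.2
  rw [mul_pow, norm_sq_eq_coords, norm_sq_eq_coords]
  rw [dilation_apply, dilation_apply, dilation_apply, dilation_apply, if_neg (by decide),
    if_neg (by decide), if_neg (by decide), if_pos rfl]
  have h3 : (1 / 4 : ℝ) ^ 2 ≤ (1 / 4 / ρ) ^ 2 := by gcongr
  have h4 := mul_le_mul_of_nonneg_right h3 (sq_nonneg (x 3))
  simp only [mul_pow] at h4 ⊢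
  linarith

/-- The intersection of the line `a + ℝ w` with the hyperplane on which the last coordinate
vanishes. -/
def hit (a w : E4) : E4 := a - (a 3 / w 3) • w

theorem hit_three {a w : E4} (hw : w 3 ≠ 0) : hit a w 3 = 0 := by
  simp [hit, div_mul_cancel₀ _ hw]

/-- For lines transverse to `{x₄ = 0}`, the point where they meet it is a Lipschitz function of the
point and the direction. -/
theorem norm_hit_sub_le {a a' w w' : E4} (hw' : ‖w'‖ = 1) (h3 : 1 / 2 ≤ |w 3|)
    (h3' : 1 / 2 ≤ |w' 3|) (ha : ‖a‖ ≤ 1) (ha' : ‖a'‖ ≤ 1) :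
    ‖hit a w - hit a' w'‖ ≤ 6 * (‖a - a'‖ + ‖w - w'‖) := by
  have hw0 : w 3 ≠ 0 := by intro h; rw [h, abs_zero] at h3; linarith
  have hw0' : w' 3 ≠ 0 := by intro h; rw [h, abs_zero] at h3'; linarith
  have e : hit a w - hit a' w' =
      (a - a') - (a 3 / w 3) • (w - w') - (a 3 / w 3 - a' 3 / w' 3) • w' := by
    unfold hit
    rw [smul_sub, sub_smul]
    abel
  have h1 : |a 3 / w 3| ≤ 2 := by
    rw [abs_div, div_le_iff₀ (by positivity)]
    linarith [abs_coord_le_norm a 3]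
  have h2 : |a 3 / w 3 - a' 3 / w' 3| ≤ 4 * (‖a - a'‖ + ‖w - w'‖) := by
    have e2 : a 3 / w 3 - a' 3 / w' 3 =
        ((a 3 - a' 3) * w' 3 - a' 3 * (w 3 - w' 3)) / (w 3 * w' 3) := by
      field_simp; ring
    rw [e2, abs_div, div_le_iff₀ (by positivity), abs_mul (w 3)]
    have k1 := abs_coord_le_norm (a - a') 3
    have k2 := abs_coord_le_norm (w - w') 3
    have k3 := abs_coord_le_norm w' 3
    have k4 := abs_coord_le_norm a' 3
    rw [PiLp.sub_apply] at k1 k2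
    rw [hw'] at k3
    have k5 : |(a 3 - a' 3) * w' 3 - a' 3 * (w 3 - w' 3)| ≤ ‖a - a'‖ * 1 + 1 * ‖w - w'‖ := by
      refine (abs_sub _ _).trans ?_
      rw [abs_mul, abs_mul]
      exact add_le_add (mul_le_mul k1 k3 (abs_nonneg _) (norm_nonneg _))
        (mul_le_mul (k4.trans ha') k2 (abs_nonneg _) zero_le_one)
    have k6 : 1 / 4 ≤ |w 3| * |w' 3| := by nlinarith
    have k7 : 0 ≤ ‖a - a'‖ + ‖w - w'‖ := by positivity
    nlinarith
  rw [e]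
  refine (norm_sub_le _ _).trans ?_
  have h4 : ‖(a 3 / w 3 - a' 3 / w' 3) • w'‖ ≤ 4 * (‖a - a'‖ + ‖w - w'‖) := by
    rw [norm_smul, hw', mul_one]; exact h2
  have h5 : ‖a - a' - (a 3 / w 3) • (w - w')‖ ≤ ‖a - a'‖ + 2 * ‖w - w'‖ := by
    refine (norm_sub_le _ _).trans ?_
    rw [norm_smul]
    have := mul_le_mul_of_nonneg_right h1 (norm_nonneg (w - w'))
    rw [← Real.norm_eq_abs] at this
    linarith
  linarith [norm_nonneg (a - a')]

theorem norm_normalize_sub_le {x y : E4} (hx : x ≠ 0) (hy : y ≠ 0) :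
    ‖‖x‖⁻¹ • x - ‖y‖⁻¹ • y‖ ≤ 2 * ‖x - y‖ / ‖x‖ := by
  have hx' : 0 < ‖x‖ := norm_pos_iff.mpr hx
  have hy' : 0 < ‖y‖ := norm_pos_iff.mpr hy
  have e : ‖x‖⁻¹ • x - ‖y‖⁻¹ • y = ‖x‖⁻¹ • (x - y) + (‖x‖⁻¹ - ‖y‖⁻¹) • y := by
    rw [smul_sub, sub_smul]; abel
  have h1 : |‖x‖⁻¹ - ‖y‖⁻¹| * ‖y‖ ≤ ‖x - y‖ / ‖x‖ := by
    have e2 : ‖x‖⁻¹ - ‖y‖⁻¹ = (‖y‖ - ‖x‖) / (‖x‖ * ‖y‖) := by field_simp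
    rw [e2, abs_div, abs_of_pos (mul_pos hx' hy')]
    have e3 : |‖y‖ - ‖x‖| / (‖x‖ * ‖y‖) * ‖y‖ = |‖y‖ - ‖x‖| / ‖x‖ := by field_simp
    rw [e3]
    gcongr
    rw [abs_sub_comm]
    exact abs_norm_sub_norm_le x y
  rw [e]
  refine (norm_add_le _ _).trans ?_
  rw [norm_smul, norm_smul, norm_inv, norm_norm, Real.norm_eq_abs]
  have e4 : ‖x‖⁻¹ * ‖x - y‖ = ‖x - y‖ / ‖x‖ := by rw [div_eq_inv_mul]
  rw [e4, two_mul, add_div]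
  linarith

/-- A frame for the `ρ`-tube around `U`: the linear part `L` of a rigid motion taking `U` to the
`x₄`-axis, which may reverse the orientation of the axis. -/
structure Frame (U : TubeLine) where
  L : E4 ≃ₗᵢ[ℝ] E4
  L_dir : ∀ i, i ≠ 3 → L U.dir i = 0

namespace Frame

variable {U : TubeLine} (F : Frame U)

/-- The orientation `±1`. -/
def sgn : ℝ := F.L U.dir 3

theorem sgn_sq : F.sgn ^ 2 = 1 := by
  have h := norm_sq_eq_coords (F.L U.dir)
  rw [F.L.norm_map, U.norm_dir, F.L_dir 0 (by decide), F.L_dir 1 (by decide),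
    F.L_dir 2 (by decide)] at h
  unfold sgn
  linarith

theorem abs_sgn : |F.sgn| = 1 := by
  have := F.sgn_sq
  rw [← sq_abs] at this
  nlinarith [abs_nonneg F.sgn, sq_nonneg (|F.sgn| - 1)]

theorem sgn_ne_zero : F.sgn ≠ 0 := by
  intro h
  have := F.abs_sgn
  rw [h, abs_zero] at this
  exact zero_ne_one this

/-- Directions in the frame. -/
def vec (T : TubeLine) : E4 := F.sgn • F.L T.dir

/-- Base points in the frame, moved to the hyperplane perpendicular to `U`. -/
def pos (T : TubeLine) : E4 := hit (F.L (T.base - U.base)) (F.vec T)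

theorem norm_vec (T : TubeLine) : ‖F.vec T‖ = 1 := by
  rw [vec, norm_smul, F.L.norm_map, T.norm_dir, mul_one, Real.norm_eq_abs, F.abs_sgn]

theorem norm_vec_sub (T T' : TubeLine) : ‖F.vec T - F.vec T'‖ = ‖T.dir - T'.dir‖ := by
  rw [vec, vec, ← smul_sub, ← map_sub, norm_smul, F.L.norm_map, Real.norm_eq_abs, F.abs_sgn,
    one_mul]

theorem vec_self_of_ne {i : Fin 4} (hi : i ≠ 3) : F.vec U i = 0 := by
  rw [vec, PiLp.smul_apply, F.L_dir i hi, smul_zero]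

theorem vec_self_three : F.vec U 3 = 1 := by
  have := F.sgn_sq
  rw [vec, PiLp.smul_apply, smul_eq_mul]
  unfold sgn at this ⊢
  linarith

variable {ρ : ℝ} {T T' : TubeLine}

theorem norm_base_sub_le (h : U.CoversTube ρ T) : ‖T.base - U.base‖ ≤ ρ / 2 :=
  (T.norm_base_sub_le_lineDist U).trans h

theorem norm_vec_sub_self_le (h : U.CoversTube ρ T) : ‖F.vec T - F.vec U‖ ≤ ρ / 2 := by
  rw [F.norm_vec_sub]
  exact (T.norm_dir_sub_le_lineDist U).trans h

theorem abs_vec_le (h : U.CoversTube ρ T) {i : Fin 4} (hi : i ≠ 3) : |F.vec T i| ≤ ρ / 2 := by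
  have h1 := (abs_coord_le_norm _ i).trans (F.norm_vec_sub_self_le h)
  rwa [PiLp.sub_apply, F.vec_self_of_ne hi, sub_zero] at h1

theorem half_le_vec (hρ1 : ρ ≤ 1) (h : U.CoversTube ρ T) : 1 / 2 ≤ F.vec T 3 := by
  have h1 := (abs_coord_le_norm _ 3).trans (F.norm_vec_sub_self_le h)
  rw [PiLp.sub_apply, F.vec_self_three] at h1
  linarith [(abs_le.mp h1).1]

theorem half_le_abs_vec (hρ1 : ρ ≤ 1) (h : U.CoversTube ρ T) : 1 / 2 ≤ |F.vec T 3| :=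
  (F.half_le_vec hρ1 h).trans (le_abs_self _)

theorem pos_three (hρ1 : ρ ≤ 1) (h : U.CoversTube ρ T) : F.pos T 3 = 0 :=
  hit_three (by linarith [F.half_le_vec hρ1 h])

theorem abs_pos_le (hρ1 : ρ ≤ 1) (h : U.CoversTube ρ T) (i : Fin 4) : |F.pos T i| ≤ ρ := by
  have h0 : 0 ≤ ρ := by linarith [norm_nonneg (T.base - U.base), norm_base_sub_le h]
  by_cases hi : i = 3
  · subst hi
    rwa [F.pos_three hρ1 h, abs_zero]
  have h1 := F.half_le_vec hρ1 h
  have h2 := F.abs_vec_le h hi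
  have h3 : ∀ j, |F.L (T.base - U.base) j| ≤ ρ / 2 := fun j =>
    (abs_coord_le_norm _ j).trans ((F.L.norm_map _).trans_le (norm_base_sub_le h))
  have h4 : |F.L (T.base - U.base) 3 / F.vec T 3| ≤ ρ := by
    rw [abs_div, abs_of_pos (show 0 < F.vec T 3 by linarith), div_le_iff₀ (by linarith)]
    nlinarith [h3 3]
  have h5 : |F.L (T.base - U.base) 3 / F.vec T 3 * F.vec T i| ≤ ρ * (ρ / 2) := by
    rw [abs_mul]
    exact mul_le_mul h4 h2 (abs_nonneg _) h0
  rw [pos, hit, PiLp.sub_apply, PiLp.smul_apply, smul_eq_mul]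
  refine (abs_sub _ _).trans ?_
  nlinarith [h3 i]

theorem dilation_vec_three (hρ1 : ρ ≤ 1) (h : U.CoversTube ρ T) :
    1 / 8 ≤ dilation ρ (F.vec T) 3 := by
  rw [dilation_apply, if_pos rfl]
  linarith [F.half_le_vec hρ1 h]

theorem eighth_le_norm_dilation_vec (hρ1 : ρ ≤ 1) (h : U.CoversTube ρ T) :
    1 / 8 ≤ ‖dilation ρ (F.vec T)‖ :=
  (F.dilation_vec_three hρ1 h).trans ((le_abs_self _).trans (abs_coord_le_norm _ _))

theorem dilation_vec_ne_zero (hρ1 : ρ ≤ 1) (h : U.CoversTube ρ T) :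
    dilation ρ (F.vec T) ≠ 0 := by
  rw [← norm_pos_iff]
  linarith [F.eighth_le_norm_dilation_vec hρ1 h]

theorem norm_dilation_vec_le (hρ : 0 < ρ) (hρ1 : ρ ≤ 1) (h : U.CoversTube ρ T) :
    ‖dilation ρ (F.vec T)‖ ≤ 2 * dilation ρ (F.vec T) 3 := by
  have h1 := F.dilation_vec_three hρ1 h
  refine abs_le_of_sq_le_sq' ?_ (by linarith) |>.2
  have h2 := F.norm_vec_sub_self_le h
  have h3 : ‖F.vec T - F.vec U‖ ^ 2 ≤ (ρ / 2) ^ 2 := by gcongr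
  rw [norm_sq_eq_coords] at h3 ⊢
  simp only [PiLp.sub_apply, F.vec_self_of_ne (show (0 : Fin 4) ≠ 3 by decide),
    F.vec_self_of_ne (show (1 : Fin 4) ≠ 3 by decide),
    F.vec_self_of_ne (show (2 : Fin 4) ≠ 3 by decide), sub_zero] at h3
  have e : ∀ i : Fin 4, i ≠ 3 → dilation ρ (F.vec T) i ^ 2 = (1 / 16 / ρ ^ 2) * F.vec T i ^ 2 := by
    intro i hi
    rw [dilation_apply, if_neg hi]
    ring
  rw [e 0 (by decide), e 1 (by decide), e 2 (by decide)]
  have h4 : (1 / 16 / ρ ^ 2) * (F.vec T 0 ^ 2 + F.vec T 1 ^ 2 + F.vec T 2 ^ 2) ≤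
      (1 / 16 / ρ ^ 2) * (ρ / 2) ^ 2 := by
    gcongr
    linarith [sq_nonneg (F.vec T 3 - F.vec U 3)]
  have h5 : (1 / 16 / ρ ^ 2) * (ρ / 2) ^ 2 = 1 / 64 := by field_simp; norm_num
  nlinarith

/-- The image of a line of `𝓛₄` in the `ρ`-tube around `U` under the rescaling. -/
def rescale (hρ : 0 < ρ) (hρ1 : ρ ≤ 1) (T : TubeLine) (h : U.CoversTube ρ T) : TubeLine where
  base := dilation ρ (F.pos T)
  dir := ‖dilation ρ (F.vec T)‖⁻¹ • dilation ρ (F.vec T)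
  base_last := by
    rw [dilation_apply, if_pos rfl, F.pos_three hρ1 h, mul_zero]
  abs_base_le i := by
    rw [dilation_apply]
    have h1 := F.abs_pos_le hρ1 h i
    split_ifs with hi
    · subst hi
      rw [F.pos_three hρ1 h]
      norm_num
    · rw [abs_mul, abs_of_pos (show 0 < 1 / 4 / ρ by positivity)]
      calc 1 / 4 / ρ * |F.pos T i| ≤ 1 / 4 / ρ * ρ := by gcongr
        _ = 1 / 4 := by field_simp
  norm_dir := by
    rw [norm_smul, norm_inv, norm_norm,
      inv_mul_cancel₀ (norm_ne_zero_iff.mpr (F.dilation_vec_ne_zero hρ1 h))]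
  half_le_dir := by
    have h1 := F.norm_dilation_vec_le hρ hρ1 h
    have h2 : 0 < ‖dilation ρ (F.vec T)‖ := norm_pos_iff.mpr (F.dilation_vec_ne_zero hρ1 h)
    rw [PiLp.smul_apply, smul_eq_mul, inv_mul_eq_div, le_div_iff₀ h2]
    linarith

theorem rescale_line (hρ : 0 < ρ) (hρ1 : ρ ≤ 1) (h : U.CoversTube ρ T) :
    (F.rescale hρ hρ1 T h).line = (fun x => dilation ρ (F.L (x - U.base))) '' T.line := by
  have hN : ‖dilation ρ (F.vec T)‖ ≠ 0 := norm_ne_zero_iff.mpr (F.dilation_vec_ne_zero hρ1 h)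
  have hs := F.sgn_ne_zero
  set c := F.L (T.base - U.base) 3 / F.vec T 3 with hc
  have e1 : ∀ t : ℝ, (F.rescale hρ hρ1 T h).base + t • (F.rescale hρ hρ1 T h).dir =
      dilation ρ (F.L (T.base - U.base)) +
        (t * ‖dilation ρ (F.vec T)‖⁻¹ - c) • dilation ρ (F.vec T) := by
    intro t
    simp only [rescale, pos, hit, dilation_sub, dilation_smul, ← hc]
    rw [sub_smul, mul_smul]
    abel
  have e2 : ∀ t : ℝ, dilation ρ (F.L (T.base + t • T.dir - U.base)) =
      dilation ρ (F.L (T.base - U.base)) + (t * F.sgn⁻¹) • dilation ρ (F.vec T) := by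
    intro t
    rw [show T.base + t • T.dir - U.base = (T.base - U.base) + t • T.dir by abel, map_add,
      map_smul, dilation_add, dilation_smul, vec, dilation_smul, smul_smul, mul_assoc,
      inv_mul_cancel₀ hs, mul_one]
  ext x
  simp only [TubeLine.line, Set.mem_range, Set.mem_image, exists_exists_eq_and]
  constructor
  · rintro ⟨t, rfl⟩
    refine ⟨(t * ‖dilation ρ (F.vec T)‖⁻¹ - c) * F.sgn, ?_⟩
    rw [e1, e2, mul_assoc, mul_inv_cancel₀ hs, mul_one]
  · rintro ⟨t, rfl⟩
    refine ⟨(t * F.sgn⁻¹ + c) * ‖dilation ρ (F.vec T)‖, ?_⟩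
    rw [e1, e2, mul_assoc, mul_inv_cancel₀ hN, mul_one, add_sub_cancel_right]

/-- Rescaling expands the distance of lines at most by `10 / ρ`. The converse is
`lineDist_le_rescale`: up to constants, rescaling multiplies distances by `1 / ρ`. -/
theorem lineDist_rescale_le (hρ : 0 < ρ) (hρ1 : ρ ≤ 1) (h : U.CoversTube ρ T)
    (h' : U.CoversTube ρ T') :
    (F.rescale hρ hρ1 T h).lineDist (F.rescale hρ hρ1 T' h') ≤ 10 / ρ * T.lineDist T' := by
  have hw := F.norm_vec_sub T T'
  have h1 : ‖(F.rescale hρ hρ1 T h).base - (F.rescale hρ hρ1 T' h').base‖ ≤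
      1 / 4 / ρ * (6 * (‖T.base - T'.base‖ + ‖T.dir - T'.dir‖)) := by
    simp only [rescale]
    rw [← dilation_sub]
    refine (norm_dilation_le hρ hρ1 _).trans ?_
    gcongr
    have := norm_hit_sub_le (F.norm_vec T') (F.half_le_abs_vec hρ1 h)
      (F.half_le_abs_vec hρ1 h') (a := F.L (T.base - U.base)) (a' := F.L (T'.base - U.base))
      (by rw [F.L.norm_map]; linarith [norm_base_sub_le h])
      (by rw [F.L.norm_map]; linarith [norm_base_sub_le h'])
    rwa [← map_sub, F.L.norm_map, sub_sub_sub_cancel_right, hw] at this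
  have h2 : ‖(F.rescale hρ hρ1 T h).dir - (F.rescale hρ hρ1 T' h').dir‖ ≤
      4 / ρ * ‖T.dir - T'.dir‖ := by
    simp only [rescale]
    refine (norm_normalize_sub_le (F.dilation_vec_ne_zero hρ1 h)
      (F.dilation_vec_ne_zero hρ1 h')).trans ?_
    have h3 := F.eighth_le_norm_dilation_vec hρ1 h
    rw [div_le_iff₀ (by linarith), ← dilation_sub]
    have h4 := norm_dilation_le hρ hρ1 (F.vec T - F.vec T')
    rw [hw] at h4
    have h5 : 4 / ρ * ‖T.dir - T'.dir‖ * (1 / 8) ≤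
        4 / ρ * ‖T.dir - T'.dir‖ * ‖dilation ρ (F.vec T)‖ := by gcongr
    have h6 : 4 / ρ * ‖T.dir - T'.dir‖ * (1 / 8) = 2 * (1 / 4 / ρ * ‖T.dir - T'.dir‖) := by ring
    linarith
  have h3 := TubeLine.angle_le_two_mul_norm (F.rescale hρ hρ1 T h) (F.rescale hρ hρ1 T' h')
  have h4 := TubeLine.norm_dir_sub_le_angle T T'
  have h5 : (0 : ℝ) ≤ 1 / ρ := by positivity
  have e1 : 1 / 4 / ρ * (6 * (‖T.base - T'.base‖ + ‖T.dir - T'.dir‖)) =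
      1 / ρ * (3 / 2 * (‖T.base - T'.base‖ + ‖T.dir - T'.dir‖)) := by ring
  have e2 : 4 / ρ * ‖T.dir - T'.dir‖ = 1 / ρ * (4 * ‖T.dir - T'.dir‖) := by ring
  have e3 : 10 / ρ * T.lineDist T' = 1 / ρ * (10 * T.lineDist T') := by ring
  rw [e1] at h1
  rw [e2] at h2
  rw [e3]
  calc (F.rescale hρ hρ1 T h).lineDist (F.rescale hρ hρ1 T' h')
      ≤ 1 / ρ * (3 / 2 * (‖T.base - T'.base‖ + ‖T.dir - T'.dir‖)) +
        2 * (1 / ρ * (4 * ‖T.dir - T'.dir‖)) := by unfold TubeLine.lineDist; linarith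
    _ = 1 / ρ * (3 / 2 * ‖T.base - T'.base‖ + 19 / 2 * ‖T.dir - T'.dir‖) := by ring
    _ ≤ 1 / ρ * (10 * T.lineDist T') := by
      gcongr
      unfold TubeLine.lineDist
      linarith [norm_nonneg (T.base - T'.base), norm_nonneg (T.dir - T'.dir)]

theorem slope_rescale (hρ : 0 < ρ) (hρ1 : ρ ≤ 1) (h : U.CoversTube ρ T) {i : Fin 4} (hi : i ≠ 3) :
    F.vec T i = F.vec T 3 * (ρ * (F.rescale hρ hρ1 T h).slope i) := by
  have h1 : F.vec T 3 ≠ 0 := by linarith [F.half_le_vec hρ1 h]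
  have hN : ‖dilation ρ (F.vec T)‖ ≠ 0 := norm_ne_zero_iff.mpr (F.dilation_vec_ne_zero hρ1 h)
  simp only [TubeLine.slope, rescale, PiLp.smul_apply, smul_eq_mul]
  rw [mul_div_mul_left _ _ (inv_ne_zero hN)]
  simp only [dilation_apply, if_neg hi, if_true]
  field_simp

theorem norm_dir_sub_le (hρ : 0 < ρ) (hρ1 : ρ ≤ 1) (h : U.CoversTube ρ T)
    (h' : U.CoversTube ρ T') : ‖T.dir - T'.dir‖ ≤
      32 * ρ * (F.rescale hρ hρ1 T h).angle (F.rescale hρ hρ1 T' h') := by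
  set R := F.rescale hρ hρ1 T h with hR
  set R' := F.rescale hρ hρ1 T' h' with hR'
  have h3 := F.half_le_vec hρ1 h
  have h3' := F.half_le_vec hρ1 h'
  -- both directions are normalizations of vectors with last coordinate `1`
  set x : E4 := (F.vec T 3)⁻¹ • F.vec T with hx
  set y : E4 := (F.vec T' 3)⁻¹ • F.vec T' with hy
  have hx3 : x 3 = 1 := by
    rw [hx, PiLp.smul_apply, smul_eq_mul, inv_mul_cancel₀ (by linarith)]
  have hy3 : y 3 = 1 := by
    rw [hy, PiLp.smul_apply, smul_eq_mul, inv_mul_cancel₀ (by linarith)]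
  have hx1 : 1 ≤ ‖x‖ := by
    have := abs_coord_le_norm x 3
    rwa [hx3, abs_one] at this
  have hy1 : 1 ≤ ‖y‖ := by
    have := abs_coord_le_norm y 3
    rwa [hy3, abs_one] at this
  have hxi : ∀ i, i ≠ 3 → x i = ρ * R.slope i := by
    intro i hi
    rw [hx, PiLp.smul_apply, smul_eq_mul, F.slope_rescale hρ hρ1 h hi, ← mul_assoc,
      inv_mul_cancel₀ (by linarith), one_mul]
  have hyi : ∀ i, i ≠ 3 → y i = ρ * R'.slope i := by
    intro i hi
    rw [hy, PiLp.smul_apply, smul_eq_mul, F.slope_rescale hρ hρ1 h' hi, ← mul_assoc,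
      inv_mul_cancel₀ (by linarith), one_mul]
  have nx : ‖x‖⁻¹ • x = F.vec T := by
    rw [hx, norm_smul, F.norm_vec, mul_one, norm_inv, Real.norm_eq_abs,
      abs_of_pos (show 0 < F.vec T 3 by linarith), inv_inv, smul_smul,
      mul_inv_cancel₀ (by linarith), one_smul]
  have ny : ‖y‖⁻¹ • y = F.vec T' := by
    rw [hy, norm_smul, F.norm_vec, mul_one, norm_inv, Real.norm_eq_abs,
      abs_of_pos (show 0 < F.vec T' 3 by linarith), inv_inv, smul_smul,
      mul_inv_cancel₀ (by linarith), one_smul]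
  have hsub := norm_normalize_sub_le (x := x) (y := y)
    (norm_pos_iff.mp (by linarith)) (norm_pos_iff.mp (by linarith))
  rw [nx, ny, F.norm_vec_sub] at hsub
  have hd := R.norm_dir_sub_le_angle R'
  have hxy : ‖x - y‖ ≤ 2 * (8 * ρ * R.angle R') := by
    refine norm_le_of_abs_coord_le fun i => ?_
    rw [PiLp.sub_apply]
    by_cases hi : i = 3
    · subst hi
      rw [hx3, hy3, sub_self, abs_zero]
      have := R.angle_nonneg R'
      positivity
    · rw [hxi i hi, hyi i hi, ← mul_sub, abs_mul, abs_of_pos hρ]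
      have := R.abs_slope_sub_le R' i
      calc ρ * |R.slope i - R'.slope i| ≤ ρ * (8 * R.angle R') := by
            gcongr; linarith
        _ = 8 * ρ * R.angle R' := by ring
  refine hsub.trans ?_
  rw [div_le_iff₀ (by linarith)]
  have : 0 ≤ 32 * ρ * R.angle R' := by
    have := R.angle_nonneg R'
    positivity
  nlinarith

theorem angle_le_rescale (hρ : 0 < ρ) (hρ1 : ρ ≤ 1) (h : U.CoversTube ρ T)
    (h' : U.CoversTube ρ T') : T.angle T' ≤
      64 * ρ * (F.rescale hρ hρ1 T h).angle (F.rescale hρ hρ1 T' h') := by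
  linarith [F.norm_dir_sub_le hρ hρ1 h h', T.angle_le_two_mul_norm T']

/-- The base point is recovered from the image line: its preimage meets `{x₄ = 0}` there. -/
theorem base_eq_hit (hρ1 : ρ ≤ 1) (h : U.CoversTube ρ T) :
    T.base - U.base = hit (F.L.symm (F.pos T)) T.dir := by
  have h3 : F.vec T 3 ≠ 0 := by linarith [F.half_le_vec hρ1 h]
  have h4 := T.dir_three_pos.ne'
  set c := F.L (T.base - U.base) 3 / F.vec T 3 with hc
  have e : F.L.symm (F.pos T) = (T.base - U.base) - (c * F.sgn) • T.dir := by
    rw [pos, hit, map_sub, F.L.symm_apply_apply, ← hc, vec, smul_smul, map_smul,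
      F.L.symm_apply_apply]
  rw [hit, e]
  have e3 : ((T.base - U.base) - (c * F.sgn) • T.dir) 3 = -(c * F.sgn) * T.dir 3 := by
    simp [T.base_last, U.base_last]
  rw [e3, mul_div_cancel_right₀ _ h4, neg_smul]
  abel

/-- Rescaling expands the distance of lines at least by `1 / (256 ρ)`. -/
theorem lineDist_le_rescale (hρ : 0 < ρ) (hρ1 : ρ ≤ 1 / 2) (h : U.CoversTube ρ T)
    (h' : U.CoversTube ρ T') : T.lineDist T' ≤
      256 * ρ * (F.rescale hρ (by linarith) T h).lineDist (F.rescale hρ (by linarith) T' h') := by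
  have hρ2 : ρ ≤ 1 := by linarith
  set R := F.rescale hρ hρ2 T h with hR
  set R' := F.rescale hρ hρ2 T' h' with hR'
  have h1 := F.norm_dir_sub_le hρ hρ2 h h'
  have h2 := F.angle_le_rescale hρ hρ2 h h'
  rw [← hR, ← hR'] at h1 h2
  have hp : ‖F.pos T - F.pos T'‖ ≤ 4 * ρ * ‖R.base - R'.base‖ := by
    refine abs_le_of_sq_le_sq' ?_ (by positivity) |>.2
    rw [mul_pow, norm_sq_eq_coords, norm_sq_eq_coords]
    have e : ∀ i, i ≠ 3 → (R.base - R'.base) i = 1 / 4 / ρ * (F.pos T - F.pos T') i := by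
      intro i hi
      simp only [hR, hR', rescale, PiLp.sub_apply, dilation_apply, if_neg hi]
      ring
    rw [e 0 (by decide), e 1 (by decide), e 2 (by decide)]
    simp only [PiLp.sub_apply, F.pos_three hρ2 h, F.pos_three hρ2 h', R.base_last, R'.base_last]
    apply le_of_eq
    field_simp
    ring
  have hpn : ∀ {S : TubeLine}, U.CoversTube ρ S → ‖F.L.symm (F.pos S)‖ ≤ 1 := by
    intro S hS
    rw [F.L.symm.norm_map]
    have := norm_le_of_abs_coord_le (F.abs_pos_le hρ2 hS)
    linarith
  have hb := norm_hit_sub_le T'.norm_dir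
    (T.half_le_dir.trans (le_abs_self _)) (T'.half_le_dir.trans (le_abs_self _)) (hpn h) (hpn h')
  rw [← F.base_eq_hit hρ2 h, ← F.base_eq_hit hρ2 h', ← map_sub, F.L.symm.norm_map,
    sub_sub_sub_cancel_right] at hb
  have hn := norm_nonneg (R.base - R'.base)
  have ha := R.angle_nonneg R'
  unfold TubeLine.lineDist
  nlinarith [mul_nonneg hρ.le hn, mul_nonneg hρ.le ha]

end Frame

end

/-! ### The rescaling of a shaded collection -/

section

namespace Frame

variable {U : TubeLine} (F : Frame U) {δ ρ : ℝ} {T : TubeLine}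

/-- The rescaling map of the frame. -/
def map (ρ : ℝ) (x : E4) : E4 := dilation ρ (F.L (x - U.base))

theorem map_sub_map (ρ : ℝ) (x y : E4) : F.map ρ x - F.map ρ y = dilation ρ (F.L (x - y)) := by
  rw [map, map, ← dilation_sub, ← _root_.map_sub, sub_sub_sub_cancel_right]

theorem norm_map_sub_le (hρ : 0 < ρ) (hρ1 : ρ ≤ 1) (x y : E4) :
    ‖F.map ρ x - F.map ρ y‖ ≤ 1 / 4 / ρ * ‖x - y‖ := by
  rw [map_sub_map]
  exact (norm_dilation_le hρ hρ1 _).trans_eq (by rw [F.L.norm_map])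

theorem abs_map_le_of_mem_line (hρ : 0 < ρ) (h : U.CoversTube ρ T) {t : ℝ}
    (ht : |t| ≤ 3) {i : Fin 4} (hi : i ≠ 3) : |F.map ρ (T.base + t • T.dir) i| ≤ 1 / 2 := by
  have e : F.L (T.base + t • T.dir - U.base) i =
      F.L (T.base - U.base) i + (t * F.sgn) * F.vec T i := by
    rw [show T.base + t • T.dir - U.base = (T.base - U.base) + t • T.dir by abel, _root_.map_add,
      _root_.map_smul, vec, PiLp.add_apply, PiLp.smul_apply, PiLp.smul_apply, smul_eq_mul,
      smul_eq_mul]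
    have := F.sgn_sq
    linear_combination (- t * F.L T.dir i) * this
  rw [map, dilation_apply, if_neg hi, e, abs_mul, abs_of_pos (show 0 < 1 / 4 / ρ by positivity)]
  have h1 : |F.L (T.base - U.base) i| ≤ ρ / 2 :=
    (abs_coord_le_norm _ i).trans ((F.L.norm_map _).trans_le (norm_base_sub_le h))
  have h2 : |t * F.sgn * F.vec T i| ≤ 3 * (ρ / 2) := by
    rw [abs_mul, abs_mul, F.abs_sgn, mul_one]
    exact mul_le_mul ht (F.abs_vec_le h hi) (abs_nonneg _) (by norm_num)
  have h3 : |F.L (T.base - U.base) i + t * F.sgn * F.vec T i| ≤ 2 * ρ :=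
    (abs_add_le _ _).trans (by linarith)
  calc 1 / 4 / ρ * |F.L (T.base - U.base) i + t * F.sgn * F.vec T i| ≤ 1 / 4 / ρ * (2 * ρ) := by
        gcongr
    _ = 1 / 2 := by field_simp; norm_num

/-- Cubes meeting the image of the `δ`-tube around `T` lie in the tube around the rescaled line. -/
theorem cube_subset_tube_rescale (hδ : 0 < δ) (hρ : 0 < ρ) (hρ1 : ρ ≤ 1) (hδρ : δ / ρ ≤ 1 / 100)
    (h : U.CoversTube ρ T) {x : E4} (hx : x ∈ T.tube δ) {m : Fin 4 → ℤ}
    (hm : F.map ρ x ∈ cube (δ / ρ) m) :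
    cube (δ / ρ) m ⊆ (F.rescale hρ hρ1 T h).tube (δ / ρ) := by
  have hδ1 : δ ≤ 1 / 100 := by
    rw [div_le_iff₀ hρ] at hδρ
    linarith
  have hr : 0 < δ / ρ := div_pos hδ hρ
  obtain ⟨y, ⟨t, rfl⟩, hy⟩ := Metric.mem_thickening_iff.mp hx.1
  rw [dist_eq_norm] at hy
  have hφ : ‖F.map ρ x - F.map ρ (T.base + t • T.dir)‖ ≤ 2 * (δ / ρ) := by
    refine (F.norm_map_sub_le hρ hρ1 _ _).trans ?_
    calc 1 / 4 / ρ * ‖x - (T.base + t • T.dir)‖ ≤ 1 / 4 / ρ * (2 * 4 * δ) := by gcongr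
      _ = 2 * (δ / ρ) := by ring
  -- the tube lies in `[-1, 1]⁴`, and the last coordinate of `T.base + t • T.dir` is `t * T.dir 3`
  have ht : |t| ≤ 3 := by
    have h1 := abs_coord_le_norm (x - (T.base + t • T.dir)) 3
    simp only [PiLp.sub_apply, PiLp.add_apply, PiLp.smul_apply, smul_eq_mul, T.base_last,
      zero_add] at h1
    have h2 := (hx.2 3)
    have h3 : |t * T.dir 3| ≤ 1 + 8 / 100 := by
      have := abs_le.mp h1
      rw [abs_le]
      constructor <;> linarith [h2.1, h2.2]
    rw [abs_mul, abs_of_pos T.dir_three_pos] at h3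
    nlinarith [abs_nonneg t, T.half_le_dir]
  intro z hz
  have hzx : ∀ i, |z i - F.map ρ x i| ≤ δ / ρ := by
    intro i
    have h1 := hz i
    have h2 := hm i
    rw [abs_le]
    constructor <;> linarith [h1.1, h1.2, h2.1, h2.2]
  have hzx' : ‖z - F.map ρ x‖ ≤ 2 * (δ / ρ) := norm_le_of_abs_coord_le fun i => hzx i
  refine ⟨Metric.mem_thickening_iff.mpr ⟨F.map ρ (T.base + t • T.dir), ?_, ?_⟩, fun i => ?_⟩
  · rw [F.rescale_line hρ hρ1 h]
    exact ⟨_, ⟨t, rfl⟩, rfl⟩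
  · rw [dist_eq_norm]
    have := norm_sub_le_norm_sub_add_norm_sub z (F.map ρ x) (F.map ρ (T.base + t • T.dir))
    linarith
  · rw [Set.mem_Icc, ← abs_le]
    have h1 := abs_le.mp (hzx i)
    -- the factor `1 / 4` of the rescaling keeps the image well inside `[-1, 1]⁴`
    have h2 : |F.map ρ x i| ≤ 3 / 4 := by
      by_cases hi : i = 3
      · subst hi
        rw [map, dilation_apply, if_pos rfl, abs_mul, abs_of_pos (show (0 : ℝ) < 1 / 4 by norm_num)]
        have e1 := abs_coord_le_norm (F.L (x - U.base)) 3
        rw [F.L.norm_map] at e1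
        have e2 : ‖x‖ ≤ 2 * 1 := norm_le_of_abs_coord_le fun j => abs_le.mpr (hx.2 j)
        have e3 := norm_sub_le x U.base
        linarith [U.norm_base_le]
      · have e1 := F.abs_map_le_of_mem_line hρ h ht hi
        have e2 := (abs_coord_le_norm _ i).trans hφ
        rw [PiLp.sub_apply] at e2
        have e3 := abs_le.mp e1
        have e4 := abs_le.mp e2
        rw [abs_le]
        constructor <;> linarith
    have h3 := abs_le.mp h2
    rw [abs_le]
    constructor <;> linarith

/-- Cubes of one tube whose images share a cube of side `δ / ρ`: there are `≲ 1 / ρ` of them. -/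
theorem card_map_fiber_le (hδ : 0 < δ) (hρ : 0 < ρ) (hρ1 : ρ ≤ 1) (h : U.CoversTube ρ T)
    (S : Finset (Fin 4 → ℤ)) (hS : ∀ k ∈ S, CubeIn δ T k) {m : Fin 4 → ℤ}
    (hm : ∀ k ∈ S, F.map ρ (corner δ k) ∈ cube (δ / ρ) m) : (S.card : ℝ) ≤ 10 ^ 10 / ρ := by
  have h1ρ : 1 ≤ 1 / ρ := (one_le_div hρ).mpr hρ1
  have hδρ : δ ≤ δ / ρ := by
    rw [le_div_iff₀ hρ]
    nlinarith
  have h1 := card_cubeIn_le (l := T) hδ S hS (a := 104 * (δ / ρ)) (by positivity) (by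
    intro k hk k' hk'
    have e1 := hm k hk 3
    have e2 := hm k' hk' 3
    have e3 : |(F.map ρ (corner δ k) - F.map ρ (corner δ k')) 3| ≤ δ / ρ := by
      rw [PiLp.sub_apply, abs_le]
      constructor <;> linarith [e1.1, e1.2, e2.1, e2.2]
    rw [F.map_sub_map, dilation_apply, if_pos rfl, abs_mul,
      abs_of_pos (show (0 : ℝ) < 1 / 4 by norm_num)] at e3
    -- the difference of the two corners is almost a multiple of the direction
    set a := δ * (k 3 : ℝ) - δ * k' 3 with ha
    set e := corner δ k - corner δ k' - (a / T.dir 3) • T.dir with he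
    have e4 : ‖e‖ ≤ 48 * δ := by
      have n1 := T.norm_sub_pt_le (hS k hk (corner_mem_cube hδ k))
      have n2 := T.norm_sub_pt_le (hS k' hk' (corner_mem_cube hδ k'))
      have e5 : e = (corner δ k - T.pt (corner δ k 3)) - (corner δ k' - T.pt (corner δ k' 3)) := by
        rw [he, TubeLine.pt, TubeLine.pt, ha, sub_div, sub_smul, corner_apply, corner_apply]
        abel
      rw [e5]
      refine (norm_sub_le _ _).trans ?_
      linarith
    have e6 : F.L (corner δ k - corner δ k') 3 = (a / T.dir 3) * F.L T.dir 3 + F.L e 3 := by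
      rw [he, _root_.map_sub F.L (corner δ k - corner δ k'), _root_.map_smul, PiLp.sub_apply,
        PiLp.smul_apply, smul_eq_mul]
      ring
    have e7 : 1 / 2 ≤ |F.L T.dir 3| := by
      have := F.half_le_abs_vec hρ1 h
      rwa [vec, PiLp.smul_apply, smul_eq_mul, abs_mul, F.abs_sgn, one_mul] at this
    have e8 : |F.L e 3| ≤ 48 * δ := (abs_coord_le_norm _ 3).trans ((F.L.norm_map e).trans_le e4)
    have e9 : |(a / T.dir 3) * F.L T.dir 3| ≤ 52 * (δ / ρ) := by
      have : (a / T.dir 3) * F.L T.dir 3 = F.L (corner δ k - corner δ k') 3 - F.L e 3 := by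
        rw [e6]; ring
      rw [this]
      refine (abs_sub _ _).trans ?_
      linarith
    rw [abs_mul, abs_div, abs_of_pos T.dir_three_pos] at e9
    have e10 : |a| ≤ |a| / T.dir 3 := by
      rw [le_div_iff₀ T.dir_three_pos]
      have := (le_abs_self _).trans (T.abs_dir_le 3)
      nlinarith [abs_nonneg a]
    have e11 : |a| * (1 / 2) ≤ |a| / T.dir 3 * |F.L T.dir 3| :=
      mul_le_mul e10 e7 (by norm_num) (div_nonneg (abs_nonneg _) T.dir_three_pos.le)
    linarith [le_abs_self a])
  have h2 : 104 * (δ / ρ) / δ = 104 * (1 / ρ) := by field_simp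
  have h3 : (10 : ℝ) ^ 10 / ρ = 10 ^ 10 * (1 / ρ) := by ring
  rw [h2] at h1
  rw [h3]
  norm_num at h1 h1ρ ⊢
  linarith

/-- The images of all cubes of one fine cell meet boundedly many cubes of side `δ / ρ`. -/
theorem card_cubes_le_card_fineCell (hδ : 0 < δ) (hρ : 0 < ρ) (hρ1 : ρ ≤ 1)
    (K S : Finset (Fin 4 → ℤ)) (hS : ∀ m ∈ S, ∃ k ∈ K, ∃ x ∈ cube δ k,
      F.map ρ x ∈ cube (δ / ρ) m) :
    S.card ≤ 7 ^ 4 * (K.image (fineCell δ ρ U)).card := by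
  have hr : 0 < δ / ρ := div_pos hδ hρ
  have hδρ : δ ≤ δ / ρ := by
    rw [le_div_iff₀ hρ]
    nlinarith
  choose! f hf x hx hxm using hS
  refine Finset.card_le_mul_card_image_of_maps_to (f := fun m => fineCell δ ρ U (f m))
    (fun m hm => Finset.mem_image_of_mem _ (hf m hm)) _ fun b _ => ?_
  have hcard := card_le_of_grid_of_sub (S.filter fun m => fineCell δ ρ U (f m) = b) (ι := Fin 4)
    (fun m i => (m i : ℝ)) 3 ?_ ?_
  · simpa using hcard
  · intro m hm m' hm' i
    obtain ⟨hm, hb⟩ := Finset.mem_filter.mp hm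
    obtain ⟨hm', hb'⟩ := Finset.mem_filter.mp hm'
    have hcell := hb.trans hb'.symm
    set k := f m with hk
    set k' := f m' with hk'
    set a := δ * (k 3 : ℝ) - δ * k' 3 with ha
    have ha1 : |a| ≤ δ / ρ := abs_sub_le_of_fineCell_three_eq hδ hρ (congrFun hcell 3)
    -- `e` is what remains of the difference of the corners after a motion along `U`: the cells of
    -- `fineCell` have length `δ / ρ` along `U` and only `δ` across it
    set e := corner δ k - corner δ k' - (a / U.dir 3) • U.dir with he
    have he1 : ‖e‖ ≤ 2 * δ := by
      refine norm_le_of_abs_coord_le fun j => ?_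
      have ej : e j = (δ * (k j : ℝ) - δ * k' j) - a * U.slope j := by
        simp only [he, PiLp.sub_apply, PiLp.smul_apply, corner_apply, smul_eq_mul, TubeLine.slope]
        ring
      rw [ej]
      by_cases hj : j = 3
      · subst hj
        rw [U.slope_three, mul_one, sub_self, abs_zero]
        exact hδ.le
      · exact abs_sub_le_of_fineCell_eq hδ hj (congrFun hcell j)
    have hcorner : |(F.map ρ (corner δ k) - F.map ρ (corner δ k')) i| ≤ δ / ρ := by
      rw [F.map_sub_map]
      have e1 : corner δ k - corner δ k' = (a / U.dir 3) • U.dir + e := by rw [he]; abel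
      have e2 : ∀ j, |F.L e j| ≤ 2 * δ := fun j =>
        (abs_coord_le_norm _ j).trans ((F.L.norm_map e).trans_le he1)
      rw [e1, _root_.map_add, _root_.map_smul, dilation_apply, PiLp.add_apply, PiLp.smul_apply,
        smul_eq_mul]
      by_cases hi : i = 3
      · subst hi
        rw [if_pos rfl, abs_mul, abs_of_pos (show (0 : ℝ) < 1 / 4 by norm_num)]
        have e3 : |a / U.dir 3 * F.L U.dir 3| ≤ 2 * (δ / ρ) := by
          have := F.abs_sgn
          unfold sgn at this
          rw [abs_mul, this, mul_one, abs_div, abs_of_pos U.dir_three_pos,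
            div_le_iff₀ U.dir_three_pos]
          nlinarith [U.half_le_dir]
        have := abs_add_le (a / U.dir 3 * F.L U.dir 3) (F.L e 3)
        linarith [e2 3]
      · rw [if_neg hi, F.L_dir i hi, mul_zero, zero_add, abs_mul,
          abs_of_pos (show 0 < 1 / 4 / ρ by positivity)]
        calc 1 / 4 / ρ * |F.L e i| ≤ 1 / 4 / ρ * (2 * δ) := by gcongr; exact e2 i
          _ ≤ δ / ρ := by
            rw [show 1 / 4 / ρ * (2 * δ) = 1 / 2 * (δ / ρ) by ring]
            linarith
    have hpt : ∀ m ∈ S, |(F.map ρ (x m) - F.map ρ (corner δ (f m))) i| ≤ 1 / 2 * (δ / ρ) := by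
      intro m hm
      refine (abs_coord_le_norm _ i).trans ((F.norm_map_sub_le hρ hρ1 _ _).trans ?_)
      calc 1 / 4 / ρ * ‖x m - corner δ (f m)‖ ≤ 1 / 4 / ρ * (2 * δ) := by
            gcongr; exact norm_sub_corner_le (hx m hm)
        _ = 1 / 2 * (δ / ρ) := by ring
    have h1 := abs_le.mp (hpt m hm)
    have h2 := abs_le.mp (hpt m' hm')
    have h3 := abs_le.mp hcorner
    simp only [PiLp.sub_apply] at h1 h2 h3
    have h4 : |F.map ρ (x m) i - F.map ρ (x m') i| ≤ 2 * (δ / ρ) := by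
      rw [abs_le]
      constructor <;> linarith
    have h5 := (mem_cube_iff hr m _).mp (hxm m hm) i
    have h6 := (mem_cube_iff hr m' _).mp (hxm m' hm') i
    rw [← h5, ← h6]
    refine (abs_floor_sub_floor_le _ _).trans ?_
    rw [← sub_div, abs_div, abs_of_pos hr]
    have h7 := (div_le_iff₀ hr).mpr h4
    push_cast
    linarith
  · intro m _ m' _ h
    funext i
    have := h i
    rw [← Int.cast_sub, ← Int.cast_abs] at this
    have h2 : |m i - m' i| < 1 := by exact_mod_cast this
    rw [Int.abs_lt_one_iff] at h2
    linarith

end Frame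

/-- The unit rescaling exists as a shaded collection, and its essential distinctness, its mass, its
volume and its stickiness are those of the given collection up to constants. -/
theorem exists_rescaling {U : TubeLine} (F : Frame U) {δ ρ : ℝ} (hδ : 0 < δ) (hρ : 0 < ρ)
    (hρ1 : ρ ≤ 1 / 2) (hδρ : δ / ρ ≤ 1 / 100) (𝒯 : ShadedTubes δ)
    (hcov : ∀ T ∈ 𝒯.tubes, U.CoversTube ρ T)
    (hsep : ∀ T ∈ 𝒯.tubes, ∀ T' ∈ 𝒯.tubes, T ≠ T' → 256 * δ < T.lineDist T') :
    ∃ 𝒯' : ShadedTubes (δ / ρ), 𝒯'.IsImageUnder (F.map ρ) 𝒯 ∧ 𝒯'.EssentiallyDistinct ∧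
      (𝒯.incidences.card : ℝ) ≤ 10 ^ 10 / ρ * 𝒯'.incidences.card ∧
      (𝒯'.incidences.image Prod.snd).card ≤
        7 ^ 4 * (𝒯.incidences.image fun p => fineCell δ ρ U p.2).card ∧
      ∀ (r : ℝ) (K : ℕ) (𝒱 : Finset TubeLine), 0 < r →
        (∀ T ∈ 𝒯.tubes, ∃ V ∈ 𝒱, V.CoversTube (ρ * r) T) → ParallelBound 𝒱 (ρ * r) K →
        ∃ 𝒱' : Finset TubeLine, (∀ T ∈ 𝒯'.tubes, ∃ V ∈ 𝒱', V.CoversTube r T) ∧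
          ParallelBound 𝒱' r (10 ^ 29 * K) := by
  have hρ2 : ρ ≤ 1 := by linarith
  have hr : 0 < δ / ρ := div_pos hδ hρ
  -- on lines not covered by `U` the value of `ψ` is irrelevant
  set ψ : TubeLine → TubeLine := fun T =>
    if h : U.CoversTube ρ T then F.rescale hρ hρ2 T h else T with hψ
  have hψT : ∀ T, ∀ h : U.CoversTube ρ T, ψ T = F.rescale hρ hρ2 T h := fun T h => dif_pos h
  have hdist : ∀ T ∈ 𝒯.tubes, ∀ T' ∈ 𝒯.tubes,
      T.lineDist T' ≤ 256 * ρ * (ψ T).lineDist (ψ T') := by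
    intro T hT T' hT'
    rw [hψT T (hcov T hT), hψT T' (hcov T' hT')]
    exact F.lineDist_le_rescale hρ hρ1 _ _
  have hdist' : ∀ T ∈ 𝒯.tubes, ∀ T' ∈ 𝒯.tubes, T ≠ T' → δ / ρ < (ψ T).lineDist (ψ T') := by
    intro T hT T' hT' hne
    rw [div_lt_iff₀ hρ]
    have h1 := hsep T hT T' hT' hne
    have h2 := hdist T hT T' hT'
    nlinarith
  have hinj : ∀ T ∈ 𝒯.tubes, ∀ T' ∈ 𝒯.tubes, ψ T = ψ T' → T = T' := by
    intro T hT T' hT' he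
    by_contra hne
    have := hdist' T hT T' hT' hne
    rw [he, TubeLine.lineDist_self] at this
    linarith
  have hmem : ∀ T ∈ 𝒯.tubes, ∀ m : Fin 4 → ℤ,
      (cube (δ / ρ) m ∩ F.map ρ '' 𝒯.shadeSet T).Nonempty → cube (δ / ρ) m ⊆ (ψ T).tube (δ / ρ) := by
    rintro T hT m ⟨z, hz, x, hx, rfl⟩
    rw [hψT T (hcov T hT)]
    simp only [ShadedTubes.shadeSet, Set.mem_iUnion, exists_prop] at hx
    obtain ⟨k, hk, hxk⟩ := hx
    exact F.cube_subset_tube_rescale hδ hρ hρ2 hδρ (hcov T hT) (𝒯.cube_subset_tube T hT k hk hxk) hz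
  -- the cubes inside a tube have indices in `[-N, N]`, so that the shadings are finite sets
  set N : ℤ := ⌈1 / (δ / ρ)⌉ with hN
  let 𝒯' : ShadedTubes (δ / ρ) :=
    { tubes := 𝒯.tubes.image ψ
      shade := fun T' => (Fintype.piFinset fun _ : Fin 4 => Finset.Icc (-N) N).filter fun m =>
        ∃ T ∈ 𝒯.tubes, ψ T = T' ∧ (cube (δ / ρ) m ∩ F.map ρ '' 𝒯.shadeSet T).Nonempty
      cube_subset_tube := by
        rintro T' - m hm
        obtain ⟨-, T, hT, rfl, h⟩ := Finset.mem_filter.mp hm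
        exact hmem T hT m h }
  have hshade : ∀ T ∈ 𝒯.tubes, ∀ m, m ∈ 𝒯'.shade (ψ T) ↔
      (cube (δ / ρ) m ∩ F.map ρ '' 𝒯.shadeSet T).Nonempty := by
    intro T hT m
    constructor
    · intro hm
      obtain ⟨-, T', hT', he, h⟩ := Finset.mem_filter.mp hm
      rwa [hinj T' hT' T hT he] at h
    · intro h
      refine Finset.mem_filter.mpr ⟨Fintype.mem_piFinset.mpr fun i => ?_, T, hT, rfl, h⟩
      have h1 := abs_le.mp (CubeIn.abs_le hr (l := ψ T) (k := m) (hmem T hT m h) i)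
      have h2 : (1 / (δ / ρ) : ℝ) ≤ N := Int.le_ceil _
      have h3 : (m i : ℝ) ≤ 1 / (δ / ρ) := by rw [le_div_iff₀ hr]; linarith
      have h4 : -(m i : ℝ) ≤ 1 / (δ / ρ) := by rw [le_div_iff₀ hr]; linarith
      rw [Finset.mem_Icc]
      constructor
      · have : -(m i : ℝ) ≤ N := h4.trans h2
        have : -(m i) ≤ N := by exact_mod_cast this
        linarith
      · have : (m i : ℝ) ≤ N := h3.trans h2
        exact_mod_cast this
  refine ⟨𝒯', ⟨fun T hT => ⟨ψ T, Finset.mem_image_of_mem _ hT, ?_, hshade T hT⟩, ?_⟩, ?_, ?_, ?_, ?_⟩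
  · rw [hψT T (hcov T hT)]
    exact F.rescale_line hρ hρ2 _
  · intro T' hT'
    obtain ⟨T, hT, rfl⟩ := Finset.mem_image.mp hT'
    refine ⟨T, hT, ?_⟩
    rw [hψT T (hcov T hT)]
    exact F.rescale_line hρ hρ2 _
  · intro T hT T' hT' hne
    obtain ⟨S, hS, rfl⟩ := Finset.mem_image.mp hT
    obtain ⟨S', hS', rfl⟩ := Finset.mem_image.mp hT'
    exact hdist' S hS S' hS' fun h => hne (h ▸ rfl)
  · rw [ShadedTubes.card_incidences, ShadedTubes.card_incidences]
    push_cast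
    rw [Finset.sum_image (fun T hT T' hT' he => hinj T hT T' hT' he), Finset.mul_sum]
    refine Finset.sum_le_sum fun T hT => ?_
    set c : (Fin 4 → ℤ) → Fin 4 → ℤ := fun k i => ⌊F.map ρ (corner δ k) i / (δ / ρ)⌋ with hc
    have hck : ∀ k, F.map ρ (corner δ k) ∈ cube (δ / ρ) (c k) := fun k =>
      (mem_cube_iff hr _ _).mpr fun i => rfl
    refine (card_le_mul_card_image_real (𝒯.shade T) c (c := 10 ^ 10 / ρ) fun k _ => ?_).trans ?_
    · refine F.card_map_fiber_le hδ hρ hρ2 (hcov T hT) _ (fun k' hk' => ?_) (m := c k)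
        fun k' hk' => ?_
      · exact 𝒯.cube_subset_tube T hT k' (Finset.mem_of_mem_filter k' hk')
      · rw [← (Finset.mem_filter.mp hk').2]
        exact hck k'
    · refine mul_le_mul_of_nonneg_left ?_ (by positivity)
      norm_cast
      refine Finset.card_le_card fun m hm => ?_
      obtain ⟨k, hk, rfl⟩ := Finset.mem_image.mp hm
      rw [hshade T hT]
      refine ⟨_, hck k, corner δ k, ?_, rfl⟩
      simp only [ShadedTubes.shadeSet, Set.mem_iUnion, exists_prop]
      exact ⟨k, hk, corner_mem_cube hδ k⟩
  · have := F.card_cubes_le_card_fineCell hδ hρ hρ2 (𝒯.incidences.image Prod.snd)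
      (𝒯'.incidences.image Prod.snd) (by
        intro m hm
        obtain ⟨⟨T', m'⟩, hp, rfl⟩ := Finset.mem_image.mp hm
        obtain ⟨hT', hm'⟩ := ShadedTubes.mem_incidences.mp hp
        obtain ⟨T, hT, rfl⟩ := Finset.mem_image.mp hT'
        obtain ⟨z, hz, x, hx, rfl⟩ := (hshade T hT m').mp hm'
        simp only [ShadedTubes.shadeSet, Set.mem_iUnion, exists_prop] at hx
        obtain ⟨k, hk, hxk⟩ := hx
        exact ⟨k, Finset.mem_image.mpr ⟨(T, k), ShadedTubes.mem_incidences.mpr ⟨hT, hk⟩, rfl⟩,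
          x, hxk, hz⟩)
    rwa [Finset.image_image] at this
  · intro r K 𝒱 hr0 hV hK
    -- separated lines at scale `r` with nearly equal directions come from lines that are
    -- `ρ r / 20`-separated and whose directions differ by at most `128 ρ r`
    refine exists_cover_of_separated_bound _ hr0 _ fun S' hS' hsep' W => ?_
    set G := S'.filter fun V => V.angle W ≤ r with hG
    rcases G.eq_empty_or_nonempty with h0 | ⟨R₀, hR₀⟩
    · rw [h0]; simp
    have hpre : ∀ R ∈ G, ∃ T ∈ 𝒯.tubes, ψ T = R := fun R hR =>
      Finset.mem_image.mp (hS' (Finset.mem_of_mem_filter R hR))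
    choose! f hf hfψ using hpre
    have hinjf : Set.InjOn f G := by
      intro R hR R' hR' he
      rw [← hfψ R hR, ← hfψ R' hR', he]
    rw [← Finset.card_image_of_injOn hinjf]
    have hρr : 0 < ρ * r := mul_pos hρ hr0
    have := card_separated_angle_le (S := G.image f) (𝒱 := 𝒱) (r := ρ * r) (s := ρ * r / 20)
      (a := 128 * (ρ * r)) (b := ρ * r / 2) (K := K) hρr (by positivity) (by
        intro T hT T' hT' hne
        obtain ⟨R, hR, rfl⟩ := Finset.mem_image.mp hT
        obtain ⟨R', hR', rfl⟩ := Finset.mem_image.mp hT'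
        have h1 := hsep' R (Finset.mem_of_mem_filter R hR) R' (Finset.mem_of_mem_filter R' hR')
          (fun h => hne (h ▸ rfl))
        rw [← hfψ R hR, ← hfψ R' hR', hψT _ (hcov _ (hf R hR)), hψT _ (hcov _ (hf R' hR'))] at h1
        have h2 := h1.trans_le (F.lineDist_rescale_le hρ hρ2 _ _)
        rw [div_mul_eq_mul_div, lt_div_iff₀ hρ] at h2
        linarith) (by
        intro T hT
        obtain ⟨R, hR, rfl⟩ := Finset.mem_image.mp hT
        exact hV _ (hf R hR)) hK (f R₀) (by
        intro T hT
        obtain ⟨R, hR, rfl⟩ := Finset.mem_image.mp hT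
        refine (F.angle_le_rescale hρ hρ2 (hcov _ (hf R hR)) (hcov _ (hf R₀ hR₀))).trans ?_
        rw [← hψT, ← hψT, hfψ R hR, hfψ R₀ hR₀]
        have h1 := TubeLine.angle_triangle R W R₀
        have h2 := (Finset.mem_filter.mp hR).2
        have h3 := (Finset.mem_filter.mp hR₀).2
        rw [TubeLine.angle_comm] at h3
        nlinarith) 60 3084 (by
        rw [div_le_iff₀ (by positivity)]; push_cast; linarith) (by
        rw [div_le_iff₀ hρr]; push_cast; linarith)
    refine this.trans ?_
    have e : (2 * 60 + 1) ^ 8 * (2 * 3084 + 1) ^ 3 ≤ 10 ^ 29 := by norm_num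
    calc (2 * 60 + 1) ^ 8 * (K * (2 * 3084 + 1) ^ 3)
        = (2 * 60 + 1) ^ 8 * (2 * 3084 + 1) ^ 3 * K := by ring
      _ ≤ 10 ^ 29 * K := Nat.mul_le_mul_right _ e

end

/-! ### The coarse collection -/

section

/-- The sixteen `ρ`-cubes `m + {0, 1}⁴`. They cover all `δ`-cubes with corner in the `ρ`-cube `m`;
the grids at scales `δ` and `ρ` need not be nested, so `m` alone would not do. -/
def block (m : Fin 4 → ℤ) : Finset (Fin 4 → ℤ) :=
  Fintype.piFinset fun i => Finset.Icc (m i) (m i + 1)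

theorem mem_block {m c : Fin 4 → ℤ} : c ∈ block m ↔ ∀ i, m i ≤ c i ∧ c i ≤ m i + 1 := by
  simp only [block, Fintype.mem_piFinset, Finset.mem_Icc]

theorem card_block (m : Fin 4 → ℤ) : (block m).card = 16 := by
  rw [block, Fintype.card_piFinset]
  have : ∀ i, (Finset.Icc (m i) (m i + 1)).card = 2 := fun i => by rw [Int.card_Icc]; omega
  simp [this]

theorem self_mem_block (m : Fin 4 → ℤ) : m ∈ block m := mem_block.mpr fun i => by omega

theorem eq_of_mem_block {m m' c : Fin 4 → ℤ} (h : c ∈ block m) (h' : c ∈ block m')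
    (hp : ∀ i, m i % 2 = m' i % 2) : m = m' := by
  funext i
  have h1 := mem_block.mp h i
  have h2 := mem_block.mp h' i
  have h3 := hp i
  omega

variable {δ ρ : ℝ}

/-- The block of a coarse cell covers the `δ`-cubes of that cell. -/
theorem exists_mem_block_of_mem_cube (hρ : 0 < ρ) (hδρ : δ ≤ ρ) {k : Fin 4 → ℤ} {x : E4}
    (hx : x ∈ cube δ k) : ∃ c ∈ block (coarseCell δ ρ k), x ∈ cube ρ c := by
  refine ⟨fun i => ⌊x i / ρ⌋, mem_block.mpr fun i => ?_, (mem_cube_iff hρ _ _).mpr fun i => rfl⟩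
  have h1 := (hx i).1
  have h2 := (hx i).2
  constructor
  · refine Int.floor_le_floor ?_
    gcongr
  · have h3 : x i / ρ ≤ δ * k i / ρ + 1 := by
      rw [div_add_one hρ.ne']
      gcongr
      linarith
    have := Int.floor_le_floor h3
    rwa [Int.floor_add_one] at this

theorem abs_sub_corner_le_of_mem_block (hρ : 0 < ρ) {k c : Fin 4 → ℤ} {y : E4}
    (hc : c ∈ block (coarseCell δ ρ k)) (hy : y ∈ cube ρ c) (i : Fin 4) :
    |y i - δ * k i| ≤ 2 * ρ := by
  have h1 := mem_block.mp hc i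
  have h2 := Int.floor_le (δ * k i / ρ)
  have h3 := Int.lt_floor_add_one (δ * k i / ρ)
  rw [le_div_iff₀ hρ] at h2
  rw [div_lt_iff₀ hρ] at h3
  have h4 := hy i
  have h5 : ((⌊δ * k i / ρ⌋ : ℤ) : ℝ) ≤ c i := by exact_mod_cast h1.1
  have h6 : (c i : ℝ) ≤ (⌊δ * k i / ρ⌋ : ℤ) + 1 := by exact_mod_cast h1.2
  rw [abs_le]
  constructor <;> nlinarith [h4.1, h4.2]

/-- The `ρ`-cubes of the block around a `δ`-cube in a tube lie in every covering `ρ`-tube: they stay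
within `4 ρ + 8 δ + 3 ρ / 2 < 8 ρ` of its axis, and within `[-1, 1]⁴` because the `δ`-cube has
distance about `2 ρ` from the boundary. -/
theorem cube_subset_tube_of_mem_block (hδ : 0 < δ) (hδρ : 8 * δ ≤ ρ) (hδ1 : δ ≤ 1 / 100)
    {T U : TubeLine} {k c : Fin 4 → ℤ} (hk : CubeIn δ T k) (hU : U.CoversTube ρ T)
    (hbd : ∀ i, |δ * k i| ≤ 1 - 2 * ρ) (hc : c ∈ block (coarseCell δ ρ k)) :
    cube ρ c ⊆ U.tube ρ := by
  intro y hy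
  have hρ : 0 < ρ := by linarith
  have h1 : ∀ i, |y i - δ * k i| ≤ 2 * ρ := abs_sub_corner_le_of_mem_block hρ hc hy
  have h2 : ‖y - corner δ k‖ ≤ 2 * (2 * ρ) := norm_le_of_abs_coord_le h1
  refine ⟨?_, fun i => ?_⟩
  · obtain ⟨x, ⟨t, rfl⟩, hx⟩ := Metric.mem_thickening_iff.mp (hk (corner_mem_cube hδ k)).1
    rw [dist_eq_norm] at hx
    have ht : |t| ≤ 3 := by
      have h3 := abs_coord_le_norm (corner δ k - (T.base + t • T.dir)) 3
      simp only [PiLp.sub_apply, PiLp.add_apply, PiLp.smul_apply, smul_eq_mul, T.base_last,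
        zero_add, corner_apply] at h3
      have h4 : |t * T.dir 3| ≤ 1 + 8 / 100 := by
        have e1 := abs_le.mp h3
        have e2 := abs_le.mp (hbd 3)
        rw [abs_le]
        constructor <;> linarith
      rw [abs_mul, abs_of_pos T.dir_three_pos] at h4
      nlinarith [abs_nonneg t, T.half_le_dir]
    refine Metric.mem_thickening_iff.mpr ⟨U.base + t • U.dir, ⟨t, rfl⟩, ?_⟩
    rw [dist_eq_norm]
    have e1 : y - (U.base + t • U.dir) = (y - corner δ k) +
        (corner δ k - (T.base + t • T.dir)) + ((T.base - U.base) + t • (T.dir - U.dir)) := by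
      rw [smul_sub]; abel
    have e2 : ‖(T.base - U.base) + t • (T.dir - U.dir)‖ ≤ 3 * (ρ / 2) := by
      refine (norm_add_le _ _).trans ?_
      rw [norm_smul, Real.norm_eq_abs]
      have n1 := T.norm_dir_sub_le_angle U
      have n2 : ‖T.base - U.base‖ + T.angle U ≤ ρ / 2 := hU
      nlinarith [norm_nonneg (T.base - U.base), norm_nonneg (T.dir - U.dir), abs_nonneg t]
    rw [e1]
    refine (norm_add_le _ _).trans_lt ?_
    have := norm_add_le (y - corner δ k) (corner δ k - (T.base + t • T.dir))
    linarith
  · have e1 := abs_le.mp (h1 i)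
    have e2 := abs_le.mp (hbd i)
    constructor <;> linarith

/-- The coarse collection of a set `J` of incidences whose tubes are covered by the `ρ`-tubes around
`u T`: the shading of `u T` consists of the blocks of the coarse cells that `J` meets. The parity
condition makes the blocks of different coarse cells disjoint. -/
theorem exists_coarse (hδ : 0 < δ) (hδρ : 8 * δ ≤ ρ) (hδ1 : δ ≤ 1 / 100)
    (u : TubeLine → TubeLine) (J : Finset (TubeLine × (Fin 4 → ℤ)))
    (hJ : ∀ p ∈ J, CubeIn δ p.1 p.2) (hu : ∀ p ∈ J, (u p.1).CoversTube ρ p.1)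
    (hbd : ∀ p ∈ J, ∀ i, |δ * p.2 i| ≤ 1 - 2 * ρ)
    (hpar : ∀ p ∈ J, ∀ p' ∈ J, ∀ i, coarseCell δ ρ p.2 i % 2 = coarseCell δ ρ p'.2 i % 2) :
    ∃ 𝒰 : ShadedTubes ρ, 𝒰.tubes = J.image (fun p => u p.1) ∧
      (∀ p ∈ J, cube δ p.2 ⊆ 𝒰.shadeSet (u p.1)) ∧
      (J.image fun p => (u p.1, coarseCell δ ρ p.2)).card ≤ 𝒰.incidences.card ∧
      (𝒰.incidences.image Prod.snd).card ≤ 16 * (J.image fun p => coarseCell δ ρ p.2).card ∧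
      ∀ c, ∃ m, ∀ U ∈ 𝒰.through c, ∃ p ∈ J, u p.1 = U ∧ coarseCell δ ρ p.2 = m := by
  have hρ : 0 < ρ := by linarith
  let 𝒰 : ShadedTubes ρ :=
    { tubes := J.image fun p => u p.1
      shade := fun U =>
        ((J.filter fun p => u p.1 = U).image fun p => coarseCell δ ρ p.2).biUnion block
      cube_subset_tube := by
        intro U _ c hc
        obtain ⟨m, hm, hc'⟩ := Finset.mem_biUnion.mp hc
        obtain ⟨p, hp, rfl⟩ := Finset.mem_image.mp hm
        obtain ⟨hp', rfl⟩ := Finset.mem_filter.mp hp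
        exact cube_subset_tube_of_mem_block hδ hδρ hδ1 (hJ p hp') (hu p hp') (hbd p hp') hc' }
  have hmem : ∀ U c, (U, c) ∈ 𝒰.incidences ↔
      ∃ p ∈ J, u p.1 = U ∧ c ∈ block (coarseCell δ ρ p.2) := by
    intro U c
    rw [ShadedTubes.mem_incidences]
    simp only [𝒰, Finset.mem_image, Finset.mem_biUnion, Finset.mem_filter]
    constructor
    · rintro ⟨-, m, ⟨p, ⟨hp, rfl⟩, rfl⟩, hc⟩
      exact ⟨p, hp, rfl, hc⟩
    · rintro ⟨p, hp, rfl, hc⟩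
      exact ⟨⟨p, hp, rfl⟩, _, ⟨p, ⟨hp, rfl⟩, rfl⟩, hc⟩
  refine ⟨𝒰, rfl, ?_, ?_, ?_, ?_⟩
  · intro p hp x hx
    obtain ⟨c, hc, hxc⟩ := exists_mem_block_of_mem_cube hρ (by linarith) hx
    simp only [ShadedTubes.shadeSet, Set.mem_iUnion, exists_prop]
    exact ⟨c, (ShadedTubes.mem_incidences.mp ((hmem (u p.1) c).mpr ⟨p, hp, rfl, hc⟩)).2, hxc⟩
  · refine Finset.card_le_card fun x hx => ?_
    obtain ⟨p, hp, rfl⟩ := Finset.mem_image.mp hx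
    exact (hmem _ _).mpr ⟨p, hp, rfl, self_mem_block _⟩
  · have h1 : 𝒰.incidences.image Prod.snd ⊆ (J.image fun p => coarseCell δ ρ p.2).biUnion block := by
      intro c hc
      obtain ⟨⟨U, c'⟩, hx, rfl⟩ := Finset.mem_image.mp hc
      obtain ⟨p, hp, -, hc⟩ := (hmem _ _).mp hx
      exact Finset.mem_biUnion.mpr ⟨_, Finset.mem_image_of_mem _ hp, hc⟩
    refine (Finset.card_le_card h1).trans ((Finset.card_biUnion_le_card_mul _ _ 16
      fun m _ => (card_block m).le).trans_eq (mul_comm _ _))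
  · intro c
    rcases (𝒰.through c).eq_empty_or_nonempty with h0 | ⟨U₀, hU₀⟩
    · exact ⟨0, by rw [h0]; simp⟩
    obtain ⟨p₀, hp₀, -, hc₀⟩ := (hmem _ _).mp (ShadedTubes.mem_through.mp hU₀)
    refine ⟨coarseCell δ ρ p₀.2, fun U hU => ?_⟩
    obtain ⟨p, hp, hpU, hc⟩ := (hmem _ _).mp (ShadedTubes.mem_through.mp hU)
    exact ⟨p, hp, hpU, eq_of_mem_block hc hc₀ (hpar p hp p₀ hp₀)⟩

/-- Stickiness passes to covering tubes at larger scales. -/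
theorem exists_cover_coarse {r : ℝ} {K : ℕ} {S 𝒱 : Finset TubeLine} (hr : 0 < r) (hρr : ρ ≤ r)
    (hS : ∀ U ∈ S, ∃ T, U.CoversTube ρ T ∧ ∃ V ∈ 𝒱, V.CoversTube r T) (hK : ParallelBound 𝒱 r K) :
    ∃ 𝒱' : Finset TubeLine, (∀ U ∈ S, ∃ V ∈ 𝒱', V.CoversTube r U) ∧
      ParallelBound 𝒱' r (10 ^ 29 * K) := by
  refine exists_cover_of_separated_bound S hr _ fun S' hS' hsep W => ?_
  have := card_separated_angle_le (S := S'.filter fun V => V.angle W ≤ r) (𝒱 := 𝒱) (r := r)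
    (s := r / 2) (a := r) (b := r) (K := K) hr (by positivity)
    (fun T hT T' hT' => hsep T (Finset.mem_of_mem_filter T hT) T' (Finset.mem_of_mem_filter T' hT'))
    (by
      intro U hU
      obtain ⟨T, hUT, V, hV, hVT⟩ := hS U (hS' (Finset.mem_of_mem_filter U hU))
      refine ⟨V, hV, ?_⟩
      have h1 := U.lineDist_triangle T V
      rw [TubeLine.lineDist_comm U T] at h1
      unfold TubeLine.CoversTube at hUT hVT
      linarith) hK W (fun T hT => (Finset.mem_filter.mp hT).2) 12 48 (by
      rw [div_le_iff₀ (by positivity)]; push_cast; linarith) (by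
      rw [div_le_iff₀ hr]; push_cast; linarith)
  refine this.trans ?_
  have e : (2 * 12 + 1) ^ 8 * (2 * 48 + 1) ^ 3 ≤ 10 ^ 29 := by norm_num
  calc (2 * 12 + 1) ^ 8 * (K * (2 * 48 + 1) ^ 3)
      = (2 * 12 + 1) ^ 8 * (2 * 48 + 1) ^ 3 * K := by ring
    _ ≤ 10 ^ 29 * K := Nat.mul_le_mul_right _ e

/-! ### Rigid motions and frames -/

theorem exists_frame (U : TubeLine) : Nonempty (Frame U) := by
  have he : ‖EuclideanSpace.single (3 : Fin 4) (1 : ℝ)‖ = 1 := by simp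
  refine ⟨⟨(ℝ ∙ (U.dir - EuclideanSpace.single 3 1))ᗮ.reflection, fun i hi => ?_⟩⟩
  rw [Submodule.reflection_sub (U.norm_dir.trans he.symm)]
  simp [hi]

theorem exists_frame_of_motion {U : TubeLine} (g : E4 ≃ᵃⁱ[ℝ] E4) (h0 : g U.base = 0)
    (hline : g '' U.line = {x | ∀ i, i ≠ 3 → x i = 0}) (ρ : ℝ) :
    ∃ F : Frame U, (fun x => dilation ρ (g x)) = F.map ρ := by
  have hg : ∀ x, g x = g.linearIsometryEquiv (x - U.base) := by
    intro x
    have := g.map_vsub x U.base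
    rw [h0, vsub_eq_sub, vsub_eq_sub, sub_zero] at this
    exact this.symm
  refine ⟨⟨g.linearIsometryEquiv, fun i hi => ?_⟩, ?_⟩
  · have h1 : g (U.base + (1 : ℝ) • U.dir) ∈ g '' U.line := ⟨_, ⟨1, rfl⟩, rfl⟩
    rw [hline, hg, add_sub_cancel_left, one_smul] at h1
    exact h1 i hi
  · funext x
    rw [hg, Frame.map]

end

/-! ### The two-scale combinatorics of incidences -/

section

theorem mul_card_le_card_of_fibers {α β : Type*} [DecidableEq β] (s : Finset α)
    (f : α → β) (t : Finset β) {c : ℝ}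
    (h : ∀ b ∈ t, c ≤ ((s.filter fun a => f a = b).card : ℝ)) : c * t.card ≤ s.card := by
  calc c * t.card = t.card • c := by rw [nsmul_eq_mul, mul_comm]
    _ ≤ ∑ b ∈ t, ((s.filter fun a => f a = b).card : ℝ) := Finset.card_nsmul_le_sum _ _ _ h
    _ = ((s.filter fun a => f a ∈ t).card : ℝ) := by
      have := Finset.card_eq_sum_card_fiberwise (s := s.filter fun a => f a ∈ t) (t := t) (f := f)
        (fun a ha => (Finset.mem_filter.mp ha).2)
      rw [this]
      push_cast
      refine Finset.sum_congr rfl fun b hb => ?_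
      rw [Finset.filter_filter]
      congr 2
      ext a
      simp only [Finset.mem_filter]
      constructor
      · rintro ⟨h1, rfl⟩; exact ⟨h1, hb, rfl⟩
      · rintro ⟨h1, -, h2⟩; exact ⟨h1, h2⟩
    _ ≤ s.card := by exact_mod_cast Finset.card_filter_le _ _

theorem card_filter_add_card_filter_not {α : Type*} (s : Finset α) (P : α → Prop)
    [DecidablePred P] : ((s.filter P).card : ℝ) + ((s.filter fun a => ¬ P a).card : ℝ) = s.card := by
  exact_mod_cast Finset.card_filter_add_card_filter_not (s := s) P

/-- The incidences `(T, k)` of a finite family are grouped by coarse objects `u T`; `R k` is the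
coarse cell of `k` and `q U k` its cell relative to `U`. If each `k` lies on at least `m` elements,
each pair `(U, k)` carries at most `2 μ` and only `M` coarse objects occur, then some `k` is seen by
coarse objects carrying a proportion `m / (2 μ M)` of all incidences. -/
theorem exists_popular {α β κ : Type*} [DecidableEq α] [DecidableEq β] [DecidableEq κ]
    (S : Finset (α × κ)) (u : α → β) {m μ M : ℝ} (hm : 0 < m) (hμ : 0 < μ) (hM : 0 < M) (hne : S.Nonempty)
    (h1 : ∀ p ∈ S, m ≤ ((S.filter fun p' => p'.2 = p.2).card : ℝ))
    (h2 : ∀ p ∈ S, ((S.filter fun p' => u p'.1 = u p.1 ∧ p'.2 = p.2).card : ℝ) ≤ 2 * μ)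
    (h3 : ((S.image fun p => u p.1).card : ℝ) ≤ M) :
    ∃ k, m / (2 * μ * M) * S.card ≤
      ((S.filter fun p => ∃ p' ∈ S, u p'.1 = u p.1 ∧ p'.2 = k).card : ℝ) := by
  set K := S.image Prod.snd with hK
  have hKne : K.Nonempty := hne.image _
  set W : κ → ℝ := fun k => ((S.filter fun p => ∃ p' ∈ S, u p'.1 = u p.1 ∧ p'.2 = k).card : ℝ)
    with hW
  by_contra hcon
  push Not at hcon
  have hn : (0 : ℝ) < S.card := by exact_mod_cast hne.card_pos
  -- an upper bound for the sum of the popularities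
  have hup : ∑ k ∈ K, W k < K.card * (m / (2 * μ * M) * S.card) := by
    calc ∑ k ∈ K, W k < ∑ _k ∈ K, (m / (2 * μ * M) * S.card) :=
          Finset.sum_lt_sum_of_nonempty hKne fun k _ => hcon k
      _ = _ := by rw [Finset.sum_const, nsmul_eq_mul]
  have hKm : m * K.card ≤ S.card := mul_card_le_card_of_fibers S Prod.snd K fun k hk => by
    obtain ⟨p, hp, rfl⟩ := Finset.mem_image.mp hk
    exact h1 p hp
  -- double counting
  have hdouble : ∑ k ∈ K, W k =
      ∑ p ∈ S, ((K.filter fun k => ∃ p' ∈ S, u p'.1 = u p.1 ∧ p'.2 = k).card : ℝ) := by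
    have := Finset.sum_card_bipartiteAbove_eq_sum_card_bipartiteBelow (s := K) (t := S)
      (fun k p => ∃ p' ∈ S, u p'.1 = u p.1 ∧ p'.2 = k)
    simp only [Finset.bipartiteAbove, Finset.bipartiteBelow] at this
    simp only [hW]
    exact_mod_cast this
  set n : β → ℝ := fun U => ((S.filter fun p => u p.1 = U).card : ℝ) with hnU
  have hlow : ∀ p ∈ S, n (u p.1) ≤ 2 * μ *
      ((K.filter fun k => ∃ p' ∈ S, u p'.1 = u p.1 ∧ p'.2 = k).card : ℝ) := by
    intro p hp
    have := card_le_mul_card_image_real (S.filter fun p' => u p'.1 = u p.1) Prod.snd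
      (c := 2 * μ) (by
        intro a ha
        rw [Finset.mem_filter] at ha
        refine le_trans ?_ (h2 a ha.1)
        norm_cast
        refine Finset.card_le_card fun b hb => ?_
        simp only [Finset.mem_filter] at hb ⊢
        exact ⟨hb.1.1, hb.1.2.trans ha.2.symm, hb.2⟩)
    refine this.trans (mul_le_mul_of_nonneg_left ?_ (by positivity))
    norm_cast
    refine Finset.card_le_card fun k hk => ?_
    simp only [Finset.mem_filter, Finset.mem_image] at hk ⊢
    obtain ⟨a, ⟨ha, hua⟩, rfl⟩ := hk
    exact ⟨Finset.mem_image_of_mem _ ha, a, ha, hua, rfl⟩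
  have hsum : ∑ p ∈ S, n (u p.1) ≤ 2 * μ * ∑ k ∈ K, W k := by
    rw [hdouble, Finset.mul_sum]
    exact Finset.sum_le_sum hlow
  have hsq : ∑ p ∈ S, n (u p.1) = ∑ U ∈ S.image (fun p => u p.1), n U ^ 2 := by
    rw [Finset.sum_comp n (fun p : α × κ => u p.1)]
    refine Finset.sum_congr rfl fun U _ => ?_
    rw [nsmul_eq_mul, sq]
  have htot : ∑ U ∈ S.image (fun p => u p.1), n U = S.card := by
    have := Finset.card_eq_sum_card_fiberwise (s := S) (t := S.image fun p => u p.1)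
      (f := fun p => u p.1) (fun a ha => Finset.mem_image_of_mem _ ha)
    rw [this]
    push_cast
    rfl
  -- Cauchy-Schwarz over the coarse objects
  have hcs := sq_sum_le_card_mul_sum_sq (s := S.image (fun p => u p.1)) (f := n)
  rw [htot, ← hsq] at hcs
  have h5 : (S.card : ℝ) ^ 2 ≤ M * (2 * μ * ∑ k ∈ K, W k) := by
    refine hcs.trans (mul_le_mul h3 hsum ?_ hM.le)
    exact Finset.sum_nonneg fun p _ => Nat.cast_nonneg _
  have h6 : M * (2 * μ * ∑ k ∈ K, W k) < M * (2 * μ * (K.card * (m / (2 * μ * M) * S.card))) := by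
    gcongr
  have h7 : M * (2 * μ * (K.card * (m / (2 * μ * M) * S.card))) = (m * K.card) * S.card := by
    field_simp
  rw [h7] at h6
  nlinarith

/-- The counting hypotheses of the two-scale argument. The elements `(T, k)` of `J₀` are incidences
of `δ`-tubes with `δ`-cubes, `u T` is the `ρ`-tube of `T`, `R k` the coarse cell of `k` and `q U k`
its cell in the rescaling of `U`. The numbers `sR`, `sr` stand for `ρ ^ σ` and `(δ / ρ) ^ σ`, and
`zR`, `zr` for `ρ ^ ζ` and `(δ / ρ) ^ ζ`; factors `B` are losses. `coarse` and `fine` are the lower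
bounds for the volume of the coarse and of the rescaled collections, and `mult` says that all
nonempty sets of tubes through a cube within one `ρ`-tube have about `μ` elements. -/
structure TwoScaleBounds {α β κ γ ι : Type*} [DecidableEq α] [DecidableEq β]
    [DecidableEq κ] [DecidableEq γ] [DecidableEq ι] (u : α → β) (R : κ → γ) (q : β → κ → ι)
    (J₀ : Finset (α × κ)) (δ ρ B sR sr zR zr μ : ℝ) : Prop where
  δ_pos : 0 < δ
  ρ_pos : 0 < ρ
  B_ge : 6 ≤ B
  sR_pos : 0 < sR
  sr_pos : 0 < sr
  zR_pos : 0 < zR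
  zr_pos : 0 < zr
  μ_pos : 0 < μ
  card_U : ((J₀.image fun p => u p.1).card : ℝ) ≤ B / ρ ^ 3
  card_inU : ∀ U, ((J₀.filter fun p => u p.1 = U).card : ℝ) ≤ B * ρ ^ 3 / δ ^ 4
  card_UR : ((J₀.image fun p => (u p.1, R p.2)).card : ℝ) ≤ B / ρ ^ 4
  card_Tq : ((J₀.image fun p => (p.1, q (u p.1) p.2)).card : ℝ) ≤ B * ρ / δ ^ 4
  card_E : ((J₀.image Prod.snd).card : ℝ) ≤ B * sR * sr / δ ^ 4
  mass : 1 / (B ^ 2 * δ ^ 4) ≤ (J₀.card : ℝ)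
  mult : ∀ p ∈ J₀, μ ≤ ((J₀.filter fun p' => u p'.1 = u p.1 ∧ p'.2 = p.2).card : ℝ) ∧
    ((J₀.filter fun p' => u p'.1 = u p.1 ∧ p'.2 = p.2).card : ℝ) ≤ 2 * μ
  coarse : ∀ J ⊆ J₀, 1 / (B ^ 5 * δ ^ 4) ≤ (J.card : ℝ) →
    sR * zR / (B * ρ ^ 4) ≤ ((J.image fun p => R p.2).card : ℝ)
  fine : ∀ J ⊆ J₀, ∀ U, ρ ^ 3 / (B ^ 6 * δ ^ 4) ≤ ((J.filter fun p => u p.1 = U).card : ℝ) →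
    ρ ^ 4 * sr * zr / (B * δ ^ 4) ≤
      (((J.filter fun p => u p.1 = U).image fun p => q U p.2).card : ℝ)

/-- `J ⊆ J₀` contains with `(T, k)` all `(T', k) ∈ J₀` with `u T' = u T`. -/
def IsSaturated {α β κ : Type*} (u : α → β) (J₀ J : Finset (α × κ)) : Prop :=
  J ⊆ J₀ ∧ ∀ p ∈ J, ∀ p' ∈ J₀, u p'.1 = u p.1 → p'.2 = p.2 → p' ∈ J

theorem IsSaturated.filter {α β κ : Type*} {u : α → β} {J₀ J : Finset (α × κ)}
    (h : IsSaturated u J₀ J) (P : α × κ → Prop) [DecidablePred P]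
    (hP : ∀ p p', u p'.1 = u p.1 → p'.2 = p.2 → P p → P p') : IsSaturated u J₀ (J.filter P) := by
  refine ⟨(Finset.filter_subset _ _).trans h.1, fun p hp p' hp' h1 h2 => ?_⟩
  rw [Finset.mem_filter] at hp ⊢
  exact ⟨h.2 p hp.1 p' hp' h1 h2, hP p p' h1 h2 hp.2⟩

namespace TwoScaleBounds

variable {α β κ γ ι : Type*} [DecidableEq α] [DecidableEq β] [DecidableEq κ] [DecidableEq γ]
  [DecidableEq ι] {u : α → β} {R : κ → γ} {q : β → κ → ι}
  {J₀ : Finset (α × κ)} {δ ρ B sR sr zR zr μ : ℝ}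

theorem mult_le (h : TwoScaleBounds u R q J₀ δ ρ B sR sr zR zr μ) {J : Finset (α × κ)}
    (hJ : J ⊆ J₀) {p : α × κ} (hp : p ∈ J) :
    ((J.filter fun p' => u p'.1 = u p.1 ∧ p'.2 = p.2).card : ℝ) ≤ 2 * μ := by
  refine le_trans ?_ (h.mult p (hJ hp)).2
  exact_mod_cast Finset.card_le_card (Finset.filter_subset_filter _ hJ)

/-- In a saturated set each nonempty cell `(U, q)` is met by at least `μ` of the tubes `T`. -/
theorem card_image_Uq_le (h : TwoScaleBounds u R q J₀ δ ρ B sR sr zR zr μ) {J : Finset (α × κ)}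
    (hJ : IsSaturated u J₀ J) :
    ((J.image fun p => (u p.1, q (u p.1) p.2)).card : ℝ) ≤ B * ρ / (δ ^ 4 * μ) := by
  have hδ := h.δ_pos
  have hμ := h.μ_pos
  have h1 := mul_card_le_card_of_fibers (J.image fun p => (p.1, q (u p.1) p.2))
    (fun x => (u x.1, x.2)) (J.image fun p => (u p.1, q (u p.1) p.2)) (c := μ) (by
      intro b hb
      obtain ⟨p, hp, rfl⟩ := Finset.mem_image.mp hb
      refine (h.mult p (hJ.1 hp)).1.trans ?_
      norm_cast
      refine Finset.card_le_card_of_injOn (fun p' => (p'.1, q (u p'.1) p'.2)) ?_ ?_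
      · intro p' hp'
        simp only [Finset.coe_filter, Set.mem_ofPred_eq] at hp'
        simp only [Finset.coe_filter, Set.mem_ofPred_eq, Finset.mem_image]
        refine ⟨⟨p', hJ.2 p hp p' hp'.1 hp'.2.1 hp'.2.2, rfl⟩, ?_⟩
        rw [hp'.2.1, hp'.2.2]
      · intro a ha b hb hab
        simp only [Finset.coe_filter, Set.mem_ofPred_eq] at ha hb
        simp only [Prod.mk.injEq] at hab
        exact Prod.ext hab.1 (ha.2.2.trans hb.2.2.symm))
  have h2 : ((J.image fun p => (p.1, q (u p.1) p.2)).card : ℝ) ≤ B * ρ / δ ^ 4 := by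
    refine le_trans ?_ h.card_Tq
    exact_mod_cast Finset.card_le_card (Finset.image_subset_image hJ.1)
  rw [← div_div, le_div_iff₀ hμ]
  linarith

/-- Cubes on few tubes carry little mass, because the union of the shadings is small. -/
theorem card_highMult (h : TwoScaleBounds u R q J₀ δ ρ B sR sr zR zr μ) :
    1 / (B ^ 3 * δ ^ 4) ≤ ((J₀.filter fun p =>
      1 / (B ^ 4 * sR * sr) ≤ ((J₀.filter fun p' => p'.2 = p.2).card : ℝ)).card : ℝ) := by
  have hB := h.B_ge
  have hδ := h.δ_pos
  have hsR := h.sR_pos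
  have hsr := h.sr_pos
  have h1 := card_small_fibers_le J₀ Prod.snd (c := 1 / (B ^ 4 * sR * sr)) (by positivity) h.card_E
  have h2 := card_filter_add_card_filter_not J₀ fun p =>
      ((J₀.filter fun p' => p'.2 = p.2).card : ℝ) < 1 / (B ^ 4 * sR * sr)
  simp only [not_lt] at h2
  have h3 : 1 / (B ^ 4 * sR * sr) * (B * sR * sr / δ ^ 4) = 1 / (B ^ 3 * δ ^ 4) := by
    field_simp
  rw [h3] at h1
  have h4 := h.mass
  have h5 : 2 * (1 / (B ^ 3 * δ ^ 4)) ≤ 1 / (B ^ 2 * δ ^ 4) := by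
    rw [← mul_div_assoc, div_le_div_iff₀ (by positivity) (by positivity)]
    have : 0 ≤ B ^ 2 * δ ^ 4 := by positivity
    nlinarith
  linarith

/-- Upper bound for the fine multiplicity `μ`: some rescaled collection is large, so its union has
large volume. -/
theorem mul_sr_zr_le (h : TwoScaleBounds u R q J₀ δ ρ B sR sr zR zr μ) {J : Finset (α × κ)}
    (hJ : IsSaturated u J₀ J) (hcard : 1 / (B ^ 3 * δ ^ 4) ≤ (J.card : ℝ)) :
    μ * sr * zr ≤ B ^ 7 := by
  have hB := h.B_ge
  have hδ := h.δ_pos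
  have hρ := h.ρ_pos
  have hμ := h.μ_pos
  have hsr := h.sr_pos
  have hzr := h.zr_pos
  -- discard the sparse cells `(U, q)`
  set c := μ / (B ^ 5 * ρ) with hc
  have hcpos : 0 < c := by positivity
  set f : α × κ → β × ι := fun p => (u p.1, q (u p.1) p.2) with hf
  set J' := J.filter fun p => ¬ ((J.filter fun p' => f p' = f p).card : ℝ) < c with hJ'
  have h1 := card_small_fibers_le J f hcpos.le (h.card_image_Uq_le hJ)
  have h2 := card_filter_add_card_filter_not J fun p =>
      ((J.filter fun p' => f p' = f p).card : ℝ) < c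
  have h3 : c * (B * ρ / (δ ^ 4 * μ)) = 1 / (B ^ 4 * δ ^ 4) := by
    rw [hc]; field_simp
  rw [h3] at h1
  have h4 : 2 * (1 / (B ^ 4 * δ ^ 4)) ≤ 1 / (B ^ 3 * δ ^ 4) := by
    rw [← mul_div_assoc, div_le_div_iff₀ (by positivity) (by positivity)]
    have : 0 ≤ B ^ 3 * δ ^ 4 := by positivity
    nlinarith
  have h5 : 1 / (B ^ 4 * δ ^ 4) ≤ (J'.card : ℝ) := by linarith
  -- some `U` is rich
  have hex : ∃ U, ρ ^ 3 / (B ^ 6 * δ ^ 4) ≤ ((J'.filter fun p => u p.1 = U).card : ℝ) := by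
    by_contra hcon
    push Not at hcon
    have h6 := card_le_mul_card_image_real J' (fun p => u p.1) (c := ρ ^ 3 / (B ^ 6 * δ ^ 4))
      (fun a _ => (hcon (u a.1)).le)
    have h7 : ((J'.image fun p => u p.1).card : ℝ) ≤ B / ρ ^ 3 := by
      refine le_trans ?_ h.card_U
      exact_mod_cast Finset.card_le_card (Finset.image_subset_image
        ((Finset.filter_subset _ _).trans hJ.1))
    have h8 : ρ ^ 3 / (B ^ 6 * δ ^ 4) * ((J'.image fun p => u p.1).card : ℝ)
        ≤ ρ ^ 3 / (B ^ 6 * δ ^ 4) * (B / ρ ^ 3) := by gcongr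
    have h9 : ρ ^ 3 / (B ^ 6 * δ ^ 4) * (B / ρ ^ 3) = 1 / (B ^ 5 * δ ^ 4) := by field_simp
    have h10 : 1 / (B ^ 5 * δ ^ 4) < 1 / (B ^ 4 * δ ^ 4) := by
      rw [div_lt_div_iff₀ (by positivity) (by positivity)]
      have : 0 < B ^ 4 * δ ^ 4 := by positivity
      nlinarith
    linarith
  obtain ⟨U, hU⟩ := hex
  have h6 := h.fine J' ((Finset.filter_subset _ _).trans hJ.1) U hU
  have h7 := mul_card_le_card_of_fibers (J.filter fun p => u p.1 = U) (fun p => q U p.2)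
    ((J'.filter fun p => u p.1 = U).image fun p => q U p.2) (c := c) (by
      intro b hb
      obtain ⟨p, hp, rfl⟩ := Finset.mem_image.mp hb
      obtain ⟨hp', rfl⟩ := Finset.mem_filter.mp hp
      refine (not_lt.mp (Finset.mem_filter.mp hp').2).trans ?_
      norm_cast
      refine Finset.card_le_card fun b hb => ?_
      simp only [Finset.mem_filter, hf, Prod.mk.injEq] at hb ⊢
      refine ⟨⟨hb.1, hb.2.1⟩, ?_⟩
      have := hb.2.2
      rwa [hb.2.1] at this)
  have h8 : ((J.filter fun p => u p.1 = U).card : ℝ) ≤ B * ρ ^ 3 / δ ^ 4 := by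
    refine le_trans ?_ (h.card_inU U)
    exact_mod_cast Finset.card_le_card (Finset.filter_subset_filter _ hJ.1)
  have h9 : c * (ρ ^ 4 * sr * zr / (B * δ ^ 4)) ≤ B * ρ ^ 3 / δ ^ 4 :=
    (mul_le_mul_of_nonneg_left h6 hcpos.le).trans (h7.trans h8)
  have h10 : c * (ρ ^ 4 * sr * zr / (B * δ ^ 4)) = μ * sr * zr / B ^ 6 * (ρ ^ 3 / δ ^ 4) := by
    rw [hc]; field_simp
  have h11 : B * ρ ^ 3 / δ ^ 4 = B * (ρ ^ 3 / δ ^ 4) := by ring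
  rw [h10, h11] at h9
  have h12 := le_of_mul_le_mul_right h9 (by positivity)
  rw [div_le_iff₀ (by positivity)] at h12
  linarith [h12, show B * B ^ 6 = B ^ 7 by ring]

/-- Coarse cells lying in too many `ρ`-tubes carry at most half of the incidences: otherwise the
coarse collection restricted to them would have too large a mass. -/
theorem card_lowCoarseMult (h : TwoScaleBounds u R q J₀ δ ρ B sR sr zR zr μ) {J : Finset (α × κ)}
    (hJ : J ⊆ J₀) (hcard : 1 / (B ^ 3 * δ ^ 4) ≤ (J.card : ℝ)) :
    1 / (B ^ 4 * δ ^ 4) ≤ ((J.filter fun p => (((J.filter fun p' => R p'.2 = R p.2).image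
      fun p' => u p'.1).card : ℝ) ≤ B ^ 3 / (sR * zR)).card : ℝ) := by
  have hB := h.B_ge
  have hδ := h.δ_pos
  have hρ := h.ρ_pos
  have hsR := h.sR_pos
  have hzR := h.zR_pos
  by_contra hcon
  push Not at hcon
  set P : α × κ → Prop := fun p => (((J.filter fun p' => R p'.2 = R p.2).image
      fun p' => u p'.1).card : ℝ) ≤ B ^ 3 / (sR * zR) with hP
  have h2 := card_filter_add_card_filter_not J P
  set J' := J.filter fun p => ¬ P p with hJ'
  have h4 : 2 * (1 / (B ^ 4 * δ ^ 4)) ≤ 1 / (B ^ 3 * δ ^ 4) := by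
    rw [← mul_div_assoc, div_le_div_iff₀ (by positivity) (by positivity)]
    have : 0 ≤ B ^ 3 * δ ^ 4 := by positivity
    nlinarith
  have h5 : 1 / (B ^ 5 * δ ^ 4) ≤ 1 / (B ^ 4 * δ ^ 4) := by
    rw [div_le_div_iff₀ (by positivity) (by positivity)]
    have : 0 < B ^ 4 * δ ^ 4 := by positivity
    nlinarith
  have h6 := h.coarse J' ((Finset.filter_subset _ _).trans hJ) (by linarith)
  have h7 := mul_card_le_card_of_fibers (J.image fun p => (u p.1, R p.2)) Prod.snd
    (J'.image fun p => R p.2) (c := B ^ 3 / (sR * zR)) (by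
      intro b hb
      obtain ⟨p, hp, rfl⟩ := Finset.mem_image.mp hb
      have := (not_le.mp (Finset.mem_filter.mp hp).2).le
      refine this.trans ?_
      norm_cast
      refine Finset.card_le_card_of_injOn (fun U => (U, R p.2)) ?_ ?_
      · intro U hU
        simp only [Finset.coe_image, Set.mem_image, Finset.coe_filter, Set.mem_ofPred_eq] at hU
        obtain ⟨a, ⟨ha, hR⟩, rfl⟩ := hU
        simp only [Finset.coe_filter, Set.mem_ofPred_eq, Finset.mem_image]
        exact ⟨⟨a, ha, by rw [hR]⟩, trivial⟩
      · intro a _ b _ hab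
        exact (Prod.mk.inj hab).1)
  have h8 : ((J.image fun p => (u p.1, R p.2)).card : ℝ) ≤ B / ρ ^ 4 := by
    refine le_trans ?_ h.card_UR
    exact_mod_cast Finset.card_le_card (Finset.image_subset_image hJ)
  have h9 : B ^ 3 / (sR * zR) * (sR * zR / (B * ρ ^ 4)) ≤ B / ρ ^ 4 :=
    (mul_le_mul_of_nonneg_left h6 (by positivity)).trans (h7.trans h8)
  have h10 : B ^ 3 / (sR * zR) * (sR * zR / (B * ρ ^ 4)) = B ^ 2 / ρ ^ 4 := by field_simp
  rw [h10, div_le_div_iff_of_pos_right (by positivity)] at h9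
  nlinarith

/-- Lower bound for the fine multiplicity `μ`: a cube lies on many tubes, but those are distributed
over few `ρ`-tubes. -/
theorem zR_le (h : TwoScaleBounds u R q J₀ δ ρ B sR sr zR zr μ) {J : Finset (α × κ)}
    (hJ : J ⊆ J₀) {p : α × κ}
    (h1 : 1 / (B ^ 4 * sR * sr) ≤ ((J.filter fun p' => p'.2 = p.2).card : ℝ))
    (h2 : (((J.filter fun p' => R p'.2 = R p.2).image fun p' => u p'.1).card : ℝ) ≤
      B ^ 3 / (sR * zR)) :
    zR ≤ B ^ 8 * μ * sr := by
  have hB := h.B_ge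
  have hμ := h.μ_pos
  have hsR := h.sR_pos
  have hsr := h.sr_pos
  have hzR := h.zR_pos
  have h3 := card_le_mul_card_image_real (J.filter fun p' => p'.2 = p.2) (fun p => u p.1)
    (c := 2 * μ) (by
      intro a ha
      rw [Finset.mem_filter] at ha
      refine le_trans ?_ (h.mult_le hJ ha.1)
      norm_cast
      refine Finset.card_le_card fun b hb => ?_
      simp only [Finset.mem_filter] at hb ⊢
      exact ⟨hb.1.1, hb.2, hb.1.2.trans ha.2.symm⟩)
  have h4 : (((J.filter fun p' => p'.2 = p.2).image fun p => u p.1).card : ℝ) ≤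
      B ^ 3 / (sR * zR) := by
    refine le_trans ?_ h2
    norm_cast
    refine Finset.card_le_card (Finset.image_subset_image fun b hb => ?_)
    simp only [Finset.mem_filter] at hb ⊢
    exact ⟨hb.1, by rw [hb.2]⟩
  have h5 : 1 / (B ^ 4 * sR * sr) ≤ 2 * μ * (B ^ 3 / (sR * zR)) :=
    h1.trans (h3.trans (mul_le_mul_of_nonneg_left h4 (by positivity)))
  rw [← mul_div_assoc, div_le_div_iff₀ (by positivity) (by positivity)] at h5
  have h6 : sR * zR ≤ sR * (2 * B ^ 7 * μ * sr) := by linarith [h5, show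
    2 * μ * B ^ 3 * (B ^ 4 * sR * sr) = sR * (2 * B ^ 7 * μ * sr) by ring]
  have h7 := le_of_mul_le_mul_left h6 hsR
  have h8 : 0 ≤ B ^ 7 * μ * sr := by positivity
  nlinarith [h7, h8, show B ^ 8 * μ * sr = B * (B ^ 7 * μ * sr) by ring]

/-- In each coarse cell one cube `k` is selected, and the `ρ`-tubes not seen from it are dropped. -/
theorem exists_selection (h : TwoScaleBounds u R q J₀ δ ρ B sR sr zR zr μ) {J : Finset (α × κ)}
    (hJ : J ⊆ J₀) (hne : J.Nonempty) {m M : ℝ} (hm : 0 < m) (hM : 0 < M)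
    (h1 : ∀ p ∈ J, m ≤ ((J.filter fun p' => p'.2 = p.2).card : ℝ))
    (h2 : ∀ p ∈ J, (((J.filter fun p' => R p'.2 = R p.2).image fun p' => u p'.1).card : ℝ) ≤ M) :
    ∃ k : γ → κ, m / (2 * μ * M) * J.card ≤
      ((J.filter fun p => ∃ p' ∈ J, u p'.1 = u p.1 ∧ p'.2 = k (R p.2)).card : ℝ) := by
  have : Nonempty κ := ⟨hne.choose.2⟩
  have hex : ∀ g ∈ J.image (fun p => R p.2), ∃ k, m / (2 * μ * M) *
      (J.filter fun p => R p.2 = g).card ≤ (((J.filter fun p => R p.2 = g).filter fun p =>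
        ∃ p' ∈ J.filter fun p => R p.2 = g, u p'.1 = u p.1 ∧ p'.2 = k).card : ℝ) := by
    intro g hg
    obtain ⟨p, hp, rfl⟩ := Finset.mem_image.mp hg
    convert exists_popular (J.filter fun p' => R p'.2 = R p.2) u hm h.μ_pos hM
      ⟨p, Finset.mem_filter.mpr ⟨hp, rfl⟩⟩ ?_ ?_ (h2 p hp)
    · intro a ha
      rw [Finset.mem_filter] at ha
      refine (h1 a ha.1).trans ?_
      norm_cast
      refine Finset.card_le_card fun b hb => ?_
      simp only [Finset.mem_filter] at hb ⊢
      exact ⟨⟨hb.1, by rw [hb.2, ha.2]⟩, hb.2⟩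
    · intro a ha
      refine le_trans ?_ (h.mult_le hJ (Finset.mem_of_mem_filter a ha))
      exact_mod_cast Finset.card_le_card (Finset.filter_subset_filter _ (Finset.filter_subset _ _))
  choose! k hk using hex
  refine ⟨k, ?_⟩
  have h3 : (J.card : ℝ) = ∑ g ∈ J.image (fun p => R p.2),
      ((J.filter fun p => R p.2 = g).card : ℝ) := by
    exact_mod_cast Finset.card_eq_sum_card_fiberwise (s := J) (t := J.image fun p => R p.2)
      (f := fun p => R p.2) (fun a ha => Finset.mem_image_of_mem _ ha)
  set J' := J.filter fun p => ∃ p' ∈ J, u p'.1 = u p.1 ∧ p'.2 = k (R p.2) with hJ'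
  have h4 : (J'.card : ℝ) = ∑ g ∈ J.image (fun p => R p.2),
      ((J'.filter fun p => R p.2 = g).card : ℝ) := by
    exact_mod_cast Finset.card_eq_sum_card_fiberwise (s := J') (t := J.image fun p => R p.2)
      (f := fun p => R p.2) (fun a ha => Finset.mem_image_of_mem _ (Finset.mem_of_mem_filter a ha))
  rw [h3, h4, Finset.mul_sum]
  refine Finset.sum_le_sum fun g hg => (hk g hg).trans ?_
  norm_cast
  refine Finset.card_le_card fun p hp => ?_
  simp only [Finset.mem_filter, hJ'] at hp ⊢
  obtain ⟨⟨hp, hg⟩, p', ⟨hp', -⟩, h5, h6⟩ := hp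
  exact ⟨⟨hp, p', hp', h5, by rw [hg]; exact h6⟩, hg⟩

/-- Removal of sparse cells `(U, R)`, of sparse cells `(U, q)`, and then of sparse `ρ`-tubes. -/
theorem exists_clean (h : TwoScaleBounds u R q J₀ δ ρ B sR sr zR zr μ) {J : Finset (α × κ)}
    (hJ : IsSaturated u J₀ J) {l : ℝ} (hl : 0 < l) (hcard : l / δ ^ 4 ≤ (J.card : ℝ)) :
    ∃ J' ⊆ J, IsSaturated u J₀ J' ∧ l / (2 * δ ^ 4) ≤ (J'.card : ℝ) ∧
      (∀ p ∈ J', l * ρ ^ 4 / (B ^ 2 * δ ^ 4) ≤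
        ((J.filter fun p' => u p'.1 = u p.1 ∧ R p'.2 = R p.2).card : ℝ)) ∧
      (∀ p ∈ J', l * μ / (B ^ 2 * ρ) ≤
        ((J.filter fun p' => u p'.1 = u p.1 ∧ q (u p.1) p'.2 = q (u p.1) p.2).card : ℝ)) ∧
      (∀ p ∈ J', l * ρ ^ 3 / (B ^ 2 * δ ^ 4) ≤ ((J'.filter fun p' => u p'.1 = u p.1).card : ℝ)) := by
  have hB := h.B_ge
  have hδ := h.δ_pos
  have hρ := h.ρ_pos
  have hμ := h.μ_pos
  set f : α × κ → β × γ := fun p => (u p.1, R p.2) with hf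
  set g : α × κ → β × ι := fun p => (u p.1, q (u p.1) p.2) with hg
  set c₁ := l * ρ ^ 4 / (B ^ 2 * δ ^ 4) with hc₁
  set c₂ := l * μ / (B ^ 2 * ρ) with hc₂
  set c₃ := l * ρ ^ 3 / (B ^ 2 * δ ^ 4) with hc₃
  set P₁ : α × κ → Prop := fun p => ((J.filter fun p' => f p' = f p).card : ℝ) < c₁ with hP₁
  set P₂ : α × κ → Prop := fun p => ((J.filter fun p' => g p' = g p).card : ℝ) < c₂ with hP₂
  have h1 : ((J.filter P₁).card : ℝ) ≤ l / (B * δ ^ 4) := by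
    have : ((J.image f).card : ℝ) ≤ B / ρ ^ 4 := by
      refine le_trans ?_ h.card_UR
      exact_mod_cast Finset.card_le_card (Finset.image_subset_image hJ.1)
    refine (card_small_fibers_le J f (by positivity) this).trans_eq ?_
    rw [hc₁]; field_simp
  have h2 : ((J.filter P₂).card : ℝ) ≤ l / (B * δ ^ 4) := by
    refine (card_small_fibers_le J g (by positivity) (h.card_image_Uq_le hJ)).trans_eq ?_
    rw [hc₂]; field_simp
  set J₁ := J.filter fun p => ¬ (P₁ p ∨ P₂ p) with hJ₁
  have h3 : (J.card : ℝ) ≤ J₁.card + 2 * (l / (B * δ ^ 4)) := by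
    have h4 := card_filter_add_card_filter_not J fun p => P₁ p ∨ P₂ p
    have h5 : ((J.filter fun p => P₁ p ∨ P₂ p).card : ℝ) ≤ (J.filter P₁).card + (J.filter P₂).card := by
      rw [Finset.filter_or]
      exact_mod_cast Finset.card_union_le _ _
    linarith
  have hsat₁ : IsSaturated u J₀ J₁ := by
    refine hJ.filter _ fun p p' h1 h2 h3 => ?_
    simpa only [hP₁, hP₂, hf, hg, h1, h2] using h3
  set P₃ : α × κ → Prop := fun p => ((J₁.filter fun p' => u p'.1 = u p.1).card : ℝ) < c₃ with hP₃
  have h4 : ((J₁.filter P₃).card : ℝ) ≤ l / (B * δ ^ 4) := by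
    have : ((J₁.image fun p => u p.1).card : ℝ) ≤ B / ρ ^ 3 := by
      refine le_trans ?_ h.card_U
      exact_mod_cast Finset.card_le_card (Finset.image_subset_image hsat₁.1)
    refine (card_small_fibers_le J₁ (fun p => u p.1) (by positivity) this).trans_eq ?_
    rw [hc₃]; field_simp
  have h5 := card_filter_add_card_filter_not J₁ P₃
  have h6 : 3 * (l / (B * δ ^ 4)) ≤ l / (2 * δ ^ 4) := by
    rw [← mul_div_assoc, div_le_div_iff₀ (by positivity) (by positivity)]
    have : 0 ≤ l * δ ^ 4 := by positivity
    nlinarith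
  have h7 : l / δ ^ 4 = 2 * (l / (2 * δ ^ 4)) := by field_simp
  refine ⟨J₁.filter fun p => ¬ P₃ p, (Finset.filter_subset _ _).trans (Finset.filter_subset _ _),
    hsat₁.filter _ fun p p' h1 _ h3 => ?_, by linarith, fun p hp => ?_, fun p hp => ?_,
    fun p hp => ?_⟩
  · simpa only [hP₃, h1] using h3
  · have hp := (Finset.mem_filter.mp (Finset.mem_of_mem_filter p hp)).2
    have h8 := not_lt.mp (not_or.mp hp).1
    refine h8.trans ?_
    norm_cast
    refine Finset.card_le_card fun b hb => ?_
    simpa only [Finset.mem_filter, hf, Prod.mk.injEq] using hb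
  · have hp := (Finset.mem_filter.mp (Finset.mem_of_mem_filter p hp)).2
    have h8 := not_lt.mp (not_or.mp hp).2
    refine h8.trans ?_
    norm_cast
    refine Finset.card_le_card fun b hb => ?_
    simp only [Finset.mem_filter, hg, Prod.mk.injEq] at hb ⊢
    refine ⟨hb.1, hb.2.1, ?_⟩
    have := hb.2.2
    rwa [hb.2.1] at this
  · refine (not_lt.mp (Finset.mem_filter.mp hp).2).trans ?_
    norm_cast
    refine Finset.card_le_card fun b hb => ?_
    simp only [Finset.mem_filter] at hb ⊢
    refine ⟨⟨hb.1, ?_⟩, hb.2⟩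
    have h9 := (Finset.mem_filter.mp hp).2
    simpa only [hP₃, hb.2] using h9

/-- If all coarse cells `(U, R)` are rich there are few coarse cells, as there are few cubes. -/
theorem card_image_R_mul_le (h : TwoScaleBounds u R q J₀ δ ρ B sR sr zR zr μ)
    {J J₃ : Finset (α × κ)} (hJ₃ : J₃ ⊆ J₀) {l : ℝ} (hμle : μ * sr * zr ≤ B ^ 7)
    (hUR : ∀ p ∈ J, l * ρ ^ 4 / (B ^ 2 * δ ^ 4) ≤
      ((J₃.filter fun p' => u p'.1 = u p.1 ∧ R p'.2 = R p.2).card : ℝ)) :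
    ((J.image fun p => R p.2).card : ℝ) * (l * ρ ^ 4 * zr) ≤ 2 * B ^ 10 * sR := by
  have hB := h.B_ge
  have hδ := h.δ_pos
  have hρ := h.ρ_pos
  have hμ := h.μ_pos
  have hsR := h.sR_pos
  have hsr := h.sr_pos
  have hzR' := h.zR_pos
  have hzr' := h.zr_pos
  -- a coarse cell contains many cubes, and there are few cubes altogether
  have h1 := mul_card_le_card_of_fibers (J₃.image Prod.snd) R (J.image fun p => R p.2)
    (c := l * ρ ^ 4 / (B ^ 2 * δ ^ 4) / (2 * μ)) (by
      intro b hb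
      obtain ⟨p, hp, rfl⟩ := Finset.mem_image.mp hb
      rw [div_le_iff₀ (by positivity), mul_comm _ (2 * μ)]
      refine (hUR p hp).trans ((card_le_mul_card_image_real _ Prod.snd (c := 2 * μ)
        fun a ha => ?_).trans ?_)
      · rw [Finset.mem_filter] at ha
        refine le_trans ?_ (h.mult_le hJ₃ ha.1)
        norm_cast
        refine Finset.card_le_card fun b hb => ?_
        simp only [Finset.mem_filter] at hb ⊢
        exact ⟨hb.1.1, hb.1.2.1.trans ha.2.1.symm, hb.2⟩
      · refine mul_le_mul_of_nonneg_left ?_ (by positivity)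
        norm_cast
        refine Finset.card_le_card fun x hx => ?_
        obtain ⟨a, ha, rfl⟩ := Finset.mem_image.mp hx
        rw [Finset.mem_filter] at ha ⊢
        exact ⟨Finset.mem_image_of_mem _ ha.1, ha.2.2⟩)
  have h2 : ((J₃.image Prod.snd).card : ℝ) ≤ B * sR * sr / δ ^ 4 := by
    refine le_trans ?_ h.card_E
    exact_mod_cast Finset.card_le_card (Finset.image_subset_image hJ₃)
  have h3 := h1.trans h2
  rw [div_div, div_mul_eq_mul_div, div_le_div_iff₀ (by positivity) (by positivity)] at h3
  have h4 : δ ^ 4 * (l * ρ ^ 4 * ((J.image fun p => R p.2).card : ℝ)) ≤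
      δ ^ 4 * (2 * B ^ 3 * sR * (μ * sr)) := by
    calc _ = l * ρ ^ 4 * ((J.image fun p => R p.2).card : ℝ) * δ ^ 4 := by ring
      _ ≤ _ := h3
      _ = _ := by ring
  have h5 := le_of_mul_le_mul_left h4 (by positivity)
  calc ((J.image fun p => R p.2).card : ℝ) * (l * ρ ^ 4 * zr)
      = l * ρ ^ 4 * ((J.image fun p => R p.2).card : ℝ) * zr := by ring
    _ ≤ 2 * B ^ 3 * sR * (μ * sr) * zr := by gcongr
    _ = 2 * B ^ 3 * sR * (μ * sr * zr) := by ring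
    _ ≤ 2 * B ^ 3 * sR * B ^ 7 := by gcongr
    _ = 2 * B ^ 10 * sR := by ring

/-- If all fine cells `(U, q)` are rich there are few of them in each `U`. -/
theorem card_image_q_mul_le (h : TwoScaleBounds u R q J₀ δ ρ B sR sr zR zr μ)
    {J J₃ : Finset (α × κ)} (hJ₃ : J₃ ⊆ J₀) {l : ℝ} (hlpos : 0 < l) (hμge : zR ≤ B ^ 8 * μ * sr)
    (hUq : ∀ p ∈ J, l * μ / (B ^ 2 * ρ) ≤
      ((J₃.filter fun p' => u p'.1 = u p.1 ∧ q (u p.1) p'.2 = q (u p.1) p.2).card : ℝ)) (U : β) :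
    (((J.filter fun p => u p.1 = U).image fun p => q U p.2).card : ℝ) *
        (l * zR * δ ^ 4) ≤ B ^ 11 * ρ ^ 4 * sr := by
  have hB := h.B_ge
  have hδ := h.δ_pos
  have hρ := h.ρ_pos
  have hμ := h.μ_pos
  have hsR := h.sR_pos
  have hsr := h.sr_pos
  have hzR' := h.zR_pos
  have hzr' := h.zr_pos
  have h1 := mul_card_le_card_of_fibers (J₃.filter fun p => u p.1 = U) (fun p => q U p.2)
    ((J.filter fun p => u p.1 = U).image fun p => q U p.2) (c := l * μ / (B ^ 2 * ρ)) (by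
      intro b hb
      obtain ⟨p, hp, rfl⟩ := Finset.mem_image.mp hb
      obtain ⟨hp', rfl⟩ := Finset.mem_filter.mp hp
      refine (hUq p hp').trans ?_
      norm_cast
      refine Finset.card_le_card fun b hb => ?_
      simp only [Finset.mem_filter] at hb ⊢
      exact ⟨⟨hb.1, hb.2.1⟩, hb.2.2⟩)
  have h2 : ((J₃.filter fun p => u p.1 = U).card : ℝ) ≤ B * ρ ^ 3 / δ ^ 4 := by
    refine le_trans ?_ (h.card_inU U)
    exact_mod_cast Finset.card_le_card (Finset.filter_subset_filter _ hJ₃)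
  have h3 := h1.trans h2
  set N : ℝ := (((J.filter fun p => u p.1 = U).image fun p => q U p.2).card : ℝ) with hN
  rw [div_mul_eq_mul_div, div_le_div_iff₀ (by positivity) (by positivity)] at h3
  calc N * (l * zR * δ ^ 4) ≤ N * (l * (B ^ 8 * μ * sr) * δ ^ 4) := by gcongr
    _ = l * μ * N * δ ^ 4 * (B ^ 8 * sr) := by ring
    _ ≤ B * ρ ^ 3 * (B ^ 2 * ρ) * (B ^ 8 * sr) := by gcongr
    _ = B ^ 11 * ρ ^ 4 * sr := by ring

/-- The two-scale structure. There is a large saturated set `J` of incidences for which the numbers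
of coarse cells and of fine cells are as small as they can be, and in each coarse cell `g` all
`ρ`-tubes are seen from one and the same cube `k g`. -/
theorem exists_twoScale (h : TwoScaleBounds u R q J₀ δ ρ B sR sr zR zr μ) {l : ℝ}
    (hl : l = zR * zr / B ^ 20) :
    ∃ J ⊆ J₀, ∃ k : γ → κ, IsSaturated u J₀ J ∧ l / (2 * δ ^ 4) ≤ (J.card : ℝ) ∧
      (∀ p ∈ J, ∃ p' ∈ J₀, u p'.1 = u p.1 ∧ p'.2 = k (R p.2)) ∧
      μ * sr * zr ≤ B ^ 7 ∧
      (∀ p ∈ J, (((J.filter fun p' => R p'.2 = R p.2).image fun p' => u p'.1).card : ℝ) ≤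
        B ^ 3 / (sR * zR)) ∧
      (∀ p ∈ J, l * ρ ^ 3 / (B ^ 2 * δ ^ 4) ≤ ((J.filter fun p' => u p'.1 = u p.1).card : ℝ)) ∧
      ((J.image fun p => R p.2).card : ℝ) * (l * ρ ^ 4 * zr) ≤ 2 * B ^ 10 * sR ∧
      ∀ U, (((J.filter fun p => u p.1 = U).image fun p => q U p.2).card : ℝ) *
        (l * zR * δ ^ 4) ≤ B ^ 11 * ρ ^ 4 * sr := by
  have hB := h.B_ge
  have hδ := h.δ_pos
  have hρ := h.ρ_pos
  have hμ := h.μ_pos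
  have hsR := h.sR_pos
  have hsr := h.sr_pos
  have hzR' := h.zR_pos
  have hzr' := h.zr_pos
  have hlpos : 0 < l := by rw [hl]; positivity
  -- cubes of high multiplicity
  set m := 1 / (B ^ 4 * sR * sr) with hm
  set J₁ := J₀.filter fun p => m ≤ ((J₀.filter fun p' => p'.2 = p.2).card : ℝ) with hJ₁
  have hcard₁ := h.card_highMult
  have hsat₀ : IsSaturated u J₀ J₀ := ⟨subset_rfl, fun _ _ p' hp' _ _ => hp'⟩
  have hsat₁ : IsSaturated u J₀ J₁ := hsat₀.filter _ fun p p' _ h2 h3 => by rwa [h2]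
  have hμle := h.mul_sr_zr_le hsat₁ hcard₁
  -- coarse cells of low multiplicity
  set M := B ^ 3 / (sR * zR) with hM
  set J₂ := J₁.filter fun p => (((J₁.filter fun p' => R p'.2 = R p.2).image
      fun p' => u p'.1).card : ℝ) ≤ M with hJ₂
  have hcard₂ : 1 / (B ^ 4 * δ ^ 4) ≤ (J₂.card : ℝ) := h.card_lowCoarseMult hsat₁.1 hcard₁
  have hsat₂ : IsSaturated u J₀ J₂ := hsat₁.filter _ fun p p' _ h2 h3 => by rwa [h2]
  have hm₂ : ∀ p ∈ J₂, m ≤ ((J₂.filter fun p' => p'.2 = p.2).card : ℝ) := by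
    intro p hp
    obtain ⟨hp1, hp2⟩ := Finset.mem_filter.mp hp
    obtain ⟨hp0, hp3⟩ := Finset.mem_filter.mp hp1
    refine hp3.trans ?_
    norm_cast
    refine Finset.card_le_card fun b hb => ?_
    obtain ⟨hb0, hb⟩ := Finset.mem_filter.mp hb
    refine Finset.mem_filter.mpr ⟨Finset.mem_filter.mpr ⟨Finset.mem_filter.mpr ⟨hb0, ?_⟩, ?_⟩, hb⟩
    · rwa [hb]
    · rwa [hb]
  have hM₂ : ∀ p ∈ J₂, (((J₂.filter fun p' => R p'.2 = R p.2).image fun p' => u p'.1).card : ℝ) ≤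
      M := by
    intro p hp
    refine le_trans ?_ (Finset.mem_filter.mp hp).2
    norm_cast
    exact Finset.card_le_card (Finset.image_subset_image
      (Finset.filter_subset_filter _ (Finset.filter_subset _ _)))
  have hne₂ : J₂.Nonempty := by
    rw [← Finset.card_pos]
    have : (0 : ℝ) < J₂.card := lt_of_lt_of_le (by positivity) hcard₂
    exact_mod_cast this
  have hμge : zR ≤ B ^ 8 * μ * sr := by
    obtain ⟨p, hp⟩ := hne₂
    exact h.zR_le hsat₂.1 (hm₂ p hp) (hM₂ p hp)
  -- selection of one cube per coarse cell
  obtain ⟨k, hk⟩ := h.exists_selection hsat₂.1 hne₂ (m := m) (M := M) (by positivity)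
    (by positivity) hm₂ hM₂
  set J₃ := J₂.filter fun p => ∃ p' ∈ J₂, u p'.1 = u p.1 ∧ p'.2 = k (R p.2) with hJ₃
  have hsat₃ : IsSaturated u J₀ J₃ := hsat₂.filter _ fun p p' h1 h2 h3 => by rwa [h1, h2]
  have hcard₃ : l / δ ^ 4 ≤ (J₃.card : ℝ) := by
    refine le_trans ?_ hk
    have h1 : m / (2 * μ * M) = zR / (2 * B ^ 7 * sr * μ) := by
      rw [hm, hM]; field_simp
    have h2 : zR * zr / (2 * B ^ 14) ≤ zR / (2 * B ^ 7 * sr * μ) := by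
      rw [div_le_div_iff₀ (by positivity) (by positivity)]
      calc zR * zr * (2 * B ^ 7 * sr * μ) = zR * (2 * B ^ 7) * (μ * sr * zr) := by ring
        _ ≤ zR * (2 * B ^ 7) * B ^ 7 := by gcongr
        _ = zR * (2 * B ^ 14) := by ring
    rw [h1]
    calc l / δ ^ 4 = zR * zr / (B ^ 2 * B ^ 14) * (1 / (B ^ 4 * δ ^ 4)) := by
          rw [hl]; field_simp
      _ ≤ zR * zr / (2 * B ^ 14) * (1 / (B ^ 4 * δ ^ 4)) := by
          gcongr
          nlinarith
      _ ≤ zR / (2 * B ^ 7 * sr * μ) * J₂.card := by gcongr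
  obtain ⟨J, hJJ₃, hsat, hcard, hUR, hUq, hU⟩ := h.exists_clean hsat₃ hlpos hcard₃
  have hJJ₂ : J ⊆ J₂ := hJJ₃.trans (Finset.filter_subset _ _)
  refine ⟨J, hsat.1, k, hsat, hcard, fun p hp => ?_, hμle, fun p hp => ?_, hU, ?_, fun U => ?_⟩
  · obtain ⟨p', hp', h1⟩ := (Finset.mem_filter.mp (hJJ₃ hp)).2
    exact ⟨p', hsat₂.1 hp', h1⟩
  · refine le_trans ?_ (hM₂ p (hJJ₂ hp))
    norm_cast
    exact Finset.card_le_card (Finset.image_subset_image (Finset.filter_subset_filter _ hJJ₂))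
  · exact h.card_image_R_mul_le hsat₃.1 hμle hUR
  · exact h.card_image_q_mul_le hsat₃.1 hlpos hμge hUq U

end TwoScaleBounds

end

/-! ### Wide and narrow cubes -/

theorem finrank_span_pair {u v : E4} (hu : ‖u‖ = 1) (hv : ‖v‖ = 1) (h : inner ℝ u v ^ 2 < 1) :
    Module.finrank ℝ (Submodule.span ℝ {u, v}) = 2 := by
  have hli : LinearIndependent ℝ ![u, v] := by
    rw [LinearIndependent.pair_iff]
    intro s t hst
    have h1 : inner ℝ u (s • u + t • v) = (0 : ℝ) := by rw [hst, inner_zero_right]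
    have h2 : inner ℝ v (s • u + t • v) = (0 : ℝ) := by rw [hst, inner_zero_right]
    rw [inner_add_right, inner_smul_right, inner_smul_right, real_inner_self_eq_norm_sq, hu] at h1
    rw [inner_add_right, inner_smul_right, inner_smul_right, real_inner_self_eq_norm_sq, hv,
      real_inner_comm] at h2
    set a : ℝ := inner ℝ u v with ha
    have ht : t * (1 - a ^ 2) = 0 := by linear_combination h2 - a * h1
    have ht0 : t = 0 := by
      rcases mul_eq_zero.mp ht with h | h
      · exact h
      · linarith
    refine ⟨?_, ht0⟩
    rw [ht0] at h1
    linarith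
  have := finrank_span_eq_card hli
  rw [Matrix.range_cons, Matrix.range_cons, Matrix.range_empty, Set.union_empty,
    Set.singleton_union] at this
  simpa using this

theorem norm_sub_starProjection_le (P : Submodule ℝ E4) (v : E4) {x : E4} (hx : x ∈ P) :
    ‖v - P.starProjection v‖ ≤ ‖v - x‖ := by
  rw [Submodule.starProjection_minimal]
  exact ciInf_le ⟨0, by rintro _ ⟨y, rfl⟩; exact norm_nonneg _⟩ (⟨x, hx⟩ : P)

/-- The distance of `w` from the plane spanned by `u` and `v` is a quotient of Gram determinants. -/
theorem norm_sub_starProjection_span_le {u v w : E4} (hu : ‖u‖ = 1) (hv : ‖v‖ = 1) (hw : ‖w‖ = 1)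
    (h : inner ℝ u v ^ 2 < 1) :
    (1 - inner ℝ u v ^ 2) *
      ‖w - (Submodule.span ℝ {u, v}).starProjection w‖ ^ 2 ≤ (Matrix.gram ℝ ![u, v, w]).det := by
  have hdet : (Matrix.gram ℝ ![u, v, w]).det = 1 + 2 * inner ℝ u v * inner ℝ u w * inner ℝ v w -
      inner ℝ u v ^ 2 - inner ℝ u w ^ 2 - inner ℝ v w ^ 2 := by
    rw [Matrix.det_fin_three]
    simp only [Matrix.gram_apply, Matrix.cons_val_zero, Matrix.cons_val_one, Matrix.cons_val]
    rw [real_inner_self_eq_norm_sq, real_inner_self_eq_norm_sq, real_inner_self_eq_norm_sq, hu, hv,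
      hw, real_inner_comm u v, real_inner_comm u w, real_inner_comm v w]
    ring
  rw [hdet]
  set a : ℝ := inner ℝ u v with ha
  set b : ℝ := inner ℝ u w with hb
  set c : ℝ := inner ℝ v w with hc
  have hpos : 0 < 1 - a ^ 2 := by linarith
  set s : ℝ := (b - a * c) / (1 - a ^ 2) with hs
  set t : ℝ := (c - a * b) / (1 - a ^ 2) with ht
  have hmem : s • u + t • v ∈ Submodule.span ℝ {u, v} :=
    Submodule.add_mem _ (Submodule.smul_mem _ _ (Submodule.subset_span (by simp)))
      (Submodule.smul_mem _ _ (Submodule.subset_span (by simp)))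
  have h1 := norm_sub_starProjection_le _ w hmem
  have h2 : ‖w - (s • u + t • v)‖ ^ 2 = 1 - 2 * (s * b + t * c) + (s ^ 2 + 2 * (s * t * a) + t ^ 2) := by
    rw [norm_sub_sq_real, norm_add_sq_real, hw, inner_add_right, inner_smul_right, inner_smul_right,
      inner_smul_left, inner_smul_right, norm_smul, norm_smul, hu, hv, real_inner_comm u w,
      real_inner_comm v w, ← ha, ← hb, ← hc, Real.norm_eq_abs, Real.norm_eq_abs, mul_one, mul_one,
      sq_abs, sq_abs]
    simp only [conj_trivial]
    ring
  have h3 : (1 - a ^ 2) * ‖w - (s • u + t • v)‖ ^ 2 =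
      1 + 2 * a * b * c - a ^ 2 - b ^ 2 - c ^ 2 := by
    rw [h2, hs, ht]
    field_simp
    ring
  rw [← h3]
  gcongr

theorem angle_starProjection_le (P : Submodule ℝ E4) {v : E4} (hv : ‖v‖ = 1) :
    InnerProductGeometry.angle v (P.starProjection v) ≤ 4 * ‖v - P.starProjection v‖ := by
  by_cases h0 : P.starProjection v = 0
  · rw [h0, InnerProductGeometry.angle_zero_right, sub_zero, hv]
    linarith [Real.pi_le_four]
  · set y := P.starProjection v with hy
    have hy' : 0 < ‖y‖ := norm_pos_iff.mpr h0
    rw [← InnerProductGeometry.angle_smul_right_of_pos v y (inv_pos.mpr hy')]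
    have h1 : ‖‖y‖⁻¹ • y‖ = 1 := by
      rw [norm_smul, norm_inv, norm_norm, inv_mul_cancel₀ hy'.ne']
    have h2 := angle_le_two_mul_norm_sub hv h1
    have hv0 : v ≠ 0 := by rintro rfl; simp at hv
    have h3 := norm_normalize_sub_le hv0 h0
    rw [hv, inv_one, one_smul, div_one] at h3
    linarith

theorem TubeLine.inner_dir_sq_le (l l' : TubeLine) :
    inner ℝ l.dir l'.dir ^ 2 ≤ 1 - ‖l.dir - l'.dir‖ ^ 2 / 4 := by
  have h1 := norm_sub_sq_real l.dir l'.dir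
  have h2 := norm_add_sq_real l.dir l'.dir
  rw [l.norm_dir, l'.norm_dir] at h1 h2
  have h3 : 1 ≤ ‖l.dir + l'.dir‖ := by
    refine le_trans ?_ (abs_coord_le_norm _ 3)
    rw [PiLp.add_apply]
    exact le_trans (by linarith [l.half_le_dir, l'.half_le_dir]) (le_abs_self _)
  set a : ℝ := inner ℝ l.dir l'.dir with ha
  have h4 : 1 ≤ ‖l.dir + l'.dir‖ ^ 2 := one_le_pow₀ h3
  have h5 : 0 ≤ ‖l.dir - l'.dir‖ ^ 2 := sq_nonneg _
  nlinarith

/-- If few triples of directions span a large volume, half of the directions are close to a plane: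
either half of them are close to one, or a separated pair spans such a plane. -/
theorem exists_plane_of_narrow (S : Finset TubeLine) (hS : S.Nonempty) {ρ : ℝ} (hρ : 0 < ρ)
    (hnarrow : (((S ×ˢ S ×ˢ S).filter fun T : TubeLine × TubeLine × TubeLine =>
      (100 : ℝ)⁻¹ * ρ ^ 2 ≤ wedgeNorm T.1.dir T.2.1.dir T.2.2.dir).card : ℝ) <
        (100 : ℝ)⁻¹ * (S.card : ℝ) ^ 3) :
    ∃ P : Submodule ℝ E4, Module.finrank ℝ P = 2 ∧ (S.card : ℝ) / 2 ≤
      ((S.filter fun T => ‖T.dir - P.starProjection T.dir‖ ≤ ρ).card : ℝ) := by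
  by_contra hcon
  push Not at hcon
  have hN : (0 : ℝ) < S.card := by exact_mod_cast hS.card_pos
  -- no direction has half of the others close to it
  have hfar : ∀ T₁ ∈ S, (S.card : ℝ) / 2 ≤
      ((S.filter fun T => ¬ ‖T.dir - T₁.dir‖ < ρ).card : ℝ) := by
    intro T₁ _
    have he : ‖EuclideanSpace.single (0 : Fin 4) (1 : ℝ)‖ = 1 := by simp
    have hin : inner ℝ T₁.dir (EuclideanSpace.single (0 : Fin 4) (1 : ℝ)) ^ 2 < 1 := by
      have h1 := norm_sq_eq_coords T₁.dir
      rw [T₁.norm_dir] at h1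
      rw [EuclideanSpace.inner_single_right]
      simp only [conj_trivial, one_mul]
      nlinarith [sq_nonneg (T₁.dir 1), sq_nonneg (T₁.dir 2), T₁.half_le_dir]
    have h2 := hcon _ (finrank_span_pair T₁.norm_dir he hin)
    have h3 := card_filter_add_card_filter_not S fun T => ‖T.dir - T₁.dir‖ < ρ
    have h4 : ((S.filter fun T => ‖T.dir - T₁.dir‖ < ρ).card : ℝ) ≤
        ((S.filter fun T => ‖T.dir - (Submodule.span ℝ
          {T₁.dir, EuclideanSpace.single (0 : Fin 4) (1 : ℝ)}).starProjection T.dir‖ ≤ ρ).card : ℝ) := by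
      norm_cast
      refine Finset.card_le_card fun T hT => ?_
      rw [Finset.mem_filter] at hT ⊢
      exact ⟨hT.1, (norm_sub_starProjection_le _ _ (Submodule.subset_span (by simp))).trans hT.2.le⟩
    linarith
  set W := (S ×ˢ S ×ˢ S).filter fun T : TubeLine × TubeLine × TubeLine =>
      (100 : ℝ)⁻¹ * ρ ^ 2 ≤ wedgeNorm T.1.dir T.2.1.dir T.2.2.dir with hW
  set Q := (S ×ˢ S).filter fun T => ¬ ‖T.2.dir - T.1.dir‖ < ρ with hQ
  have hQcard : (S.card : ℝ) / 2 * S.card ≤ Q.card :=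
    mul_card_le_card_of_fibers Q Prod.fst S fun T₁ hT₁ => by
      refine (hfar T₁ hT₁).trans ?_
      norm_cast
      refine Finset.card_le_card_of_injOn (fun T => (T₁, T)) (fun T hT => ?_)
        (fun a _ b _ h => (Prod.mk.inj h).2)
      simp only [Finset.coe_filter, Set.mem_ofPred_eq] at hT ⊢
      exact ⟨Finset.mem_filter.mpr ⟨Finset.mem_product.mpr ⟨hT₁, hT.1⟩, hT.2⟩, trivial⟩
  -- a separated pair spans a plane that misses half of the directions, and each of those completes
  -- the pair to a wide triple
  have hWcard : (S.card : ℝ) / 2 * Q.card ≤ W.card :=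
    mul_card_le_card_of_fibers W (fun T => (T.1, T.2.1)) Q fun p hp => by
      obtain ⟨T₁, T₂⟩ := p
      obtain ⟨hp, hne⟩ := Finset.mem_filter.mp hp
      obtain ⟨hT₁, hT₂⟩ := Finset.mem_product.mp hp
      simp only [not_lt] at hne
      have hsq : ρ ^ 2 ≤ ‖T₁.dir - T₂.dir‖ ^ 2 := by
        rw [norm_sub_rev]
        gcongr
      have hin := T₁.inner_dir_sq_le T₂
      have hin1 : inner ℝ T₁.dir T₂.dir ^ 2 < 1 := by
        have : 0 < ρ ^ 2 := by positivity
        linarith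
      have h1 := hcon _ (finrank_span_pair T₁.norm_dir T₂.norm_dir hin1)
      have h2 := card_filter_add_card_filter_not S fun T => ‖T.dir - (Submodule.span ℝ
          {T₁.dir, T₂.dir}).starProjection T.dir‖ ≤ ρ
      have h3 : ((S.filter fun T => ¬ ‖T.dir - (Submodule.span ℝ
          {T₁.dir, T₂.dir}).starProjection T.dir‖ ≤ ρ).card : ℝ) ≤
          ((W.filter fun T => (T.1, T.2.1) = (T₁, T₂)).card : ℝ) := by
        norm_cast
        refine Finset.card_le_card_of_injOn (fun T => (T₁, T₂, T)) (fun T hT => ?_)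
          (fun a _ b _ h => (Prod.mk.inj (Prod.mk.inj h).2).2)
        simp only [Finset.coe_filter, Set.mem_ofPred_eq, not_le] at hT
        have hTS := hT.1
        have hTd := hT.2
        refine Finset.mem_coe.mpr (Finset.mem_filter.mpr ⟨Finset.mem_filter.mpr
          ⟨Finset.mem_product.mpr ⟨hT₁, Finset.mem_product.mpr ⟨hT₂, hTS⟩⟩, ?_⟩, rfl⟩)
        have h4 := norm_sub_starProjection_span_le T₁.norm_dir T₂.norm_dir T.norm_dir hin1
        refine Real.le_sqrt_of_sq_le (le_trans ?_ h4)
        have h5 : ρ ^ 2 ≤ ‖T.dir - (Submodule.span ℝ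
          {T₁.dir, T₂.dir}).starProjection T.dir‖ ^ 2 := by gcongr
        have h6 : ρ ^ 2 / 4 ≤ 1 - inner ℝ T₁.dir T₂.dir ^ 2 := by linarith
        calc ((100 : ℝ)⁻¹ * ρ ^ 2) ^ 2 = (100 : ℝ)⁻¹ ^ 2 * (ρ ^ 2 * ρ ^ 2) := by ring
          _ ≤ 1 / 4 * (ρ ^ 2 * ρ ^ 2) := by gcongr; norm_num
          _ = ρ ^ 2 / 4 * ρ ^ 2 := by ring
          _ ≤ _ := by gcongr
      linarith
  have : (S.card : ℝ) / 2 * ((S.card : ℝ) / 2 * S.card) ≤ (100 : ℝ)⁻¹ * (S.card : ℝ) ^ 3 :=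
    (mul_le_mul_of_nonneg_left hQcard (by positivity)).trans (hWcard.trans hnarrow.le)
  have hN3 : (0 : ℝ) < (S.card : ℝ) ^ 3 := by positivity
  nlinarith

/-- The dichotomy: either the cubes with many wide triples carry half of the mass, or a quarter of
the mass lies on incidences whose direction is close to a plane attached to the cube. -/
theorem wide_or_narrow {δ : ℝ} (𝒯 : ShadedTubes δ) {ρ : ℝ} (hρ : 0 < ρ) :
    (∃ J, ∃ hJ : J ⊆ 𝒯.incidences, (𝒯.incidences.card : ℝ) / 2 ≤ J.card ∧
      ∀ k ∈ (𝒯.restrict J hJ).cubes, (100 : ℝ)⁻¹ * (((𝒯.restrict J hJ).through k).card : ℝ) ^ 3 ≤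
        (((𝒯.restrict J hJ).wideTriples k ((100 : ℝ)⁻¹ * ρ ^ 2)).card : ℝ)) ∨
    ∃ J ⊆ 𝒯.incidences, (𝒯.incidences.card : ℝ) / 4 ≤ J.card ∧
      ∀ k, ∃ P : Submodule ℝ E4, Module.finrank ℝ P = 2 ∧
        ∀ T, (T, k) ∈ J → ‖T.dir - P.starProjection T.dir‖ ≤ ρ := by
  set I := 𝒯.incidences with hI
  set wide : (Fin 4 → ℤ) → Prop := fun k => (100 : ℝ)⁻¹ * ((𝒯.through k).card : ℝ) ^ 3 ≤
        ((𝒯.wideTriples k ((100 : ℝ)⁻¹ * ρ ^ 2)).card : ℝ) with hwide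
  by_cases hcase : (I.card : ℝ) / 2 ≤ ((I.filter fun p => wide p.2).card : ℝ)
  · refine Or.inl ⟨_, Finset.filter_subset _ _, hcase, fun k hk => ?_⟩
    obtain ⟨T₀, hT₀⟩ := ShadedTubes.mem_cubes.mp hk
    rw [ShadedTubes.incidences_restrict] at hT₀
    have hk' : wide k := (Finset.mem_filter.mp hT₀).2
    -- all tubes through a wide cube are kept, so its triples are those of `𝒯`
    have hthrough : (𝒯.restrict (I.filter fun p => wide p.2) (Finset.filter_subset _ _)).through k =
        𝒯.through k := by
      ext T
      rw [ShadedTubes.mem_through, ShadedTubes.mem_through, ShadedTubes.incidences_restrict,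
        Finset.mem_filter]
      exact ⟨fun h => h.1, fun h => ⟨h, hk'⟩⟩
    rw [ShadedTubes.wideTriples, hthrough]
    exact hk'
  · right
    push Not at hcase
    have hsplit := card_filter_add_card_filter_not I fun p => wide p.2
    -- the plane is arbitrary at wide cubes and at cubes without tubes
    have hplane : ∀ k, ∃ P : Submodule ℝ E4, Module.finrank ℝ P = 2 ∧ (¬ wide k →
        ((𝒯.through k).card : ℝ) / 2 ≤
          (((𝒯.through k).filter fun T => ‖T.dir - P.starProjection T.dir‖ ≤ ρ).card : ℝ)) := by
      intro k
      rcases (𝒯.through k).eq_empty_or_nonempty with h0 | hne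
      · refine ⟨Submodule.span ℝ {EuclideanSpace.single 0 1, EuclideanSpace.single 1 1},
          finrank_span_pair (by simp) (by simp) ?_, fun _ => ?_⟩
        · rw [EuclideanSpace.inner_single_right]; simp
        · rw [h0]; simp
      · by_cases hk : wide k
        · obtain ⟨T, -⟩ := hne
          refine ⟨Submodule.span ℝ {EuclideanSpace.single 0 1, EuclideanSpace.single 1 1},
            finrank_span_pair (by simp) (by simp) ?_, fun h => absurd hk h⟩
          rw [EuclideanSpace.inner_single_right]; simp
        · obtain ⟨P, hP, h⟩ := exists_plane_of_narrow _ hne hρ (not_le.mp hk)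
          exact ⟨P, hP, fun _ => h⟩
    choose P hP hPcard using hplane
    set I' := I.filter fun p => ¬ wide p.2 with hI'
    refine ⟨I'.filter fun p => ‖p.1.dir - (P p.2).starProjection p.1.dir‖ ≤ ρ,
      (Finset.filter_subset _ _).trans (Finset.filter_subset _ _), ?_, fun k => ⟨P k, hP k, ?_⟩⟩
    · set J := I'.filter fun p => ‖p.1.dir - (P p.2).starProjection p.1.dir‖ ≤ ρ with hJ
      have h1 : (I'.card : ℝ) = ∑ k ∈ I'.image Prod.snd, ((I'.filter fun p => p.2 = k).card : ℝ) := by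
        exact_mod_cast Finset.card_eq_sum_card_fiberwise (f := Prod.snd)
          (fun a ha => Finset.mem_image_of_mem Prod.snd ha)
      have h2 : (J.card : ℝ) = ∑ k ∈ I'.image Prod.snd, ((J.filter fun p => p.2 = k).card : ℝ) := by
        exact_mod_cast Finset.card_eq_sum_card_fiberwise (f := Prod.snd)
          (fun a ha => Finset.mem_image_of_mem Prod.snd (Finset.mem_of_mem_filter a ha))
      have h3 : (I'.card : ℝ) / 2 ≤ J.card := by
        rw [h1, h2, Finset.sum_div]
        refine Finset.sum_le_sum fun k hk => ?_
        obtain ⟨p, hp, rfl⟩ := Finset.mem_image.mp hk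
        have hnw := (Finset.mem_filter.mp hp).2
        have h4 := hPcard p.2 hnw
        have h5 : (I'.filter fun p' => p'.2 = p.2).card ≤ (𝒯.through p.2).card := by
          rw [ShadedTubes.card_through]
          exact Finset.card_le_card (Finset.filter_subset_filter _ (Finset.filter_subset _ _))
        have h6 : ((𝒯.through p.2).filter fun T =>
            ‖T.dir - (P p.2).starProjection T.dir‖ ≤ ρ).card ≤ (J.filter fun p' => p'.2 = p.2).card := by
          refine Finset.card_le_card_of_injOn (fun T => (T, p.2)) (fun T hT => ?_)
            (fun a _ b _ h => (Prod.mk.inj h).1)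
          obtain ⟨hT1, hT2⟩ := Finset.mem_filter.mp (Finset.mem_coe.mp hT)
          exact Finset.mem_coe.mpr (Finset.mem_filter.mpr ⟨Finset.mem_filter.mpr
            ⟨Finset.mem_filter.mpr ⟨ShadedTubes.mem_through.mp hT1, hnw⟩, hT2⟩, rfl⟩)
        have h5' : ((I'.filter fun p' => p'.2 = p.2).card : ℝ) ≤ (𝒯.through p.2).card := by
          exact_mod_cast h5
        have h6' : (((𝒯.through p.2).filter fun T =>
            ‖T.dir - (P p.2).starProjection T.dir‖ ≤ ρ).card : ℝ) ≤
              (J.filter fun p' => p'.2 = p.2).card := by exact_mod_cast h6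
        linarith
      linarith
    · intro T hT
      exact (Finset.mem_filter.mp hT).2

/-! ### The extremal exponent -/

section

variable {δ : ℝ}

namespace ShadedTubes

/-- Admissibility weakens as the exponents grow. -/
theorem IsAdmissible.mono {𝒯 : ShadedTubes δ} {s t s' t' : ℝ} (h : 𝒯.IsAdmissible s t)
    (hδ : 0 < δ) (hδ1 : δ ≤ 1) (hs : s ≤ s') (ht : t ≤ t') : 𝒯.IsAdmissible s' t' := by
  refine ⟨h.1, fun r hr hr1 => ?_, (Real.rpow_le_rpow_of_exponent_ge hδ hδ1 hs).trans h.2.2⟩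
  obtain ⟨𝒱, h1, h2⟩ := h.2.1 r hr hr1
  exact ⟨𝒱, h1, fun V => (h2 V).trans
    (Real.rpow_le_rpow_of_exponent_ge hδ hδ1 (neg_le_neg ht))⟩

theorem IsExtremal.mono {𝒯 : ShadedTubes δ} {η η' : ℝ} (h : 𝒯.IsExtremal η)
    (hδ : 0 < δ) (hδ1 : δ ≤ 1) (hη : η ≤ η') : 𝒯.IsExtremal η' :=
  ⟨h.1.mono hδ hδ1 hη hη,
    h.2.trans (Real.rpow_le_rpow_of_exponent_ge hδ hδ1 (by linarith))⟩

theorem RescalingIsExtremal.mono {𝒯 : ShadedTubes δ} {ρ η η' : ℝ} {U : TubeLine}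
    (h : 𝒯.RescalingIsExtremal ρ U η) (hδ : 0 < δ / ρ) (hδ1 : δ / ρ ≤ 1) (hη : η ≤ η') :
    𝒯.RescalingIsExtremal ρ U η' := fun g h0 hg => by
  obtain ⟨𝒯', h1, h2⟩ := h g h0 hg
  exact ⟨𝒯', h1, h2.mono hδ hδ1 hη⟩

theorem pow_four_le_volume_unionSet (hδ : 0 < δ) (𝒯 : ShadedTubes δ) (h : 0 < 𝒯.mass) :
    δ ^ 4 ≤ volume.real 𝒯.unionSet := by
  rw [mass_eq hδ] at h
  rw [volume_unionSet hδ]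
  have hne : 𝒯.incidences.Nonempty := by
    rw [Finset.nonempty_iff_ne_empty]
    rintro h0
    simp [h0] at h
  have : 1 ≤ (𝒯.incidences.image Prod.snd).card := (hne.image _).card_pos
  have h1 : (1 : ℝ) ≤ (𝒯.incidences.image Prod.snd).card := by exact_mod_cast this
  nlinarith [pow_pos hδ 4]

end ShadedTubes

theorem pow_four_le_minVolume {s t : ℝ} (hδ : 0 < δ) :
    minVolume s t δ = 0 ∨ δ ^ 4 ≤ minVolume s t δ := by
  rcases Set.eq_empty_or_nonempty
    {m | ∃ 𝒯 : ShadedTubes δ, 𝒯.IsAdmissible s t ∧ m = volume.real 𝒯.unionSet} with h | h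
  · left
    rw [minVolume, h, Real.sInf_empty]
  · right
    refine le_csInf h ?_
    rintro _ ⟨𝒯, h𝒯, rfl⟩
    exact 𝒯.pow_four_le_volume_unionSet hδ ((Real.rpow_pos_of_pos hδ _).trans_le h𝒯.2.2)

theorem eventually_small : ∀ᶠ δ : ℝ in 𝓝[>] 0, 0 < δ ∧ δ < 1 :=
  Ioo_mem_nhdsGT (by norm_num)

theorem isBoundedUnder_log_minVolume (s t : ℝ) :
    (𝓝[>] (0 : ℝ)).IsBoundedUnder (· ≤ ·)
      fun δ : ℝ => Real.log (minVolume s t δ) / Real.log δ := by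
  refine ⟨4, ?_⟩
  rw [eventually_map]
  filter_upwards [eventually_small] with δ hδ
  have hlog : Real.log δ < 0 := Real.log_neg hδ.1 hδ.2
  rcases pow_four_le_minVolume (s := s) (t := t) hδ.1 with h | h
  · simp [h]
  · rw [div_le_iff_of_neg hlog]
    have := Real.log_le_log (pow_pos hδ.1 4) h
    rwa [Real.log_pow] at this

/-- Collections that are admissible with small exponents have unions of volume at least
`r ^ (σ₄ + ζ)`. The infimum defining `σ₄` need not be attained, whence the loss `ζ`. -/
theorem exists_volume_lower_bound {ζ : ℝ} (hζ : 0 < ζ) :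
    ∃ η₀ : ℝ, 0 < η₀ ∧ ∃ s₀ : ℝ, 0 < s₀ ∧ ∀ r : ℝ, 0 < r → r ≤ s₀ → ∀ 𝒯 : ShadedTubes r,
      𝒯.IsAdmissible η₀ η₀ → r ^ (sigma4 + ζ) ≤ volume.real 𝒯.unionSet := by
  have hne : (Set.image2 volumeExponent (Set.Ioo 0 1) (Set.Ioo 0 1)).Nonempty :=
    ⟨_, Set.mem_image2_of_mem (a := 1 / 2) (b := 1 / 2) (by norm_num) (by norm_num)⟩
  obtain ⟨_, ⟨s, hs, t, ht, rfl⟩, hlt⟩ :=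
    exists_lt_of_csInf_lt hne (show sigma4 < sigma4 + ζ by linarith)
  have hev := eventually_lt_of_limsup_lt hlt (isBoundedUnder_log_minVolume s t)
  obtain ⟨s₀, hs₀, hs₁⟩ := mem_nhdsGT_iff_exists_Ioc_subset.mp (hev.and eventually_small)
  refine ⟨min s t, lt_min hs.1 ht.1, s₀, hs₀, fun r hr hrs 𝒯 h𝒯 => ?_⟩
  obtain ⟨hlt, -, hr1⟩ := hs₁ ⟨hr, hrs⟩
  have h𝒯' : 𝒯.IsAdmissible s t := h𝒯.mono hr hr1.le (min_le_left _ _) (min_le_right _ _)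
  have hle : minVolume s t r ≤ volume.real 𝒯.unionSet := by
    refine csInf_le ⟨0, ?_⟩ ⟨𝒯, h𝒯', rfl⟩
    rintro _ ⟨𝒮, -, rfl⟩
    exact measureReal_nonneg
  have hpos : 0 < minVolume s t r := by
    refine (pow_pos hr 4).trans_le (le_csInf ⟨_, 𝒯, h𝒯', rfl⟩ ?_)
    rintro _ ⟨𝒮, h𝒮, rfl⟩
    exact 𝒮.pow_four_le_volume_unionSet hr ((Real.rpow_pos_of_pos hr _).trans_le h𝒮.2.2)
  refine le_trans ?_ hle
  rw [div_lt_iff_of_neg (Real.log_neg hr hr1)] at hlt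
  rw [← Real.exp_log hpos, Real.rpow_def_of_pos hr]
  exact Real.exp_le_exp.mpr (by linarith)

end

/-! ### Sticky collections: counting incidences -/

section

variable {δ ρ A : ℝ} {K : ℕ}

/-- `exists_independent` for a set of points that carries labels: the points with labels in a
suitable independent set of labels are a proportion at least `1 / K`. -/
theorem exists_subset_labels_independent {α β : Type*} (J : Finset α) (f : α → β)
    (r : β → β → Prop) (hrefl : ∀ a, r a a) (hsymm : ∀ a b, r a b → r b a) (K : ℕ)
    (hK : ∀ a ∈ J.image f, ((J.image f).filter fun b => r a b).card ≤ K) :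
    ∃ J' ⊆ J, (∀ p ∈ J', ∀ p' ∈ J', f p ≠ f p' → ¬ r (f p) (f p')) ∧ J.card ≤ K * J'.card := by
  obtain ⟨t, ht, hind, -, hsum⟩ := exists_independent r hrefl hsymm
    (fun b => (J.filter fun p => f p = b).card) K (J.image f) hK
  refine ⟨J.filter fun p => f p ∈ t, Finset.filter_subset _ _, fun p hp p' hp' hne =>
    hind _ (Finset.mem_filter.mp hp).2 _ (Finset.mem_filter.mp hp').2 hne, ?_⟩
  have h1 : J.card = ∑ b ∈ J.image f, (J.filter fun p => f p = b).card :=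
    Finset.card_eq_sum_card_fiberwise fun p hp => Finset.mem_image_of_mem f hp
  have h2 : (J.filter fun p => f p ∈ t).card = ∑ b ∈ t, (J.filter fun p => f p = b).card := by
    rw [Finset.card_eq_sum_card_fiberwise (s := J.filter fun p => f p ∈ t) (f := f) (t := t)
      fun p hp => (Finset.mem_filter.mp hp).2]
    refine Finset.sum_congr rfl fun b hb => congrArg Finset.card ?_
    ext p
    simp only [Finset.mem_filter]
    constructor
    · rintro ⟨⟨h1, -⟩, h2⟩; exact ⟨h1, h2⟩
    · rintro ⟨h1, h2⟩; exact ⟨⟨h1, h2 ▸ hb⟩, h2⟩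
  rw [h1, h2]
  exact hsum

namespace ShadedTubes

/-- Essentially distinct tubes that are sticky at all scales, with multiplicity `K`. -/
structure IsSticky (𝒯 : ShadedTubes δ) (K : ℕ) : Prop where
  distinct : 𝒯.EssentiallyDistinct
  exists_cover : ∀ r : ℝ, δ ≤ r → r ≤ 1 → ∃ 𝒱 : Finset TubeLine,
    (∀ T ∈ 𝒯.tubes, ∃ V ∈ 𝒱, V.CoversTube r T) ∧ ParallelBound 𝒱 r K

theorem IsAdmissible.isSticky {𝒯 : ShadedTubes δ} {s t : ℝ} (h : 𝒯.IsAdmissible s t) :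
    𝒯.IsSticky ⌊δ ^ (-t)⌋₊ := by
  refine ⟨h.1, fun r hr hr1 => ?_⟩
  obtain ⟨𝒱, h1, h2⟩ := h.2.1 r hr hr1
  exact ⟨𝒱, h1, fun W => Nat.le_floor (h2 W)⟩

theorem cubeIn_of_mem_incidences {𝒯 : ShadedTubes δ} {p : TubeLine × (Fin 4 → ℤ)}
    (hp : p ∈ 𝒯.incidences) : CubeIn δ p.1 p.2 :=
  𝒯.cube_subset_tube _ (mem_incidences.mp hp).1 _ (mem_incidences.mp hp).2

namespace IsSticky

variable {𝒯 : ShadedTubes δ} (h : 𝒯.IsSticky K)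

include h

theorem card_angle_le (hδ : 0 < δ) (hδ1 : δ ≤ 1) (hKA : (K : ℝ) ≤ A) {S : Finset TubeLine}
    (hS : S ⊆ 𝒯.tubes) {a : ℝ} (ha : δ ≤ a) (W : TubeLine) (hW : ∀ T ∈ S, T.angle W ≤ a) :
    (S.card : ℝ) ≤ A * (10 ^ 6 * (a / δ) ^ 3) := by
  obtain ⟨𝒱, h1, h2⟩ := h.exists_cover δ le_rfl hδ1
  refine (card_distinct_angle_le hδ ha
    (fun T hT T' hT' hne => h.distinct T (hS hT) T' (hS hT') hne)
    (fun T hT => h1 T (hS hT)) h2 W hW).trans ?_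
  have : 0 < a := hδ.trans_le ha
  gcongr

theorem card_covered_le (hδ : 0 < δ) (hδ1 : δ ≤ 1) (hKA : (K : ℝ) ≤ A) {S : Finset TubeLine}
    (hS : S ⊆ 𝒯.tubes) (hδρ : δ ≤ ρ) {U : TubeLine} (hU : ∀ T ∈ S, U.CoversTube ρ T) :
    (S.card : ℝ) ≤ A * (10 ^ 6 * (ρ / δ) ^ 3) := by
  refine h.card_angle_le hδ hδ1 hKA hS hδρ U fun T hT => (T.angle_le_lineDist U).trans ?_
  have := hU T hT
  unfold TubeLine.CoversTube at this
  linarith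

theorem card_tubes_le (hδ : 0 < δ) (hδ1 : δ ≤ 1) (hKA : (K : ℝ) ≤ A) :
    (𝒯.tubes.card : ℝ) ≤ A * (10 ^ 8 / δ ^ 3) := by
  have hA : 0 ≤ A := (Nat.cast_nonneg K).trans hKA
  rcases 𝒯.tubes.eq_empty_or_nonempty with h0 | ⟨W, _⟩
  · rw [h0]
    simp only [Finset.card_empty, Nat.cast_zero]
    positivity
  · refine (h.card_angle_le hδ hδ1 hKA subset_rfl (a := 4) (by linarith) W fun T _ =>
      (InnerProductGeometry.angle_le_pi _ _).trans Real.pi_le_four).trans ?_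
    have : (10 ^ 6 * (4 / δ) ^ 3 : ℝ) = 64 * 10 ^ 6 / δ ^ 3 := by ring
    rw [this]
    gcongr
    norm_num

end IsSticky

/-- A set of incidences all of whose fibres over a set of tubes are bounded. -/
theorem card_le_of_card_tubes_le {J : Finset (TubeLine × (Fin 4 → ℤ))} {M N : ℝ}
    (hM : 0 ≤ M) (htubes : ((J.image Prod.fst).card : ℝ) ≤ N)
    (hfib : ∀ T ∈ J.image Prod.fst, (((J.filter fun p => p.1 = T).image Prod.snd).card : ℝ) ≤ M) :
    (J.card : ℝ) ≤ M * N := by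
  refine (card_le_mul_card_image_real J Prod.fst (c := M) fun p hp => ?_).trans
    (mul_le_mul_of_nonneg_left htubes hM)
  refine le_trans (le_of_eq ?_) (hfib p.1 (Finset.mem_image_of_mem _ hp))
  rw [Finset.card_image_of_injOn]
  rintro ⟨T, k⟩ hq ⟨T', k'⟩ hq' hk
  simp only [Finset.coe_filter, Set.mem_ofPred_eq] at hq hq'
  exact Prod.ext (hq.2.trans hq'.2.symm) hk

theorem mem_image_snd_filter {J : Finset (TubeLine × (Fin 4 → ℤ))} {T : TubeLine} {k : Fin 4 → ℤ} :
    k ∈ (J.filter fun p => p.1 = T).image Prod.snd ↔ (T, k) ∈ J := by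
  simp only [Finset.mem_image, Finset.mem_filter]
  constructor
  · rintro ⟨⟨T', k'⟩, ⟨h, rfl⟩, rfl⟩; exact h
  · intro h; exact ⟨(T, k), ⟨h, rfl⟩, rfl⟩

theorem card_shading_le {𝒯 : ShadedTubes δ} (hδ : 0 < δ) (hδ1 : δ ≤ 1)
    {J : Finset (TubeLine × (Fin 4 → ℤ))} (hJ : J ⊆ 𝒯.incidences) (T : TubeLine) :
    (((J.filter fun p => p.1 = T).image Prod.snd).card : ℝ) ≤ 10 ^ 9 / δ := by
  have hin : ∀ k ∈ (J.filter fun p => p.1 = T).image Prod.snd, CubeIn δ T k := fun k hk =>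
    cubeIn_of_mem_incidences (hJ (mem_image_snd_filter.mp hk))
  refine (card_cubeIn_le hδ _ hin (a := 2) (by norm_num) fun k hk k' hk' => ?_).trans ?_
  · have h1 := abs_le.mp ((hin k hk).abs_le hδ 3)
    have h2 := abs_le.mp ((hin k' hk').abs_le hδ 3)
    linarith
  · have h1 : 1 ≤ 1 / δ := (one_le_div hδ).mpr hδ1
    have h2 : 2 / δ = 2 * (1 / δ) := by ring
    have h3 : 10 ^ 9 / δ = 10 ^ 9 * (1 / δ) := by ring
    rw [h2, h3]
    norm_num at h1 ⊢
    linarith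

theorem IsSticky.card_incidences_le {𝒯 : ShadedTubes δ} (h : 𝒯.IsSticky K) (hδ : 0 < δ)
    (hδ1 : δ ≤ 1) (hKA : (K : ℝ) ≤ A) : (𝒯.incidences.card : ℝ) ≤ A * (10 ^ 17 / δ ^ 4) := by
  have hA : 0 ≤ A := (Nat.cast_nonneg K).trans hKA
  have hsub : 𝒯.incidences.image Prod.fst ⊆ 𝒯.tubes := fun T hT => by
    obtain ⟨p, hp, rfl⟩ := Finset.mem_image.mp hT
    exact (mem_incidences.mp hp).1
  refine (card_le_of_card_tubes_le (M := 10 ^ 9 / δ) (by positivity)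
    ((Nat.cast_le.mpr (Finset.card_le_card hsub)).trans (h.card_tubes_le hδ hδ1 hKA))
    fun T _ => card_shading_le hδ hδ1 subset_rfl T).trans (le_of_eq ?_)
  field_simp

end ShadedTubes

/-! ### Pruning the incidences -/

/-- The outcome of pruning the incidences of `𝒯`: every tube is assigned one covering `ρ`-tube
`u T`, the tubes and the covering tubes are separated, the cubes stay away from the boundary of
`[-1, 1]⁴`, the coarse cells have a fixed parity, and all nonzero multiplicities of cubes inside
covering tubes are comparable to `μ`. -/
structure IsPruned (𝒯 : ShadedTubes δ) (ρ A μ : ℝ) (u : TubeLine → TubeLine)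
    (J₀ : Finset (TubeLine × (Fin 4 → ℤ))) : Prop where
  subset : J₀ ⊆ 𝒯.incidences
  covers : ∀ p ∈ J₀, (u p.1).CoversTube ρ p.1
  inner : ∀ p ∈ J₀, ∀ i, |δ * p.2 i| ≤ 1 - 2 * ρ
  separated : ∀ p ∈ J₀, ∀ p' ∈ J₀, p.1 ≠ p'.1 → 256 * δ < p.1.lineDist p'.1
  separated_cover : ∀ p ∈ J₀, ∀ p' ∈ J₀, u p.1 ≠ u p'.1 → ρ < (u p.1).lineDist (u p'.1)
  card_cover : ((J₀.image fun p => u p.1).card : ℝ) ≤ A * (10 ^ 7 / ρ ^ 3)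
  parity : ∀ p ∈ J₀, ∀ p' ∈ J₀, ∀ i, coarseCell δ ρ p.2 i % 2 = coarseCell δ ρ p'.2 i % 2
  mass : 1 / (A ^ 4 * δ ^ 4) ≤ (J₀.card : ℝ)
  mult_pos : 0 < μ
  mult : ∀ p ∈ J₀, μ ≤ ((J₀.filter fun p' => u p'.1 = u p.1 ∧ p'.2 = p.2).card : ℝ) ∧
    ((J₀.filter fun p' => u p'.1 = u p.1 ∧ p'.2 = p.2).card : ℝ) ≤ 2 * μ

/-- The incidences near the boundary of `[-1, 1]⁴` are negligible. -/
theorem card_boundary_le {𝒯 : ShadedTubes δ} (h : 𝒯.IsSticky K) (hδ : 0 < δ) (hδρ : δ ≤ ρ)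
    (hρ : ρ ≤ 1 / 1000) (hKA : (K : ℝ) ≤ A) :
    ((𝒯.incidences.filter fun p => ¬ ∀ i, |δ * p.2 i| ≤ 1 - 2 * ρ).card : ℝ) ≤
      A * (10 ^ 20 * ρ / δ ^ 4) := by
  have hδ1 : δ ≤ 1 := by linarith
  have hρ0 : 0 < ρ := hδ.trans_le hδρ
  set J := 𝒯.incidences.filter fun p => ¬ ∀ i, |δ * p.2 i| ≤ 1 - 2 * ρ with hJ
  have hsub : J.image Prod.fst ⊆ 𝒯.tubes := fun T hT => by
    obtain ⟨p, hp, rfl⟩ := Finset.mem_image.mp hT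
    exact (ShadedTubes.mem_incidences.mp (Finset.mem_filter.mp hp).1).1
  refine (ShadedTubes.card_le_of_card_tubes_le (M := 10 ^ 12 * (ρ / δ)) (by positivity)
    ((Nat.cast_le.mpr (Finset.card_le_card hsub)).trans (h.card_tubes_le hδ hδ1 hKA))
    fun T _ => ?_).trans (le_of_eq ?_)
  · refine card_cubeIn_boundary_le (l := T) hδ hδρ hρ _ (fun k hk => ?_) fun k hk => ?_
    · exact ShadedTubes.cubeIn_of_mem_incidences
        (Finset.mem_filter.mp (ShadedTubes.mem_image_snd_filter.mp hk)).1
    · have := (Finset.mem_filter.mp (ShadedTubes.mem_image_snd_filter.mp hk)).2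
      push Not at this
      exact this
  · field_simp

/-- Passing to a family of classes of comparable size. -/
theorem exists_dyadic {α β : Type*} [DecidableEq β] (J : Finset α) (f : α → β) (L : ℕ)
    (hL : ∀ p ∈ J, (J.filter fun p' => f p' = f p).card < 2 ^ L) (hne : J.Nonempty) :
    ∃ J' ⊆ J, ∃ μ : ℕ, 0 < μ ∧ J.card ≤ L * J'.card ∧
      ∀ p ∈ J', μ ≤ (J'.filter fun p' => f p' = f p).card ∧
        (J'.filter fun p' => f p' = f p).card ≤ 2 * μ := by
  set g : α → ℕ := fun p => Nat.log 2 (J.filter fun p' => f p' = f p).card with hg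
  have hpos : ∀ p ∈ J, (J.filter fun p' => f p' = f p).card ≠ 0 := fun p hp =>
    Finset.card_ne_zero_of_mem (Finset.mem_filter.mpr ⟨hp, rfl⟩)
  have hgL : ∀ p ∈ J, g p ∈ Finset.range L := fun p hp =>
    Finset.mem_range.mpr (Nat.log_lt_of_lt_pow (hpos p hp) (hL p hp))
  obtain ⟨p₀, hp₀⟩ := hne
  obtain ⟨j, -, hj⟩ := exists_card_le_mul_card_fiber J g (Finset.range L) ⟨_, hgL p₀ hp₀⟩ hgL
  rw [Finset.card_range] at hj
  refine ⟨J.filter fun p => g p = j, Finset.filter_subset _ _, 2 ^ j, by positivity, hj,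
    fun p hp => ?_⟩
  obtain ⟨hpJ, hpj⟩ := Finset.mem_filter.mp hp
  -- whole classes survive
  have hclass : ((J.filter fun p => g p = j).filter fun p' => f p' = f p) =
      J.filter fun p' => f p' = f p := by
    ext p'
    simp only [Finset.mem_filter]
    constructor
    · rintro ⟨⟨h1, -⟩, h2⟩; exact ⟨h1, h2⟩
    · rintro ⟨h1, h2⟩
      refine ⟨⟨h1, ?_⟩, h2⟩
      rw [← hpj, hg]
      simp only [h2]
  rw [hclass]
  have h1 := Nat.pow_log_le_self 2 (hpos p hpJ)
  have h2 := Nat.lt_pow_succ_log_self (b := 2) (by norm_num)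
    (J.filter fun p' => f p' = f p).card
  change 2 ^ g p ≤ _ at h1
  change _ < 2 ^ (g p + 1) at h2
  rw [hpj] at h1 h2
  rw [pow_succ] at h2
  exact ⟨h1, by omega⟩

/-- A large set `J` of incidences contains a pruned one. It is found by removing the incidences near
the boundary of `[-1, 1]⁴`, separating the tubes and then the covering tubes, fixing a parity class
of coarse cells, and finally a dyadic range of multiplicities; each step costs at most a factor
comparable to `A`. -/
theorem exists_isPruned {𝒯 : ShadedTubes δ} (h : 𝒯.IsSticky K) (hδ : 0 < δ) (hδρ : δ ≤ ρ)
    (hρ : ρ ≤ 1 / 1000) (hKA : (K : ℝ) ≤ A) (hA : 10 ^ 40 ≤ A) (hρA : A ^ 3 * ρ ≤ 1) {L : ℕ}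
    (hL : 𝒯.tubes.card < 2 ^ L) (hLA : (L : ℝ) ≤ A) {J : Finset (TubeLine × (Fin 4 → ℤ))}
    (hJ : J ⊆ 𝒯.incidences) (hJcard : 1 / (4 * A * δ ^ 4) ≤ (J.card : ℝ)) :
    ∃ u μ, ∃ J₀ ⊆ J, IsPruned 𝒯 ρ A μ u J₀ := by
  have hδ1 : δ ≤ 1 := by linarith
  have hρ0 : 0 < ρ := hδ.trans_le hδρ
  have hA0 : 0 < A := lt_of_lt_of_le (by norm_num) hA
  -- away from the boundary
  set J₁ := J.filter fun p => ∀ i, |δ * p.2 i| ≤ 1 - 2 * ρ with hJ₁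
  have hJ₁sub : J₁ ⊆ J := Finset.filter_subset _ _
  have hcard₁ : 1 / (8 * A * δ ^ 4) ≤ (J₁.card : ℝ) := by
    have h1 := card_filter_add_card_filter_not J fun p => ∀ i, |δ * p.2 i| ≤ 1 - 2 * ρ
    have h2 : ((J.filter fun p => ¬ ∀ i, |δ * p.2 i| ≤ 1 - 2 * ρ).card : ℝ) ≤
        A * (10 ^ 20 * ρ / δ ^ 4) := (Nat.cast_le.mpr (Finset.card_le_card
      (Finset.filter_subset_filter _ hJ))).trans (card_boundary_le h hδ hδρ hρ hKA)
    have h3 : A * (10 ^ 20 * ρ / δ ^ 4) ≤ 1 / (8 * A * δ ^ 4) := by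
      rw [le_div_iff₀ (by positivity)]
      calc A * (10 ^ 20 * ρ / δ ^ 4) * (8 * A * δ ^ 4) = 8 * 10 ^ 20 * (A ^ 2 * ρ) := by
            field_simp
        _ ≤ A * (A ^ 2 * ρ) := by
            gcongr
            exact le_trans (by norm_num) hA
        _ = A ^ 3 * ρ := by ring
        _ ≤ 1 := hρA
    have h4 : 1 / (4 * A * δ ^ 4) = 1 / (8 * A * δ ^ 4) + 1 / (8 * A * δ ^ 4) := by
      field_simp
      norm_num
    linarith
  -- separated tubes
  obtain ⟨J₂, hJ₂sub, hsep, hcard₂⟩ := exists_subset_labels_independent J₁ Prod.fst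
    (fun T T' : TubeLine => T.lineDist T' ≤ 256 * δ)
    (fun T => by rw [TubeLine.lineDist_self]; positivity)
    (fun T T' h => by rwa [TubeLine.lineDist_comm]) ((2 * 1536 + 1) ^ 8) (by
      intro W _
      refine TubeLine.card_le_of_separated _ W (a := 256 * δ) hδ 1536 (by
        rw [div_le_iff₀ hδ]; push_cast; linarith) (fun T hT => ?_) fun T hT T' hT' hne => ?_
      · rw [TubeLine.lineDist_comm]
        exact (Finset.mem_filter.mp hT).2
      · have hmem : ∀ T ∈ J₁.image Prod.fst, T ∈ 𝒯.tubes := fun T hT => by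
          obtain ⟨p, hp, rfl⟩ := Finset.mem_image.mp hT
          exact (ShadedTubes.mem_incidences.mp (hJ (hJ₁sub hp))).1
        exact h.distinct T (hmem T (Finset.mem_filter.mp hT).1) T'
          (hmem T' (Finset.mem_filter.mp hT').1) hne)
  -- separated covering tubes
  obtain ⟨𝒱, h𝒱, hpar⟩ := h.exists_cover ρ hδρ (by linarith)
  choose! u hu𝒱 hu using h𝒱
  have hmem₂ : ∀ p ∈ J₂, p.1 ∈ 𝒯.tubes := fun p hp =>
    (ShadedTubes.mem_incidences.mp (hJ (hJ₁sub (hJ₂sub hp)))).1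
  obtain ⟨J₃, hJ₃sub, hsepu, hcard₃⟩ := exists_subset_labels_independent J₂ (fun p => u p.1)
    (fun T T' : TubeLine => T.lineDist T' ≤ ρ)
    (fun T => by rw [TubeLine.lineDist_self]; positivity)
    (fun T T' h => by rwa [TubeLine.lineDist_comm]) K (by
      intro W _
      refine (Finset.card_le_card fun V hV => ?_).trans (hpar W)
      obtain ⟨hV, hVW⟩ := Finset.mem_filter.mp hV
      obtain ⟨p, hp, rfl⟩ := Finset.mem_image.mp hV
      refine Finset.mem_filter.mpr ⟨hu𝒱 _ (hmem₂ p hp), ?_⟩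
      rw [TubeLine.angle_comm]
      exact (TubeLine.angle_le_lineDist _ _).trans hVW)
  -- a parity class
  obtain ⟨π, -, hcard₄⟩ := exists_card_le_mul_card_fiber J₃
    (fun p i => coarseCell δ ρ p.2 i % 2) (Fintype.piFinset fun _ : Fin 4 => ({0, 1} : Finset ℤ))
    ⟨fun _ => 0, by simp⟩ (fun p _ => by
      rw [Fintype.mem_piFinset]
      intro i
      rcases Int.emod_two_eq_zero_or_one (coarseCell δ ρ p.2 i) with h | h <;> simp [h])
  have h16 : (Fintype.piFinset fun _ : Fin 4 => ({0, 1} : Finset ℤ)).card = 16 := by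
    rw [Fintype.card_piFinset]
    simp
  rw [h16] at hcard₄
  set J₄ := J₃.filter fun p => (fun i => coarseCell δ ρ p.2 i % 2) = π with hJ₄
  have hJ₄sub : J₄ ⊆ J₃ := Finset.filter_subset _ _
  have hcard₁₄ : J₁.card ≤ (2 * 1536 + 1) ^ 8 * (K * (16 * J₄.card)) :=
    hcard₂.trans (Nat.mul_le_mul_left _ (hcard₃.trans (Nat.mul_le_mul_left _ hcard₄)))
  have hne₄ : J₄.Nonempty := by
    rw [Finset.nonempty_iff_ne_empty]
    intro h0
    rw [h0] at hcard₁₄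
    have : (J₁.card : ℝ) = 0 := by exact_mod_cast Nat.le_zero.mp hcard₁₄
    rw [this] at hcard₁
    have : 0 < 1 / (8 * A * δ ^ 4) := by positivity
    linarith
  -- comparable multiplicities
  obtain ⟨J₀, hJ₀sub, μ, hμ, hcard₀, hmult⟩ := exists_dyadic J₄ (fun p => (u p.1, p.2)) L (by
      intro p _
      refine lt_of_le_of_lt (Finset.card_le_card_of_injOn Prod.fst (fun p' hp' => ?_) ?_) hL
      · exact hmem₂ _ (hJ₃sub (hJ₄sub (Finset.mem_filter.mp hp').1))
      · rintro ⟨T, k⟩ hq ⟨T', k'⟩ hq' hT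
        simp only [Finset.coe_filter, Set.mem_ofPred_eq, Prod.mk.injEq] at hq hq'
        exact Prod.ext hT (hq.2.2.trans hq'.2.2.symm)) hne₄
  have hJ₀₃ : J₀ ⊆ J₃ := hJ₀sub.trans hJ₄sub
  have hJ₀₁ : J₀ ⊆ J₁ := hJ₀₃.trans (hJ₃sub.trans hJ₂sub)
  refine ⟨u, μ, J₀, hJ₀₁.trans hJ₁sub, hJ₀₁.trans (hJ₁sub.trans hJ), ?_, ?_, ?_, ?_, ?_, ?_, ?_,
    by exact_mod_cast hμ, ?_⟩
  · exact fun p hp => hu _ (hmem₂ p (hJ₃sub (hJ₀₃ hp)))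
  · exact fun p hp => (Finset.mem_filter.mp (hJ₀₁ hp)).2
  · exact fun p hp p' hp' hne => not_le.mp
      (hsep p (hJ₃sub (hJ₀₃ hp)) p' (hJ₃sub (hJ₀₃ hp')) hne)
  · exact fun p hp p' hp' hne => not_le.mp (hsepu p (hJ₀₃ hp) p' (hJ₀₃ hp') hne)
  · have hsub : (J₀.image fun p => u p.1) ⊆ 𝒱 := fun V hV => by
      obtain ⟨p, hp, rfl⟩ := Finset.mem_image.mp hV
      exact hu𝒱 _ (hmem₂ p (hJ₃sub (hJ₀₃ hp)))
    refine ((Nat.cast_le.mpr (Finset.card_le_card hsub)).trans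
      (hpar.card_le hρ0 (by linarith))).trans ?_
    gcongr
  · intro p hp p' hp' i
    have h1 := congrFun (Finset.mem_filter.mp (hJ₀sub hp)).2 i
    have h2 := congrFun (Finset.mem_filter.mp (hJ₀sub hp')).2 i
    exact h1.trans h2.symm
  · have hcard : (J₁.card : ℝ) ≤ (2 * 1536 + 1) ^ 8 * (K * (16 * (L * J₀.card))) := by
      exact_mod_cast hcard₁₄.trans (by gcongr)
    have h2 : (J₁.card : ℝ) ≤ (2 * 1536 + 1) ^ 8 * (A * (16 * (A * J₀.card))) :=
      hcard.trans (by gcongr)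
    have h3 : ((2 * 1536 + 1) ^ 8 * (A * (16 * (A * J₀.card))) : ℝ) * 8 ≤ A ^ 3 * J₀.card := by
      calc ((2 * 1536 + 1) ^ 8 * (A * (16 * (A * J₀.card))) : ℝ) * 8
          = ((2 * 1536 + 1) ^ 8 * 16 * 8) * (A ^ 2 * J₀.card) := by ring
        _ ≤ A * (A ^ 2 * J₀.card) := by
            gcongr
            exact le_trans (by norm_num) hA
        _ = A ^ 3 * J₀.card := by ring
    rw [div_le_iff₀ (by positivity)] at hcard₁ ⊢
    have hd : 0 < δ ^ 4 * A := by positivity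
    calc 1 ≤ J₁.card * (8 * A * δ ^ 4) := hcard₁
      _ = (J₁.card * 8) * (δ ^ 4 * A) := by ring
      _ ≤ (A ^ 3 * J₀.card) * (δ ^ 4 * A) := mul_le_mul_of_nonneg_right (by linarith) hd.le
      _ = J₀.card * (A ^ 4 * δ ^ 4) := by ring
  · intro p hp
    have := hmult p hp
    simp only [Prod.mk.injEq] at this
    exact_mod_cast this

end

/-! ### The coarse and the fine collection of a set of incidences -/

section

variable {δ ρ A μ t : ℝ} {K : ℕ} {𝒯 : ShadedTubes δ} {u : TubeLine → TubeLine}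
  {J₀ J : Finset (TubeLine × (Fin 4 → ℤ))}

namespace IsPruned

/-- Incidences in one coarse cell of one covering tube. -/
theorem card_cell_le (h : IsPruned 𝒯 ρ A μ u J₀) (hs : 𝒯.IsSticky K) (hδ : 0 < δ) (hδρ : δ ≤ ρ)
    (hρ1 : ρ ≤ 1) (hKA : (K : ℝ) ≤ A) (hJ : J ⊆ J₀) (U : TubeLine) (m : Fin 4 → ℤ) :
    ((J.filter fun p => u p.1 = U ∧ coarseCell δ ρ p.2 = m).card : ℝ) ≤
      10 ^ 15 * A * (ρ ^ 4 / δ ^ 4) := by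
  have hρ0 : 0 < ρ := hδ.trans_le hδρ
  set F := J.filter fun p => u p.1 = U ∧ coarseCell δ ρ p.2 = m with hF
  have hmem : ∀ p ∈ F, p ∈ J₀ ∧ u p.1 = U ∧ coarseCell δ ρ p.2 = m := fun p hp =>
    ⟨hJ (Finset.mem_filter.mp hp).1, (Finset.mem_filter.mp hp).2⟩
  refine (ShadedTubes.card_le_of_card_tubes_le (M := 10 ^ 9 * (ρ / δ))
    (N := A * (10 ^ 6 * (ρ / δ) ^ 3)) (by positivity) ?_ fun T _ => ?_).trans (le_of_eq ?_)
  · refine hs.card_covered_le (ρ := ρ) (U := U) hδ (hδρ.trans hρ1) hKA (fun T hT => ?_) hδρ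
      fun T hT => ?_
    · obtain ⟨p, hp, rfl⟩ := Finset.mem_image.mp hT
      exact (ShadedTubes.mem_incidences.mp (h.subset (hmem p hp).1)).1
    · obtain ⟨p, hp, rfl⟩ := Finset.mem_image.mp hT
      have := h.covers p (hmem p hp).1
      rwa [(hmem p hp).2.1] at this
  · refine card_coarseCell_fiber_le (l := T) hδ hδρ _ (fun k hk => ?_) (m := m) fun k hk => ?_
    · exact ShadedTubes.cubeIn_of_mem_incidences
        (h.subset (hmem _ (ShadedTubes.mem_image_snd_filter.mp hk)).1)
    · exact (hmem _ (ShadedTubes.mem_image_snd_filter.mp hk)).2.2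
  · field_simp

theorem card_inU_le (h : IsPruned 𝒯 ρ A μ u J₀) (hs : 𝒯.IsSticky K) (hδ : 0 < δ) (hδρ : δ ≤ ρ)
    (hρ1 : ρ ≤ 1) (hKA : (K : ℝ) ≤ A) (U : TubeLine) :
    ((J₀.filter fun p => u p.1 = U).card : ℝ) ≤ 10 ^ 15 * A * (ρ ^ 3 / δ ^ 4) := by
  have hρ0 : 0 < ρ := hδ.trans_le hδρ
  set F := J₀.filter fun p => u p.1 = U with hF
  refine (ShadedTubes.card_le_of_card_tubes_le (M := 10 ^ 9 / δ)
    (N := A * (10 ^ 6 * (ρ / δ) ^ 3)) (by positivity) ?_ fun T _ => ?_).trans (le_of_eq ?_)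
  · refine hs.card_covered_le (ρ := ρ) (U := U) hδ (hδρ.trans hρ1) hKA (fun T hT => ?_) hδρ
      fun T hT => ?_
    · obtain ⟨p, hp, rfl⟩ := Finset.mem_image.mp hT
      exact (ShadedTubes.mem_incidences.mp (h.subset (Finset.mem_filter.mp hp).1)).1
    · obtain ⟨p, hp, rfl⟩ := Finset.mem_image.mp hT
      have := h.covers p (Finset.mem_filter.mp hp).1
      rwa [(Finset.mem_filter.mp hp).2] at this
  · exact ShadedTubes.card_shading_le hδ (hδρ.trans hρ1)
      ((Finset.filter_subset _ _).trans h.subset) T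
  · field_simp

theorem card_UR_le (h : IsPruned 𝒯 ρ A μ u J₀) (hδ : 0 < δ) (hδρ : δ ≤ ρ) (hρ1 : ρ ≤ 1) :
    ((J₀.image fun p => (u p.1, coarseCell δ ρ p.2)).card : ℝ) ≤ 10 ^ 17 * A / ρ ^ 4 := by
  have hρ0 : 0 < ρ := hδ.trans_le hδρ
  set F := J₀.image fun p => (u p.1, coarseCell δ ρ p.2) with hF
  refine (ShadedTubes.card_le_of_card_tubes_le (M := 10 ^ 10 / ρ)
    (N := A * (10 ^ 7 / ρ ^ 3)) (by positivity) ?_ fun U _ => ?_).trans (le_of_eq ?_)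
  · rw [hF, Finset.image_image]
    exact h.card_cover
  · refine card_coarseCell_le (U := U) hδ hδρ hρ1 _ fun m hm => ?_
    obtain ⟨p, hp, hpe⟩ := Finset.mem_image.mp (ShadedTubes.mem_image_snd_filter.mp hm)
    obtain ⟨h1, h2⟩ := Prod.mk.inj hpe
    exact ⟨p.1, p.2, ShadedTubes.cubeIn_of_mem_incidences (h.subset hp), h1 ▸ h.covers p hp, h2⟩
  · field_simp

theorem card_Tq_le (h : IsPruned 𝒯 ρ A μ u J₀) (hs : 𝒯.IsSticky K) (hδ : 0 < δ) (hδρ : δ ≤ ρ)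
    (hρ1 : ρ ≤ 1) (hKA : (K : ℝ) ≤ A) :
    ((J₀.image fun p => (p.1, fineCell δ ρ (u p.1) p.2)).card : ℝ) ≤
      10 ^ 18 * A * ρ / δ ^ 4 := by
  have hρ0 : 0 < ρ := hδ.trans_le hδρ
  set F := J₀.image fun p => (p.1, fineCell δ ρ (u p.1) p.2) with hF
  have hsub : F.image Prod.fst ⊆ 𝒯.tubes := fun T hT => by
    rw [hF, Finset.image_image] at hT
    obtain ⟨p, hp, rfl⟩ := Finset.mem_image.mp hT
    exact (ShadedTubes.mem_incidences.mp (h.subset hp)).1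
  refine (ShadedTubes.card_le_of_card_tubes_le (M := 10 ^ 10 * (ρ / δ)) (by positivity)
    ((Nat.cast_le.mpr (Finset.card_le_card hsub)).trans
      (hs.card_tubes_le hδ (hδρ.trans hρ1) hKA)) fun T hT => ?_).trans (le_of_eq ?_)
  · rw [hF, Finset.image_image] at hT
    obtain ⟨p₀, hp₀, rfl⟩ := Finset.mem_image.mp hT
    refine card_fineCell_le (l := p₀.1) hδ hδρ (h.covers p₀ hp₀) _ fun m hm => ?_
    obtain ⟨p, hp, hpe⟩ := Finset.mem_image.mp (ShadedTubes.mem_image_snd_filter.mp hm)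
    obtain ⟨h1, h2⟩ := Prod.mk.inj hpe
    have h1' : p.1 = p₀.1 := h1
    refine ⟨p.2, ?_, ?_⟩
    · have := ShadedTubes.cubeIn_of_mem_incidences (h.subset hp)
      rwa [h1'] at this
    · rw [h1'] at h2
      exact h2
  · field_simp

/-- The coarse collection of a large set of pruned incidences is admissible. -/
theorem exists_coarse_admissible (h : IsPruned 𝒯 ρ A μ u J₀) (hs : 𝒯.IsSticky K) (hδ : 0 < δ)
    (hδρ : 8 * δ ≤ ρ) (hρ1 : ρ ≤ 1 / 1000) (hKA : (K : ℝ) ≤ A) (hA : 0 < A) (hJ : J ⊆ J₀)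
    (hst : 10 ^ 29 * A ≤ ρ ^ (-t)) (hmass : ρ ^ t * (10 ^ 15 * A) ≤ J.card * δ ^ 4) :
    ∃ 𝒰 : ShadedTubes ρ, 𝒰.tubes = J.image (fun p => u p.1) ∧
      (∀ p ∈ J, cube δ p.2 ⊆ 𝒰.shadeSet (u p.1)) ∧ 𝒰.IsAdmissible t t ∧
      volume.real 𝒰.unionSet ≤ 16 * (J.image fun p => coarseCell δ ρ p.2).card * ρ ^ 4 ∧
      ∀ c, ∃ m, ∀ U ∈ 𝒰.through c, ∃ p ∈ J, u p.1 = U ∧ coarseCell δ ρ p.2 = m := by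
  have hρ0 : 0 < ρ := by linarith
  obtain ⟨𝒰, htubes, hshade, hinc, hvol, hthr⟩ := exists_coarse hδ hδρ (by linarith) u J
    (fun p hp => ShadedTubes.cubeIn_of_mem_incidences (h.subset (hJ hp)))
    (fun p hp => h.covers p (hJ hp)) (fun p hp => h.inner p (hJ hp))
    (fun p hp p' hp' => h.parity p (hJ hp) p' (hJ hp'))
  refine ⟨𝒰, htubes, hshade, ⟨?_, ?_, ?_⟩, ?_, hthr⟩
  · intro U hU U' hU' hne
    rw [htubes] at hU hU'
    obtain ⟨p, hp, rfl⟩ := Finset.mem_image.mp hU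
    obtain ⟨p', hp', rfl⟩ := Finset.mem_image.mp hU'
    exact h.separated_cover p (hJ hp) p' (hJ hp') hne
  · intro r hr hr1
    obtain ⟨𝒱, h1, h2⟩ := hs.exists_cover r (by linarith) hr1
    obtain ⟨𝒱', h3, h4⟩ := exists_cover_coarse (hρ0.trans_le hr) hr (S := 𝒰.tubes)
      (fun U hU => by
        rw [htubes] at hU
        obtain ⟨p, hp, rfl⟩ := Finset.mem_image.mp hU
        exact ⟨p.1, h.covers p (hJ hp),
          h1 p.1 (ShadedTubes.mem_incidences.mp (h.subset (hJ hp))).1⟩) h2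
    refine ⟨𝒱', h3, fun V => ?_⟩
    calc ((𝒱'.filter fun V' => V'.angle V ≤ r).card : ℝ) ≤ ((10 ^ 29 * K : ℕ) : ℝ) :=
          Nat.cast_le.mpr (h4 V)
      _ = 10 ^ 29 * K := by push_cast; ring
      _ ≤ 10 ^ 29 * A := by gcongr
      _ ≤ ρ ^ (-t) := hst
  · rw [ShadedTubes.mass_eq hρ0]
    have h1 := card_le_mul_card_image_real J (fun p => (u p.1, coarseCell δ ρ p.2))
      (c := 10 ^ 15 * A * (ρ ^ 4 / δ ^ 4)) fun p _ => by
        simp only [Prod.mk.injEq]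
        exact h.card_cell_le hs hδ (by linarith) (by linarith) hKA hJ _ _
    have h2 : (J.card : ℝ) ≤ 10 ^ 15 * A * (ρ ^ 4 / δ ^ 4) * 𝒰.incidences.card :=
      h1.trans (by gcongr)
    have h3 : (10 ^ 15 * A * (ρ ^ 4 / δ ^ 4) * 𝒰.incidences.card) * δ ^ 4 =
        (𝒰.incidences.card * ρ ^ 4) * (10 ^ 15 * A) := by
      field_simp
    have h4 : ρ ^ t * (10 ^ 15 * A) ≤ (𝒰.incidences.card * ρ ^ 4) * (10 ^ 15 * A) := by
      rw [← h3]
      exact hmass.trans (mul_le_mul_of_nonneg_right h2 (by positivity))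
    exact le_of_mul_le_mul_right h4 (by positivity)
  · rw [ShadedTubes.volume_unionSet hρ0]
    gcongr
    exact_mod_cast hvol

/-- The rescaling of the pruned incidences inside a covering tube is admissible, provided they are
many. -/
theorem exists_fine_admissible (h : IsPruned 𝒯 ρ A μ u J₀) (hs : 𝒯.IsSticky K) (hδ : 0 < δ)
    (hρ0 : 0 < ρ) (hρ1 : ρ ≤ 1 / 1000) (hδρ : δ / ρ ≤ 1 / 1000) (hKA : (K : ℝ) ≤ A)
    {U : TubeLine} {𝒮 : ShadedTubes δ} (h𝒮 : ∀ T ∈ 𝒮.tubes, ∃ k, (T, k) ∈ J₀ ∧ u T = U)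
    (F : Frame U) (hst : 10 ^ 29 * A ≤ (δ / ρ) ^ (-t))
    (hmass : (δ / ρ) ^ t * (10 ^ 10 * (ρ ^ 3 / δ ^ 4)) ≤ 𝒮.incidences.card) :
    ∃ 𝒯' : ShadedTubes (δ / ρ), 𝒯'.IsImageUnder (F.map ρ) 𝒮 ∧ 𝒯'.IsAdmissible t t ∧
      volume.real 𝒯'.unionSet ≤
        7 ^ 4 * (𝒮.incidences.image fun p => fineCell δ ρ U p.2).card * (δ / ρ) ^ 4 := by
  have hr0 : 0 < δ / ρ := div_pos hδ hρ0
  have hcov : ∀ T ∈ 𝒮.tubes, U.CoversTube ρ T := fun T hT => by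
    obtain ⟨k, hk, hU⟩ := h𝒮 T hT
    have := h.covers _ hk
    rwa [hU] at this
  have hsep : ∀ T ∈ 𝒮.tubes, ∀ T' ∈ 𝒮.tubes, T ≠ T' → 256 * δ < T.lineDist T' :=
    fun T hT T' hT' hne => by
      obtain ⟨k, hk, -⟩ := h𝒮 T hT
      obtain ⟨k', hk', -⟩ := h𝒮 T' hT'
      exact h.separated (T, k) hk (T', k') hk' hne
  obtain ⟨𝒯', himage, hdist, hinc, hvol, hsticky⟩ := exists_rescaling F hδ hρ0 (by linarith)
    (by linarith) 𝒮 hcov hsep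
  refine ⟨𝒯', himage, ⟨hdist, fun r hr hr1 => ?_, ?_⟩, ?_⟩
  · have hr' : 0 < r := hr0.trans_le hr
    obtain ⟨𝒱, h1, h2⟩ := hs.exists_cover (ρ * r) (by
      rw [div_le_iff₀ hρ0] at hr
      linarith) (by nlinarith)
    obtain ⟨𝒱', h3, h4⟩ := hsticky r K 𝒱 hr' (fun T hT => by
      obtain ⟨k, hk, -⟩ := h𝒮 T hT
      exact h1 T (ShadedTubes.mem_incidences.mp (h.subset hk)).1) h2
    refine ⟨𝒱', h3, fun V => ?_⟩
    calc ((𝒱'.filter fun V' => V'.angle V ≤ r).card : ℝ) ≤ ((10 ^ 29 * K : ℕ) : ℝ) :=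
          Nat.cast_le.mpr (h4 V)
      _ = 10 ^ 29 * K := by push_cast; ring
      _ ≤ 10 ^ 29 * A := by gcongr
      _ ≤ (δ / ρ) ^ (-t) := hst
  · rw [ShadedTubes.mass_eq hr0]
    have h1 := hmass.trans hinc
    have h2 : 10 ^ 10 / ρ * (𝒯'.incidences.card : ℝ) =
        (𝒯'.incidences.card * (δ / ρ) ^ 4) * (10 ^ 10 * (ρ ^ 3 / δ ^ 4)) := by
      field_simp
    rw [h2] at h1
    exact le_of_mul_le_mul_right h1 (by positivity)
  · rw [ShadedTubes.volume_unionSet hr0]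
    gcongr
    exact_mod_cast hvol

/-- The pruned incidences satisfy the hypotheses of the two-scale argument, with the lower bounds
for volumes supplied by the definition of `σ₄` at the scales `ρ` and `δ / ρ`.
The power `A ^ 13` absorbs the mass `A ^ (-10)` of the sets to be tested and the constants, so that
their coarse and fine collections are admissible. -/
theorem twoScaleBounds (h : IsPruned 𝒯 ρ A μ u J₀) (hs : 𝒯.IsSticky K) (hδ : 0 < δ)
    (hρ0 : 0 < ρ) (hρ1 : ρ ≤ 1 / 1000) (hδρ : δ / ρ ≤ 1 / 1000) (hKA : (K : ℝ) ≤ A)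
    (hA : 10 ^ 40 ≤ A) {σ ζ : ℝ}
    (hvol : volume.real 𝒯.unionSet ≤ A * (ρ ^ σ * (δ / ρ) ^ σ))
    (hstρ : A ^ 13 ≤ ρ ^ (-t)) (hstδ : A ^ 13 ≤ (δ / ρ) ^ (-t))
    (hlowρ : ∀ 𝒰 : ShadedTubes ρ, 𝒰.IsAdmissible t t → ρ ^ (σ + ζ) ≤ volume.real 𝒰.unionSet)
    (hlowδ : ∀ 𝒰 : ShadedTubes (δ / ρ), 𝒰.IsAdmissible t t →
      (δ / ρ) ^ (σ + ζ) ≤ volume.real 𝒰.unionSet) :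
    TwoScaleBounds u (coarseCell δ ρ) (fineCell δ ρ) J₀ δ ρ (A ^ 2) (ρ ^ σ) ((δ / ρ) ^ σ)
      (ρ ^ ζ) ((δ / ρ) ^ ζ) μ := by
  have hr0 : 0 < δ / ρ := div_pos hδ hρ0
  have hA0 : 0 < A := lt_of_lt_of_le (by norm_num) hA
  have hA1 : 1 ≤ A := le_trans (by norm_num) hA
  have hδρ' : 8 * δ ≤ ρ := by
    rw [div_le_iff₀ hρ0] at hδρ
    linarith
  have hconst : ∀ c : ℝ, c ≤ 10 ^ 40 → c * A ≤ A ^ 2 := fun c hc => by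
    rw [pow_two]
    exact mul_le_mul_of_nonneg_right (hc.trans hA) hA0.le
  have hst29 : 10 ^ 29 * A ≤ A ^ 13 := by
    calc 10 ^ 29 * A ≤ A ^ 2 := hconst _ (by norm_num)
      _ ≤ A ^ 13 := pow_le_pow_right₀ hA1 (by norm_num)
  have hpow : ∀ x : ℝ, 0 < x → A ^ 13 ≤ x ^ (-t) → x ^ t ≤ 1 / A ^ 13 := fun x hx hx' => by
    rw [Real.rpow_neg hx.le] at hx'
    rw [le_div_iff₀ (by positivity)]
    have h1 := Real.rpow_pos_of_pos hx t
    calc x ^ t * A ^ 13 ≤ x ^ t * (x ^ t)⁻¹ := by gcongr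
      _ = 1 := mul_inv_cancel₀ h1.ne'
  refine
    { δ_pos := hδ
      ρ_pos := hρ0
      B_ge := ?_
      sR_pos := Real.rpow_pos_of_pos hρ0 _
      sr_pos := Real.rpow_pos_of_pos hr0 _
      zR_pos := Real.rpow_pos_of_pos hρ0 _
      zr_pos := Real.rpow_pos_of_pos hr0 _
      μ_pos := h.mult_pos
      card_U := ?_
      card_inU := ?_
      card_UR := ?_
      card_Tq := ?_
      card_E := ?_
      mass := ?_
      mult := h.mult
      coarse := ?_
      fine := ?_ }
  · have := hconst 6 (by norm_num)
    linarith
  · refine h.card_cover.trans ?_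
    rw [← mul_div_assoc, mul_comm]
    gcongr
    exact hconst _ (by norm_num)
  · intro U
    refine (h.card_inU_le hs hδ (by linarith) (by linarith) hKA U).trans ?_
    rw [← mul_div_assoc]
    gcongr
    exact hconst _ (by norm_num)
  · refine (h.card_UR_le hδ (by linarith) (by linarith)).trans ?_
    gcongr
    exact hconst _ (by norm_num)
  · refine (h.card_Tq_le hs hδ (by linarith) (by linarith) hKA).trans ?_
    gcongr
    exact hconst _ (by norm_num)
  · rw [ShadedTubes.volume_unionSet hδ] at hvol
    rw [le_div_iff₀ (by positivity), mul_assoc]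
    refine le_trans ?_ (hvol.trans ?_)
    · exact mul_le_mul_of_nonneg_right (Nat.cast_le.mpr (Finset.card_le_card
        (Finset.image_subset_image h.subset))) (by positivity)
    · have h1 : A ≤ A ^ 2 := by nlinarith
      have h2 : 0 < ρ ^ σ * (δ / ρ) ^ σ :=
        mul_pos (Real.rpow_pos_of_pos hρ0 _) (Real.rpow_pos_of_pos hr0 _)
      exact mul_le_mul_of_nonneg_right h1 h2.le
  · rw [← pow_mul]
    exact h.mass
  · intro J hJ hJcard
    rw [div_le_iff₀ (by positivity), ← pow_mul] at hJcard
    obtain ⟨𝒰, -, -, hadm, hvol𝒰, -⟩ := h.exists_coarse_admissible (t := t) hs hδ hδρ' hρ1 hKA hA0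
      hJ (hst29.trans hstρ) (by
        have h1 := hpow ρ hρ0 hstρ
        have h2 : ρ ^ t * (10 ^ 15 * A) * A ^ 10 ≤ 1 := by
          calc ρ ^ t * (10 ^ 15 * A) * A ^ 10 ≤ 1 / A ^ 13 * (A ^ 2) * A ^ 10 := by
                gcongr
                exact hconst _ (by norm_num)
            _ = 1 / A := by field_simp
            _ ≤ 1 := (div_le_one hA0).mpr hA1
        have h3 : ρ ^ t * (10 ^ 15 * A) * A ^ 10 ≤ J.card * δ ^ 4 * A ^ 10 := by
          refine h2.trans (hJcard.trans (le_of_eq ?_))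
          ring
        exact le_of_mul_le_mul_right h3 (by positivity))
    have h1 := (hlowρ 𝒰 hadm).trans hvol𝒰
    rw [Real.rpow_add hρ0] at h1
    rw [div_le_iff₀ (by positivity)]
    refine h1.trans ?_
    have h16 : (16 : ℝ) ≤ A ^ 2 := by
      have := hconst 16 (by norm_num)
      linarith
    calc 16 * ((J.image fun p => coarseCell δ ρ p.2).card : ℝ) * ρ ^ 4
        ≤ A ^ 2 * ((J.image fun p => coarseCell δ ρ p.2).card : ℝ) * ρ ^ 4 := by gcongr
      _ = (J.image fun p => coarseCell δ ρ p.2).card * (A ^ 2 * ρ ^ 4) := by ring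
  · intro J hJ U hJcard
    set JU := J.filter fun p => u p.1 = U with hJU
    have hJU₀ : JU ⊆ J₀ := (Finset.filter_subset _ _).trans hJ
    obtain ⟨F⟩ := exists_frame U
    obtain ⟨𝒯', -, hadm, hvol'⟩ := h.exists_fine_admissible (t := t) hs hδ hρ0 hρ1 hδρ hKA
      (𝒮 := 𝒯.restrict JU (hJU₀.trans h.subset))
      (fun T hT => by
        obtain ⟨k, hk⟩ := ShadedTubes.mem_restrict_tubes.mp hT
        exact ⟨k, hJU₀ hk, (Finset.mem_filter.mp hk).2⟩) F (hst29.trans hstδ) (by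
        rw [ShadedTubes.incidences_restrict]
        refine le_trans ?_ hJcard
        have h1 := hpow _ hr0 hstδ
        rw [← pow_mul, le_div_iff₀ (by positivity)]
        calc (δ / ρ) ^ t * (10 ^ 10 * (ρ ^ 3 / δ ^ 4)) * (A ^ (2 * 6) * δ ^ 4)
            ≤ 1 / A ^ 13 * (A * (ρ ^ 3 / δ ^ 4)) * (A ^ (2 * 6) * δ ^ 4) := by
              gcongr
              exact le_trans (by norm_num) hA
          _ = ρ ^ 3 := by field_simp)
    rw [ShadedTubes.incidences_restrict] at hvol'
    have h1 := (hlowδ 𝒯' hadm).trans hvol'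
    rw [Real.rpow_add hr0] at h1
    have h7 : (7 : ℝ) ^ 4 ≤ A ^ 2 := by
      have := hconst (7 ^ 4) (by norm_num)
      have h7 : (7 : ℝ) ^ 4 * 1 ≤ 7 ^ 4 * A := by gcongr
      linarith
    rw [div_le_iff₀ (by positivity)]
    have h2 := h1.trans (show (7 : ℝ) ^ 4 * (JU.image fun p => fineCell δ ρ U p.2).card *
      (δ / ρ) ^ 4 ≤ A ^ 2 * (JU.image fun p => fineCell δ ρ U p.2).card * (δ / ρ) ^ 4 by gcongr)
    calc ρ ^ 4 * (δ / ρ) ^ σ * (δ / ρ) ^ ζ = ρ ^ 4 * ((δ / ρ) ^ σ * (δ / ρ) ^ ζ) := by ring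
      _ ≤ ρ ^ 4 * (A ^ 2 * (JU.image fun p => fineCell δ ρ U p.2).card * (δ / ρ) ^ 4) :=
          mul_le_mul_of_nonneg_left h2 (by positivity)
      _ = (JU.image fun p => fineCell δ ρ U p.2).card * (A ^ 2 * δ ^ 4) := by
          field_simp

end IsPruned

end

/-! ### The plany case -/

section

variable {δ ρ A μ e ζ : ℝ} {K : ℕ} {𝒯 : ShadedTubes δ} {u : TubeLine → TubeLine}
  {J₀ : Finset (TubeLine × (Fin 4 → ℤ))}

/-- The loss `Z` absorbs all powers of `A` that occur, and a power `e` of the scale absorbs it. -/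
theorem pow_le_rpow_neg_mul {x e Z A : ℝ} (hx : 0 < x) (hxe : x ^ e ≤ Z ^ 4) (hZ : 0 < Z)
    (hA : 1 ≤ A) (hZA : Z * A ^ 100 ≤ 1) : A ^ 90 ≤ x ^ (-e) * Z ^ 2 := by
  have hA0 : 0 < A := by linarith
  have hxp := Real.rpow_pos_of_pos hx e
  rw [Real.rpow_neg hx.le, inv_mul_eq_div, le_div_iff₀ hxp]
  have h1 : A ^ 90 * Z ≤ 1 := by
    rw [mul_comm]
    exact (mul_le_mul_of_nonneg_left (pow_le_pow_right₀ hA (by norm_num)) hZ.le).trans hZA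
  have h2 : Z ≤ 1 := le_trans (le_mul_of_one_le_right hZ.le (one_le_pow₀ hA)) hZA
  calc A ^ 90 * x ^ e ≤ A ^ 90 * Z ^ 4 := by gcongr
    _ = (A ^ 90 * Z) * (Z * Z ^ 2) := by ring
    _ ≤ 1 * (1 * Z ^ 2) := by gcongr
    _ = Z ^ 2 := by ring

theorem TubeLine.angle_starProjection_le {U T : TubeLine} {P : Submodule ℝ E4}
    (h : U.CoversTube ρ T) (hT : ‖T.dir - P.starProjection T.dir‖ ≤ ρ) :
    InnerProductGeometry.angle U.dir (P.starProjection U.dir) ≤ 6 * ρ := by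
  have h1 := norm_sub_starProjection_le P U.dir (Submodule.starProjection_apply_mem P T.dir)
  have h2 := norm_sub_le_norm_sub_add_norm_sub U.dir T.dir (P.starProjection T.dir)
  have h3 := T.norm_dir_sub_le_lineDist U
  rw [norm_sub_rev] at h3
  have h4 := StickyKakeya.angle_starProjection_le P U.norm_dir
  unfold CoversTube at h
  linarith

namespace IsPruned

set_option maxHeartbeats 400000 in
/-- Pruned incidences lying on planes, together with the outcome of the two-scale argument, give
the plany case. -/
theorem exists_plany (h : IsPruned 𝒯 ρ A μ u J₀) (hs : 𝒯.IsSticky K) (hδ : 0 < δ)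
    (hρ0 : 0 < ρ) (hρ1 : ρ ≤ 1 / 1000) (hδρ : δ / ρ ≤ 1 / 1000) (hKA : (K : ℝ) ≤ A)
    (hA : 10 ^ 40 ≤ A) {σ : ℝ} (hζ : 0 < ζ)
    (hts : TwoScaleBounds u (coarseCell δ ρ) (fineCell δ ρ) J₀ δ ρ (A ^ 2) (ρ ^ σ) ((δ / ρ) ^ σ)
      (ρ ^ ζ) ((δ / ρ) ^ ζ) μ)
    (hZA : δ ^ ζ * A ^ 100 ≤ 1) (hρe : ρ ^ e ≤ (δ ^ ζ) ^ 4) (hδe : (δ / ρ) ^ e ≤ (δ ^ ζ) ^ 4)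
    (hplane : ∀ k, ∃ P : Submodule ℝ E4, Module.finrank ℝ P = 2 ∧
      ∀ T, (T, k) ∈ J₀ → ‖T.dir - P.starProjection T.dir‖ ≤ ρ) :
    ∃ (𝒯' : ShadedTubes δ) (𝒰 : ShadedTubes ρ),
      𝒯'.IsRefinementBy (δ ^ (2 * ζ)) 𝒯 ∧ 𝒰.Covers 𝒯' ∧
      (∀ T ∈ 𝒯'.tubes, ∃! U, U ∈ 𝒰.tubes ∧ U.CoversTube ρ T) ∧
      (𝒰.IsAdmissible e e ∧ volume.real 𝒰.unionSet ≤ ρ ^ (σ - e)) ∧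
      (∀ U ∈ 𝒰.tubes, ∀ F : Frame U, ∃ 𝒮 : ShadedTubes (δ / ρ),
        𝒮.IsImageUnder (F.map ρ) (𝒯'.coveredBy ρ U) ∧ 𝒮.IsAdmissible e e ∧
          volume.real 𝒮.unionSet ≤ (δ / ρ) ^ (σ - e)) ∧
      (∀ k ∈ 𝒰.cubes, ((𝒰.through k).card : ℝ) ≤ 100 * ρ ^ (-σ - e)) ∧
      (∀ k ∈ 𝒯'.cubes, ∀ U ∈ 𝒰.tubes,
        (((𝒯'.coveredBy ρ U).through k).card : ℝ) ≤ 100 * (δ / ρ) ^ (-σ - e)) ∧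
      (∃ μfine : ℝ, 0 < μfine ∧ ∀ U ∈ 𝒰.tubes, ∀ k ∈ (𝒯'.coveredBy ρ U).cubes,
        (100 : ℝ)⁻¹ * μfine ≤ (((𝒯'.coveredBy ρ U).through k).card : ℝ) ∧
          (((𝒯'.coveredBy ρ U).through k).card : ℝ) ≤ 100 * μfine) ∧
      𝒰.IsPlany 100 := by
  have hr0 : 0 < δ / ρ := div_pos hδ hρ0
  have hA0 : 0 < A := lt_of_lt_of_le (by norm_num) hA
  have hA1 : 1 ≤ A := le_trans (by norm_num) hA
  have hδρ' : 8 * δ ≤ ρ := by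
    rw [div_le_iff₀ hρ0] at hδρ
    linarith
  -- numerical preparations
  set Z := δ ^ ζ with hZ
  have hZ0 : 0 < Z := Real.rpow_pos_of_pos hδ ζ
  have hZ1 : Z ≤ 1 := le_trans (le_mul_of_one_le_right hZ0.le (one_le_pow₀ hA1)) hZA
  have hZmul : ρ ^ ζ * (δ / ρ) ^ ζ = Z := by
    rw [← Real.mul_rpow hρ0.le hr0.le, mul_div_cancel₀ _ hρ0.ne']
  have hzR0 := Real.rpow_pos_of_pos hρ0 ζ
  have hzr0 := Real.rpow_pos_of_pos hr0 ζ
  have hsR0 := Real.rpow_pos_of_pos hρ0 σ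
  have hsr0 := Real.rpow_pos_of_pos hr0 σ
  have hzR1 : ρ ^ ζ ≤ 1 := Real.rpow_le_one hρ0.le (by linarith) hζ.le
  have hzr1 : (δ / ρ) ^ ζ ≤ 1 := Real.rpow_le_one hr0.le (by linarith) hζ.le
  have hZR : Z ≤ ρ ^ ζ := by
    rw [← hZmul]
    exact mul_le_of_le_one_right hzR0.le hzr1
  have hZr : Z ≤ (δ / ρ) ^ ζ := by
    rw [← hZmul]
    exact mul_le_of_le_one_left hzr0.le hzR1
  have hkey : ∀ x, 0 < x → x ^ e ≤ Z ^ 4 → A ^ 90 ≤ x ^ (-e) * Z ^ 2 := fun x hx hxe =>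
    pow_le_rpow_neg_mul hx hxe hZ0 hA1 hZA
  have hconst : ∀ (c : ℝ) (n : ℕ), c ≤ 10 ^ 40 → n + 1 ≤ 90 → c * A ^ n ≤ A ^ 90 :=
    fun c n hc hn => by
      calc c * A ^ n ≤ A * A ^ n := by
            gcongr
            exact hc.trans hA
        _ = A ^ (n + 1) := by ring
        _ ≤ A ^ 90 := pow_le_pow_right₀ hA1 hn
  have hst : ∀ x, 0 < x → x ^ e ≤ Z ^ 4 → 10 ^ 29 * A ≤ x ^ (-e) := fun x hx hxe => by
    have h1 := hkey x hx hxe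
    have h2 := hconst (10 ^ 29) 1 (by norm_num) (by norm_num)
    have h3 := Real.rpow_pos_of_pos hx (-e)
    have h4 : x ^ (-e) * Z ^ 2 ≤ x ^ (-e) := mul_le_of_le_one_right h3.le (pow_le_one₀ hZ0.le hZ1)
    rw [pow_one] at h2
    linarith
  have hA90 : A ^ 90 * Z ≤ 1 := by
    rw [mul_comm]
    exact (mul_le_mul_of_nonneg_left (pow_le_pow_right₀ hA1 (by norm_num)) hZ0.le).trans hZA
  -- the two-scale argument
  obtain ⟨J, hJ, k, hsat, hJcard, hk, hμ, hR, hfib, hRvol, hqvol⟩ := hts.exists_twoScale rfl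
  rw [hZmul] at hJcard hfib hRvol hqvol
  simp only [← pow_mul] at hJcard hfib hRvol hqvol hμ hR
  norm_num only at hJcard hfib hRvol hqvol hμ hR
  have hJI : J ⊆ 𝒯.incidences := hJ.trans h.subset
  have hsmall : ∀ (c : ℝ) (n : ℕ), c ≤ 10 ^ 40 → n + 1 ≤ 90 → c * A ^ n * Z ≤ 1 :=
    fun c n hc hn => (mul_le_mul_of_nonneg_right (hconst c n hc hn) hZ0.le).trans hA90
  have hfinish : ∀ x, 0 < x → x ^ e ≤ Z ^ 4 → ∀ n s : ℝ, 0 ≤ s → n * Z ^ 2 ≤ s * A ^ 90 →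
      n ≤ s * x ^ (-e) := fun x hx hxe n s hs h => by
    have h1 := h.trans (mul_le_mul_of_nonneg_left (hkey x hx hxe) hs)
    rw [← mul_assoc] at h1
    exact le_of_mul_le_mul_right h1 (by positivity)
  have hJcard' : Z / (2 * A ^ 40) ≤ J.card * δ ^ 4 := by
    refine le_trans (le_of_eq ?_) (mul_le_mul_of_nonneg_right hJcard (pow_nonneg hδ.le 4))
    field_simp
  -- the covering tube is unique
  have huniq : ∀ p ∈ J, ∀ p' ∈ J, (u p'.1).CoversTube ρ p.1 → u p'.1 = u p.1 := by
    intro p hp p' hp' hcov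
    by_contra hne
    have h1 := h.separated_cover p' (hJ hp') p (hJ hp) hne
    have h2 := h.covers p (hJ hp)
    have h3 := (u p'.1).lineDist_triangle p.1 (u p.1)
    unfold TubeLine.CoversTube at h2 hcov
    rw [TubeLine.lineDist_comm (u p'.1) p.1] at h3
    linarith
  -- the coarse collection
  obtain ⟨𝒰, htubes, hshade, hadm, hvol𝒰, hthr⟩ := h.exists_coarse_admissible (t := e) hs hδ hδρ'
    hρ1 hKA hA0 hJ (hst ρ hρ0 hρe) (by
      refine le_trans ?_ hJcard'
      rw [le_div_iff₀ (by positivity)]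
      calc ρ ^ e * (10 ^ 15 * A) * (2 * A ^ 40) ≤ Z ^ 4 * (10 ^ 15 * A) * (2 * A ^ 40) := by gcongr
        _ = (2 * 10 ^ 15 * A ^ 41 * Z) * (Z * (Z * Z)) := by ring
        _ ≤ 1 * (1 * (1 * Z)) := by
            gcongr
            exact hsmall _ 41 (by norm_num) (by norm_num)
        _ = Z := by ring)
  have hmem𝒰 : ∀ U ∈ 𝒰.tubes, ∃ p ∈ J, u p.1 = U := fun U hU => by
    rw [htubes] at hU
    exact Finset.mem_image.mp hU
  have hcover : ∀ U ∈ 𝒰.tubes, ∀ p ∈ J, U.CoversTube ρ p.1 ↔ u p.1 = U := by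
    intro U hU p hp
    obtain ⟨p', hp', rfl⟩ := hmem𝒰 U hU
    exact ⟨fun hc => (huniq p hp p' hp' hc).symm, fun hc => hc ▸ h.covers p (hJ hp)⟩
  set 𝒯' := 𝒯.restrict J hJI with h𝒯'
  have hinc : 𝒯'.incidences = J := ShadedTubes.incidences_restrict
  have hincU : ∀ U ∈ 𝒰.tubes, (𝒯'.coveredBy ρ U).incidences = J.filter fun p => u p.1 = U := by
    intro U hU
    rw [ShadedTubes.incidences_coveredBy, hinc]
    exact Finset.filter_congr fun p hp => hcover U hU p hp
  have hcubeU : ∀ U ∈ 𝒰.tubes, ∀ k ∈ (𝒯'.coveredBy ρ U).cubes,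
      μ ≤ (((𝒯'.coveredBy ρ U).through k).card : ℝ) ∧
        (((𝒯'.coveredBy ρ U).through k).card : ℝ) ≤ 2 * μ := by
    intro U hU k hk
    obtain ⟨T, hT⟩ := ShadedTubes.mem_cubes.mp hk
    rw [hincU U hU] at hT
    obtain ⟨hT, hTU⟩ := Finset.mem_filter.mp hT
    have := h.mult _ (hJ hT)
    convert this using 3 <;>
    · rw [ShadedTubes.card_through, hincU U hU, Finset.filter_filter]
      refine congrArg _ (Finset.Subset.antisymm (fun p hp => ?_) fun p hp => ?_)
      · obtain ⟨hp, h1, h2⟩ := Finset.mem_filter.mp hp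
        exact Finset.mem_filter.mpr ⟨hJ hp, h1.trans hTU.symm, h2⟩
      · obtain ⟨hp, h1, h2⟩ := Finset.mem_filter.mp hp
        exact Finset.mem_filter.mpr ⟨hsat.2 _ hT p hp h1 h2, h1.trans hTU, h2⟩
  refine ⟨𝒯', 𝒰, ?_, ⟨?_, ?_⟩, ?_, ⟨hadm, ?_⟩, ?_, ?_, ?_, ⟨μ, h.mult_pos, ?_⟩, ?_⟩
  · -- the refinement
    refine ShadedTubes.restrict_isRefinementBy hδ ?_
    rw [mul_comm 2 ζ, Real.rpow_mul hδ.le, Real.rpow_two]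
    refine (mul_le_mul_of_nonneg_left (hs.card_incidences_le hδ (by linarith) hKA)
      (by positivity)).trans (le_trans ?_ hJcard)
    rw [le_div_iff₀ (by positivity), le_div_iff₀ (by positivity)]
    calc Z ^ 2 * (A * (10 ^ 17 / δ ^ 4)) * (2 * δ ^ 4) * A ^ 40
        = (2 * 10 ^ 17 * A ^ 41 * Z) * Z := by field_simp
      _ ≤ 1 * Z := by
          gcongr
          exact hsmall _ 41 (by norm_num) (by norm_num)
      _ = Z := one_mul Z
  · intro T hT
    obtain ⟨k, hTk⟩ := ShadedTubes.mem_restrict_tubes.mp hT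
    exact ⟨u T, by rw [htubes]; exact Finset.mem_image_of_mem _ hTk, h.covers (T, k) (hJ hTk)⟩
  · intro U hU T hT x hx
    obtain ⟨hT, hUT⟩ := Finset.mem_filter.mp hT
    obtain ⟨k, hk, hx⟩ := Set.mem_iUnion₂.mp hx
    have hTk := ShadedTubes.mem_restrict_shade.mp hk
    rw [← (hcover U hU (T, k) hTk).mp hUT]
    exact hshade (T, k) hTk hx
  · intro T hT
    obtain ⟨k, hTk⟩ := ShadedTubes.mem_restrict_tubes.mp hT
    refine ⟨u T, ⟨by rw [htubes]; exact Finset.mem_image_of_mem _ hTk, h.covers (T, k) (hJ hTk)⟩, ?_⟩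
    rintro U ⟨hU, hUT⟩
    exact ((hcover U hU (T, k) hTk).mp hUT).symm
  · -- the volume of the coarse collection
    rw [sub_eq_add_neg, Real.rpow_add hρ0]
    refine hvol𝒰.trans (hfinish ρ hρ0 hρe _ _ hsR0.le ?_)
    set N : ℝ := ((J.image fun p => coarseCell δ ρ p.2).card : ℝ) with hN
    have hN0 : 0 ≤ N := Nat.cast_nonneg _
    calc 16 * N * ρ ^ 4 * Z ^ 2 = 16 * A ^ 40 * (N * (Z / A ^ 40 * ρ ^ 4 * Z)) := by
          field_simp
      _ ≤ 16 * A ^ 40 * (N * (Z / A ^ 40 * ρ ^ 4 * (δ / ρ) ^ ζ)) := by gcongr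
      _ ≤ 16 * A ^ 40 * (2 * A ^ 20 * ρ ^ σ) := by gcongr
      _ = ρ ^ σ * (32 * A ^ 60) := by ring
      _ ≤ ρ ^ σ * A ^ 90 := by
          gcongr
          exact hconst _ 60 (by norm_num) (by norm_num)
  · -- the fine collections
    intro U hU F
    obtain ⟨p₀, hp₀, hp₀U⟩ := hmem𝒰 U hU
    obtain ⟨𝒮, himage, hadm', hvol'⟩ := h.exists_fine_admissible (t := e) hs hδ hρ0 hρ1 hδρ hKA
      (𝒮 := 𝒯'.coveredBy ρ U) (fun T hT => by
        obtain ⟨hT, hUT⟩ := Finset.mem_filter.mp hT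
        obtain ⟨k, hTk⟩ := ShadedTubes.mem_restrict_tubes.mp hT
        exact ⟨k, hJ hTk, (hcover U hU (T, k) hTk).mp hUT⟩) F (hst _ hr0 hδe) (by
        rw [hincU U hU]
        have h1 := hfib p₀ hp₀
        rw [hp₀U] at h1
        refine le_trans ?_ h1
        rw [le_div_iff₀ (by positivity)]
        calc (δ / ρ) ^ e * (10 ^ 10 * (ρ ^ 3 / δ ^ 4)) * (A ^ 4 * δ ^ 4)
            ≤ Z ^ 4 * (10 ^ 10 * (ρ ^ 3 / δ ^ 4)) * (A ^ 4 * δ ^ 4) := by gcongr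
          _ = (10 ^ 10 * A ^ 44 * Z) * (Z * Z) * (Z / A ^ 40 * ρ ^ 3) := by field_simp
          _ ≤ 1 * (1 * 1) * (Z / A ^ 40 * ρ ^ 3) := by
              gcongr
              exact hsmall _ 44 (by norm_num) (by norm_num)
          _ = Z / A ^ 40 * ρ ^ 3 := by ring)
    refine ⟨𝒮, himage, hadm', ?_⟩
    rw [sub_eq_add_neg, Real.rpow_add hr0]
    refine hvol'.trans (hfinish _ hr0 hδe _ _ hsr0.le ?_)
    rw [hincU U hU]
    have h1 := hqvol U
    set N : ℝ := (((J.filter fun p => u p.1 = U).image fun p => fineCell δ ρ U p.2).card : ℝ)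
      with hN
    have hN0 : 0 ≤ N := Nat.cast_nonneg _
    calc 7 ^ 4 * N * (δ / ρ) ^ 4 * Z ^ 2
        = 7 ^ 4 * A ^ 40 / ρ ^ 4 * (N * (Z / A ^ 40 * Z * δ ^ 4)) := by field_simp
      _ ≤ 7 ^ 4 * A ^ 40 / ρ ^ 4 * (N * (Z / A ^ 40 * ρ ^ ζ * δ ^ 4)) := by gcongr
      _ ≤ 7 ^ 4 * A ^ 40 / ρ ^ 4 * (A ^ 22 * ρ ^ 4 * (δ / ρ) ^ σ) := by gcongr
      _ = (δ / ρ) ^ σ * (7 ^ 4 * A ^ 62) := by field_simp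
      _ ≤ (δ / ρ) ^ σ * A ^ 90 := by
          gcongr
          exact hconst _ 62 (by norm_num) (by norm_num)
  · -- the multiplicity of the coarse collection
    intro c _
    rw [sub_eq_add_neg, Real.rpow_add hρ0, Real.rpow_neg hρ0.le]
    have hpos := Real.rpow_pos_of_pos hρ0 (-e)
    obtain ⟨m, hm⟩ := hthr c
    rcases (𝒰.through c).eq_empty_or_nonempty with h0 | ⟨U₀, hU₀⟩
    · rw [h0, Finset.card_empty, Nat.cast_zero]
      positivity
    obtain ⟨p₀, hp₀, -, hp₀m⟩ := hm U₀ hU₀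
    have h1 : ((𝒰.through c).card : ℝ) ≤ A ^ 6 / (ρ ^ σ * ρ ^ ζ) := by
      refine le_trans (Nat.cast_le.mpr (Finset.card_le_card fun U hU => ?_)) (hR p₀ hp₀)
      obtain ⟨p, hp, hpU, hpm⟩ := hm U hU
      exact Finset.mem_image.mpr ⟨p, Finset.mem_filter.mpr ⟨hp, hpm.trans hp₀m.symm⟩, hpU⟩
    rw [le_div_iff₀ (by positivity)] at h1
    have h2 := hfinish ρ hρ0 hρe ((𝒰.through c).card * ρ ^ σ) 1 zero_le_one (by
      calc ((𝒰.through c).card : ℝ) * ρ ^ σ * Z ^ 2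
          = (𝒰.through c).card * (ρ ^ σ * Z) * Z := by ring
        _ ≤ (𝒰.through c).card * (ρ ^ σ * ρ ^ ζ) * 1 := by gcongr
        _ ≤ 1 * A ^ 6 := by rw [mul_one, one_mul]; exact h1
        _ ≤ 1 * A ^ 90 := by
            gcongr
            norm_num)
    rw [← div_eq_inv_mul, ← mul_div_assoc, le_div_iff₀ hsR0]
    linarith
  · -- the multiplicity of the fine collections
    intro k _ U hU
    rw [sub_eq_add_neg, Real.rpow_add hr0, Real.rpow_neg hr0.le]
    have hpos := Real.rpow_pos_of_pos hr0 (-e)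
    rcases ((𝒯'.coveredBy ρ U).through k).eq_empty_or_nonempty with h0 | ⟨T, hT⟩
    · rw [h0, Finset.card_empty, Nat.cast_zero]
      positivity
    have h1 := (hcubeU U hU k (ShadedTubes.mem_cubes.mpr ⟨T, ShadedTubes.mem_through.mp hT⟩)).2
    have hμ0 := h.mult_pos
    have h2 := hfinish _ hr0 hδe (μ * (δ / ρ) ^ σ) 1 zero_le_one (by
      calc μ * (δ / ρ) ^ σ * Z ^ 2 = μ * (δ / ρ) ^ σ * Z * Z := by ring
        _ ≤ μ * (δ / ρ) ^ σ * (δ / ρ) ^ ζ * 1 := by gcongr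
        _ ≤ 1 * A ^ 14 := by rw [mul_one, one_mul]; exact hμ
        _ ≤ 1 * A ^ 90 := by
            gcongr
            norm_num)
    rw [← div_eq_inv_mul, ← mul_div_assoc, le_div_iff₀ hsr0]
    have h3 := mul_le_mul_of_nonneg_right h1 hsr0.le
    linarith
  · intro U hU k hk
    have h1 := hcubeU U hU k hk
    have hμ0 := h.mult_pos
    constructor <;> linarith
  · -- the planes
    intro c
    obtain ⟨m, hm⟩ := hthr c
    obtain ⟨P, hP, hPT⟩ := hplane (k m)
    refine ⟨P, hP, fun U hU => ?_⟩
    obtain ⟨p, hp, rfl, rfl⟩ := hm U hU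
    obtain ⟨p', hp', hu', hk'⟩ := hk p hp
    have h1 := h.covers p' hp'
    rw [hu'] at h1
    have h2 := TubeLine.angle_starProjection_le h1 (hPT p'.1 (by rw [← hk']; exact hp'))
    linarith

end IsPruned

end

/-! ### The choice of the parameters -/

section

variable {δ ρ : ℝ}

/-- What is used about small `δ`: `A = δ ^ (-η)` exceeds constants and logarithms. -/
theorem eventually_scale {η e s : ℝ} (hη : 0 < η) (he : 0 < e) (hs : 0 < s) :
    ∀ᶠ δ : ℝ in 𝓝[>] 0, (0 < δ ∧ δ < 1) ∧ 10 ^ 40 ≤ δ ^ (-η) ∧ 16 * |Real.log δ| ≤ δ ^ (-η) ∧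
      1 ≤ |Real.log δ| ∧ δ ^ e ≤ s := by
  have h1 := (tendsto_rpow_neg_nhdsGT_zero (neg_neg_of_pos hη)).eventually_ge_atTop (10 ^ 40)
  have h2 := (isLittleO_log_rpow_nhdsGT_zero (neg_neg_of_pos hη)).bound
    (show (0 : ℝ) < 1 / 16 by norm_num)
  have h3 := Real.tendsto_log_nhdsGT_zero.eventually_le_atBot (-1)
  have h4 := (tendsto_rpow_neg_nhdsGT_zero (neg_neg_of_pos he)).eventually_ge_atTop s⁻¹
  filter_upwards [eventually_small, h1, h2, h3, h4] with δ hδ h1 h2 h3 h4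
  refine ⟨hδ, h1, ?_, ?_, ?_⟩
  · rw [Real.norm_eq_abs, Real.norm_eq_abs, abs_of_pos (Real.rpow_pos_of_pos hδ.1 _)] at h2
    linarith
  · rw [abs_of_nonpos (by linarith)]
    linarith
  · rw [Real.rpow_neg hδ.1.le] at h4
    exact (inv_le_inv₀ hs (Real.rpow_pos_of_pos hδ.1 e)).mp h4

/-- The number of dyadic ranges of multiplicities is at most `A`, since there are at most `δ⁻⁴`
tubes. -/
theorem ShadedTubes.IsSticky.log_card_le {A : ℝ} {K : ℕ} {𝒯 : ShadedTubes δ} (h : 𝒯.IsSticky K)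
    (hδ : 0 < δ) (hδ1 : δ < 1) (hKA : (K : ℝ) ≤ A) (hA : 10 ^ 40 ≤ A) (hAδ : A ^ 2 * δ ≤ 1)
    (hlog : 16 * |Real.log δ| ≤ A) : ((Nat.log 2 𝒯.tubes.card + 1 : ℕ) : ℝ) ≤ A := by
  have hA0 : 0 < A := lt_of_lt_of_le (by norm_num) hA
  have hlogδ : Real.log δ < 0 := Real.log_neg hδ hδ1
  rw [abs_of_neg hlogδ] at hlog
  have h1 : (𝒯.tubes.card : ℝ) ≤ 1 / δ ^ 4 := by
    refine (h.card_tubes_le hδ hδ1.le hKA).trans ?_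
    rw [le_div_iff₀ (by positivity)]
    calc A * (10 ^ 8 / δ ^ 3) * δ ^ 4 = 10 ^ 8 * A * δ := by field_simp
      _ ≤ A * A * δ := by
          gcongr
          exact le_trans (by norm_num) hA
      _ = A ^ 2 * δ := by ring
      _ ≤ 1 := hAδ
  have h2 : Real.log 𝒯.tubes.card ≤ 4 * -Real.log δ := by
    rcases Nat.eq_zero_or_pos 𝒯.tubes.card with h0 | h0
    · rw [h0, Nat.cast_zero, Real.log_zero]
      linarith
    · have := Real.log_le_log (Nat.cast_pos.mpr h0) h1
      rw [one_div, Real.log_inv, Real.log_pow] at this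
      push_cast at this
      linarith
  have h3 := Real.natLog_le_logb 𝒯.tubes.card 2
  have h4 : (1 : ℝ) / 2 < Real.log 2 := by linarith [Real.log_two_gt_d9]
  have h5 : Real.logb (2 : ℕ) 𝒯.tubes.card ≤ 8 * -Real.log δ := by
    rw [Real.logb, Nat.cast_ofNat, div_le_iff₀ (by linarith)]
    nlinarith
  push_cast
  linarith

/-- The dichotomy for one collection at fixed scales; `A = δ^{-η}` dominates all constants and
logarithms, and `A¹³` is dominated by the power `η₀` of the scales `ρ` and `δ / ρ` at which the
lower bound for volumes is applied. -/
theorem wide_or_plany {e η η₀ : ℝ} (he : 0 < e) (he4 : e ≤ 1 / 4) (hη : 100 * η ≤ e ^ 3)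
    (hη₀ : 0 < η₀) (hηη₀ : 13 * η ≤ e * η₀) (hδ : 0 < δ) (hδ1 : δ < 1) (hA : 10 ^ 40 ≤ δ ^ (-η))
    (hlog : 16 * |Real.log δ| ≤ δ ^ (-η)) (hδe : δ ^ e ≤ 1 / 1000)
    (hlow : ∀ r, 0 < r → r ≤ δ ^ e → ∀ 𝒰 : ShadedTubes r, 𝒰.IsAdmissible η₀ η₀ →
      r ^ (sigma4 + e ^ 3) ≤ volume.real 𝒰.unionSet)
    {𝒯 : ShadedTubes δ} (h𝒯 : 𝒯.IsExtremal η) (hρ0 : 0 < ρ) (hρ : ρ ≤ δ ^ e)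
    (hδρ : δ / ρ ≤ δ ^ e) :
    (∃ 𝒯' : ShadedTubes δ, 𝒯'.IsRefinementBy (1 / 2) 𝒯 ∧ ∀ k ∈ 𝒯'.cubes,
      (100 : ℝ)⁻¹ * ((𝒯'.through k).card : ℝ) ^ 3 ≤
        ((𝒯'.wideTriples k ((100 : ℝ)⁻¹ * ρ ^ 2)).card : ℝ)) ∨
    ∃ (𝒯' : ShadedTubes δ) (𝒰 : ShadedTubes ρ),
      𝒯'.IsRefinementBy (δ ^ (2 * e ^ 3)) 𝒯 ∧ 𝒰.Covers 𝒯' ∧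
      (∀ T ∈ 𝒯'.tubes, ∃! U, U ∈ 𝒰.tubes ∧ U.CoversTube ρ T) ∧
      𝒰.IsExtremal e ∧
      (∀ U ∈ 𝒰.tubes, (𝒯'.coveredBy ρ U).RescalingIsExtremal ρ U e) ∧
      (∀ k ∈ 𝒰.cubes, ((𝒰.through k).card : ℝ) ≤ 100 * ρ ^ (-sigma4 - e)) ∧
      (∀ k ∈ 𝒯'.cubes, ∀ U ∈ 𝒰.tubes,
        (((𝒯'.coveredBy ρ U).through k).card : ℝ) ≤ 100 * (δ / ρ) ^ (-sigma4 - e)) ∧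
      (∃ μfine : ℝ, 0 < μfine ∧ ∀ U ∈ 𝒰.tubes, ∀ k ∈ (𝒯'.coveredBy ρ U).cubes,
        (100 : ℝ)⁻¹ * μfine ≤ (((𝒯'.coveredBy ρ U).through k).card : ℝ) ∧
          (((𝒯'.coveredBy ρ U).through k).card : ℝ) ≤ 100 * μfine) ∧
      𝒰.IsPlany 100 := by
  have hr0 : 0 < δ / ρ := div_pos hδ hρ0
  set A := δ ^ (-η) with hAdef
  have hA0 : 0 < A := lt_of_lt_of_le (by norm_num) hA
  have hApow : ∀ (n : ℕ) (a : ℝ), n * η ≤ a → A ^ n * δ ^ a ≤ 1 := fun n a hn => by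
    rw [hAdef, ← Real.rpow_mul_natCast hδ.le, ← Real.rpow_add hδ]
    exact Real.rpow_le_one hδ.le hδ1.le (by linarith)
  rcases wide_or_narrow 𝒯 hρ0 with ⟨J, hJ, hcard, hwide⟩ | ⟨J, hJ, hcard, hplane⟩
  · refine Or.inl ⟨𝒯.restrict J hJ, ShadedTubes.restrict_isRefinementBy hδ ?_, hwide⟩
    linarith
  right
  have hs := h𝒯.1.isSticky
  rw [← hAdef] at hs
  have hKA : (⌊A⌋₊ : ℝ) ≤ A := Nat.floor_le hA0.le
  have he3 : e ^ 3 ≤ e * (1 / 16) := by nlinarith [mul_pos he he]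
  have h3 : A ^ 3 * ρ ≤ 1 :=
    (mul_le_mul_of_nonneg_left hρ (by positivity)).trans (hApow 3 e (by push_cast; linarith))
  have h2 : A ^ 2 * δ ≤ 1 := by
    have := hApow 2 1 (by push_cast; linarith)
    rwa [Real.rpow_one] at this
  have hmass : 1 / (4 * A * δ ^ 4) ≤ (J.card : ℝ) := by
    have h1 := h𝒯.1.2.2
    rw [ShadedTubes.mass_eq hδ] at h1
    have h4 : A * δ ^ η = 1 := by
      rw [hAdef, ← Real.rpow_add hδ, neg_add_cancel, Real.rpow_zero]
    rw [div_le_iff₀ (by positivity)]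
    calc 1 = A * δ ^ η := h4.symm
      _ ≤ A * (𝒯.incidences.card * δ ^ 4) := by gcongr
      _ = 𝒯.incidences.card / 4 * (4 * A * δ ^ 4) := by ring
      _ ≤ J.card * (4 * A * δ ^ 4) := by gcongr
  have hδρ1 : 8 * δ ≤ ρ := by
    have := hδρ.trans hδe
    rw [div_le_iff₀ hρ0] at this
    linarith
  obtain ⟨u, μ, J₀, hJ₀, hpr⟩ := exists_isPruned hs hδ (by linarith) (hρ.trans hδe) hKA hA h3
    (Nat.lt_pow_succ_log_self (by norm_num) 𝒯.tubes.card)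
    (hs.log_card_le hδ hδ1 hKA hA h2 hlog) hJ hmass
  have hst : ∀ x, 0 < x → x ≤ δ ^ e → A ^ 13 ≤ x ^ (-η₀) := fun x hx hxe => by
    have h1 : x ^ η₀ ≤ δ ^ (e * η₀) := by
      rw [Real.rpow_mul hδ.le]
      exact Real.rpow_le_rpow hx.le hxe hη₀.le
    rw [Real.rpow_neg hx.le, ← one_div, le_div_iff₀ (Real.rpow_pos_of_pos hx _)]
    exact (mul_le_mul_of_nonneg_left h1 (by positivity)).trans
      (hApow 13 _ (by push_cast; linarith))
  have hxe : ∀ x, 0 < x → x ≤ δ ^ e → x ^ e ≤ (δ ^ e ^ 3) ^ 4 := fun x hx hxe => by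
    refine (Real.rpow_le_rpow hx.le hxe he.le).trans ?_
    rw [← Real.rpow_mul hδ.le, ← Real.rpow_mul_natCast hδ.le]
    refine Real.rpow_le_rpow_of_exponent_ge hδ hδ1.le ?_
    push_cast
    nlinarith [mul_pos he he]
  have hts := hpr.twoScaleBounds hs hδ hρ0 (hρ.trans hδe) (hδρ.trans hδe) hKA hA (σ := sigma4)
    (ζ := e ^ 3) (t := η₀) (by
      refine h𝒯.2.trans (le_of_eq ?_)
      rw [← Real.mul_rpow hρ0.le hr0.le, mul_div_cancel₀ _ hρ0.ne', hAdef, ← Real.rpow_add hδ]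
      congr 1
      ring) (hst ρ hρ0 hρ) (hst _ hr0 hδρ) (hlow ρ hρ0 hρ) (hlow _ hr0 hδρ)
  obtain ⟨𝒯', 𝒰, h1, h2, h3, h4, h5, h6, h7, h8, h9⟩ := hpr.exists_plany (e := e) hs hδ hρ0
    (hρ.trans hδe) (hδρ.trans hδe) hKA hA (pow_pos he 3) hts (by
      rw [mul_comm]
      exact hApow 100 _ (by push_cast; linarith)) (hxe ρ hρ0 hρ) (hxe _ hr0 hδρ) (fun k => by
      obtain ⟨P, hP, hPT⟩ := hplane k
      exact ⟨P, hP, fun T hT => hPT T (hJ₀ hT)⟩)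
  refine ⟨𝒯', 𝒰, h1, h2, h3, h4, fun U hU g h0 hg => ?_, h6, h7, h8, h9⟩
  obtain ⟨F, hF⟩ := exists_frame_of_motion g h0 hg ρ
  rw [hF]
  exact h5 U hU F

end

end StickyKakeya

end

theorem mainTheorem4 :
    -- `C` is the absolute constant behind every `≲`, `≳`, `∼`.
    ∃ C : ℝ, 0 < C ∧ ∀ ε : ℝ, 0 < ε → ∃ η : ℝ, 0 < η ∧ ∃ δ₀ : ℝ, 0 < δ₀ ∧
      ∀ δ : ℝ, 0 < δ → δ ≤ δ₀ →
      ∀ 𝒯 : StickyKakeya.ShadedTubes δ, 𝒯.IsExtremal η →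
      ∀ ρ : ℝ, δ ^ (1 - ε) ≤ ρ → ρ ≤ δ ^ ε →
        -- (a) the trilinear case
        (∃ 𝒯' : StickyKakeya.ShadedTubes δ, 𝒯'.IsRefinement C 𝒯 ∧
          ∀ k ∈ 𝒯'.cubes,
            C⁻¹ * ((𝒯'.through k).card : ℝ) ^ 3 ≤ ((𝒯'.wideTriples k (C⁻¹ * ρ ^ 2)).card : ℝ)) ∨
        -- (b) the plany case
        (∃ (𝒯' : StickyKakeya.ShadedTubes δ) (𝒰 : StickyKakeya.ShadedTubes ρ),
          𝒯'.IsRefinementBy (δ ^ (23 * η + 2 * ε ^ 3)) 𝒯 ∧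
          𝒰.Covers 𝒯' ∧
          -- (i)
          (∀ T ∈ 𝒯'.tubes, ∃! U, U ∈ 𝒰.tubes ∧ U.CoversTube ρ T) ∧
          -- (ii)
          𝒰.IsExtremal ε ∧
          -- (iii)
          (∀ U ∈ 𝒰.tubes, (𝒯'.coveredBy ρ U).RescalingIsExtremal ρ U ε) ∧
          -- (iv)
          (∀ k ∈ 𝒰.cubes, ((𝒰.through k).card : ℝ) ≤ C * ρ ^ (-StickyKakeya.sigma4 - ε)) ∧
          -- (v)
          (∀ k ∈ 𝒯'.cubes, ∀ U ∈ 𝒰.tubes,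
            (((𝒯'.coveredBy ρ U).through k).card : ℝ) ≤
              C * (δ / ρ) ^ (-StickyKakeya.sigma4 - ε)) ∧
          (∃ μfine : ℝ, 0 < μfine ∧
            ∀ U ∈ 𝒰.tubes, ∀ k ∈ (𝒯'.coveredBy ρ U).cubes,
              C⁻¹ * μfine ≤ (((𝒯'.coveredBy ρ U).through k).card : ℝ) ∧
              (((𝒯'.coveredBy ρ U).through k).card : ℝ) ≤ C * μfine) ∧
          -- (vi)
          𝒰.IsPlany C) := by
  refine ⟨100, by norm_num, fun ε hε => ?_⟩
  -- every conclusion weakens as `ε` grows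
  obtain ⟨e, he, he4, heε⟩ : ∃ e : ℝ, 0 < e ∧ e ≤ 1 / 4 ∧ e ≤ ε :=
    ⟨min ε (1 / 4), lt_min hε (by norm_num), min_le_right _ _, min_le_left _ _⟩
  have he3 : e ^ 3 ≤ ε ^ 3 := pow_le_pow_left₀ he.le heε 3
  obtain ⟨η₀, hη₀, s₀, hs₀, hlow⟩ := StickyKakeya.exists_volume_lower_bound (pow_pos he 3)
  obtain ⟨η, hη, hη1, hη2⟩ : ∃ η : ℝ, 0 < η ∧ 100 * η ≤ e ^ 3 ∧ 13 * η ≤ e * η₀ :=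
    ⟨min (e ^ 3 / 100) (e * η₀ / 13), lt_min (by positivity) (by positivity),
      by linarith [min_le_left (e ^ 3 / 100) (e * η₀ / 13)],
      by linarith [min_le_right (e ^ 3 / 100) (e * η₀ / 13)]⟩
  obtain ⟨δ₀, hδ₀, hsmall⟩ := mem_nhdsGT_iff_exists_Ioc_subset.mp
    (StickyKakeya.eventually_scale hη he (lt_min hs₀ (show (0 : ℝ) < 1 / 1000 by norm_num)))
  refine ⟨η, hη, δ₀, hδ₀, fun δ hδ hδδ₀ 𝒯 h𝒯 ρ hρl hρu => ?_⟩
  obtain ⟨⟨-, hδ1⟩, hA, hlog, hlog1, hδe⟩ := hsmall ⟨hδ, hδδ₀⟩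
  have hρ0 : 0 < ρ := (Real.rpow_pos_of_pos hδ _).trans_le hρl
  have hr0 : 0 < δ / ρ := div_pos hδ hρ0
  have hρe : ρ ≤ δ ^ e := hρu.trans (Real.rpow_le_rpow_of_exponent_ge hδ hδ1.le heε)
  have hre : δ / ρ ≤ δ ^ e := by
    rw [div_le_iff₀ hρ0]
    calc δ = δ ^ e * δ ^ (1 - e) := by
          rw [← Real.rpow_add hδ, add_sub_cancel, Real.rpow_one]
      _ ≤ δ ^ e * δ ^ (1 - ε) := by
          gcongr ?_ * ?_
          exact Real.rpow_le_rpow_of_exponent_ge hδ hδ1.le (by linarith)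
      _ ≤ δ ^ e * ρ := by gcongr
  have hδe1 : δ ^ e ≤ 1 := hδe.trans ((min_le_right _ _).trans (by norm_num))
  have hρ1 := hρe.trans hδe1
  have hr1 := hre.trans hδe1
  rcases StickyKakeya.wide_or_plany he he4 hη1 hη₀ hη2 hδ hδ1 hA hlog
    (hδe.trans (min_le_right _ _))
    (fun r hr hre => hlow r hr (hre.trans (hδe.trans (min_le_left _ _)))) h𝒯 hρ0 hρe hre with
    ⟨𝒯', h1, h2⟩ | ⟨𝒯', 𝒰, h1, h2, h3, h4, h5, h6, h7, h8, h9⟩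
  · refine Or.inl ⟨𝒯', ⟨h1.1, h1.2.1, le_trans ?_ h1.2.2⟩, h2⟩
    have hm : 0 ≤ 𝒯.mass := Finset.sum_nonneg fun T _ => MeasureTheory.measureReal_nonneg
    have hp : |Real.log δ| ^ (-(100 : ℝ)) ≤ 1 :=
      Real.rpow_le_one_of_one_le_of_nonpos hlog1 (by norm_num)
    refine mul_le_mul_of_nonneg_right ?_ hm
    linarith
  · refine Or.inr ⟨𝒯', 𝒰, ⟨h1.1, h1.2.1, le_trans ?_ h1.2.2⟩, h2, h3, h4.mono hρ0 hρ1 heε,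
      fun U hU => (h5 U hU).mono hr0 hr1 heε, fun k hk => (h6 k hk).trans ?_,
      fun k hk U hU => (h7 k hk U hU).trans ?_, h8, h9⟩
    · have hm : 0 ≤ 𝒯.mass := Finset.sum_nonneg fun T _ => MeasureTheory.measureReal_nonneg
      exact mul_le_mul_of_nonneg_right
        (Real.rpow_le_rpow_of_exponent_ge hδ hδ1.le (by linarith)) hm
    · gcongr 100 * ?_
      exact Real.rpow_le_rpow_of_exponent_ge hρ0 hρ1 (by linarith)
    · gcongr 100 * ?_
      exact Real.rpow_le_rpow_of_exponent_ge hr0 hr1 (by linarith)
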